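/- Let $n=r+m$, let $A,\bar Q\in\mathbb R^{n\times n}$ be symmetric with $A$ invertible, let $Q=\mathrm{diag}(0,S)$ with $S\in\mathbb R^{m\times m}$ symmetric negative definite, and let $B\in\mathbb R^{p\times n}$, where $p$ is the number of positive eigenvalues of $A$ (with multiplicity). For $\mathrm{Re}\,\xi>0$ and $\eta\ge 0$ put $M(\xi,\eta)=A^{-1}(\eta Q-\xi I)$. A right-stable matrix of a complex $n\times n$ matrix $M$ having exactly $k$ eigenvalues with negative real part (counted with algebraic multiplicity) is a full-rank $n\times k$ matrix $R$ with $MR=RS'$ for some $k\times k$ matrix $S'$ all of whose eigenvalues have negative real part. The matrix $B$ satisfies the Generalized Kreiss Condition if there is $c_K>0$ such that $$|\det(B\,R_M^S(\xi,\eta))|\ge c_K\qquad\text{for all }\eta\ge0,\ \mathrm{Re}\,\xi>0,$$ where $R_M^S(\xi,\eta)$ is any right-stable matrix of $M(\xi,\eta)$ with orthonormal columns. Assume that $B$ satisfies the Generalized Kreiss Condition. Then there is $\epsilon_0>0$ such that for every $T>0$ there is a constant $C>0$, which does not depend on $\epsilon$, with the following property. Let $0<\epsilon<\epsilon_0$,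 let $b\in L^2(0,T;\mathbb R^p)$, and let $U\in C([0,T];L^2(\mathbb R^+;\mathbb R^n))$, with boundary trace $U(0,\cdot)\in L^1(0,T;\mathbb R^n)$, be a weak solution of $$\partial_tU+A\,\partial_xU=\tfrac1\epsilon QU+\bar QU\quad(x>0,\ 0<t<T),\qquad BU(0,t)=b(t),\qquad U(x,0)=0,$$ that is, $BU(0,t)=b(t)$ for almost every $t\in(0,T)$, and for all $\varphi\in C_c^\infty(\mathbb R^2;\mathbb R^n)$ supported in $\{(t,x):t<T\}$ $$\int_0^T\!\!\int_0^\infty\Big(\partial_t\varphi^TU+\partial_x\varphi^TAU+\varphi^T\big(\tfrac1\epsilon Q+\bar Q\big)U\Big)\,dx\,dt+\int_0^T\varphi(t,0)^TA\,U(0,t)\,dt=0 .$$ Then $U(0,\cdot)\in L^2(0,T;\mathbb R^n)$, and for every $t\in[0,T]$ $$\|U(\cdot,t)\|_{L^2(\mathbb R^+)}^2+\int_0^T|U(0,s)|^2\,ds\le C\int_0^T|b(s)|^2\,ds .$$ -/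

import Mathlib

open MeasureTheory Set
open scoped Matrix ContDiff

/-- The number of positive eigenvalues of a real matrix, with algebraic multiplicity. -/
noncomputable def numPosEigenvalues {ι : Type*} [Fintype ι] [DecidableEq ι]
    (A : Matrix ι ι ℝ) : ℕ :=
  (A.charpoly.roots.filter fun a : ℝ => 0 < a).card

/-- The number of stable eigenvalues (those with negative real part) of a complex matrix, with
algebraic multiplicity. -/
noncomputable def numStableEigenvalues {ι : Type*} [Fintype ι] [DecidableEq ι]
    (M : Matrix ι ι ℂ) : ℕ :=
  (M.charpoly.roots.filter fun z : ℂ => z.re < 0).card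

/-- A stable matrix: all eigenvalues have negative real part. -/
def IsStableMatrix {κ : Type*} [Fintype κ] [DecidableEq κ] (S : Matrix κ κ ℂ) : Prop :=
  ∀ z ∈ spectrum ℂ S, z.re < 0

/-- `R` is a right-stable matrix of `M`: `M` has precisely `k` stable eigenvalues, the
matrix `R` with `k` columns has full rank, and `M R = R S` for some stable `k × k` matrix `S`. -/
structure IsRightStableMatrix {ι : Type*} [Fintype ι] [DecidableEq ι] {k : ℕ}
    (M : Matrix ι ι ℂ) (R : Matrix ι (Fin k) ℂ) : Prop where
  numStable : numStableEigenvalues M = k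
  fullRank : R.rank = k
  invariant : ∃ S : Matrix (Fin k) (Fin k) ℂ, IsStableMatrix S ∧ M * R = R * S

/-- The matrix `M(ξ, η) = A⁻¹ (η Q - ξ I)`. -/
noncomputable def symbolMatrix {ι : Type*} [Fintype ι] [DecidableEq ι]
    (A Q : Matrix ι ι ℝ) (ξ : ℂ) (η : ℝ) : Matrix ι ι ℂ :=
  (A.map ((↑) : ℝ → ℂ))⁻¹ * ((η : ℂ) • Q.map ((↑) : ℝ → ℂ) - ξ • (1 : Matrix ι ι ℂ))

/-- The generalized Kreiss condition: `|det (B R)|` is bounded below by a positive constant for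
the right-stable matrices `R` of `M(ξ, η)`, uniformly in `η ≥ 0` and `Re ξ > 0`.

A right-stable matrix is determined only up to multiplication by an invertible matrix from the
right, so it is normalized to have orthonormal columns; then `|det (B R)|` depends only on
`(ξ, η)`. -/
def GeneralizedKreissCondition {ι : Type*} [Fintype ι] [DecidableEq ι] {p : ℕ}
    (A Q : Matrix ι ι ℝ) (B : Matrix (Fin p) ι ℝ) : Prop :=
  ∃ c : ℝ, 0 < c ∧ ∀ (η : ℝ) (ξ : ℂ), 0 ≤ η → 0 < ξ.re →
    ∀ R : Matrix ι (Fin p) ℂ, IsRightStableMatrix (symbolMatrix A Q ξ η) R → Rᴴ * R = 1 →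
      c ≤ ‖(B.map ((↑) : ℝ → ℂ) * R).det‖

/-- The space `L²(ℝ⁺; ℝ^ι)`. -/
abbrev HalfLineL2 (ι : Type*) [Fintype ι] : Type _ :=
  Lp (EuclideanSpace ℝ ι) 2 (volume.restrict (Ioi (0 : ℝ)))

/-- `U ∈ C([0, T]; L²(ℝ⁺))` with boundary trace `g = U(0, ·) ∈ L¹(0, T)` is a weak solution on
`[0, T]` of
`∂ₜ U + A ∂ₓ U = Q U / ε + Qbar U` for `x > 0`, `B U(0, t) = b(t)`, `U(x, 0) = U₀(x)`.
Test functions `φ(t, x)` need not vanish at `x = 0` or at `t = 0`, so that the integral identity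
contains the boundary values and the initial values. -/
structure IsRelaxationSolution {ι : Type*} [Fintype ι] [DecidableEq ι] {p : ℕ}
    (A Q Qbar : Matrix ι ι ℝ) (B : Matrix (Fin p) ι ℝ) (ε T : ℝ)
    (b : ℝ → EuclideanSpace ℝ (Fin p)) (U₀ : HalfLineL2 ι)
    (U : ℝ → HalfLineL2 ι) (g : ℝ → EuclideanSpace ℝ ι) : Prop where
  continuousOn : ContinuousOn U (Icc 0 T)
  integrableOn_trace : IntegrableOn g (Ioo 0 T)
  weak : ∀ φ : ℝ × ℝ → EuclideanSpace ℝ ι, ContDiff ℝ ∞ φ → HasCompactSupport φ →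
    tsupport φ ⊆ {z | z.1 < T} →
    (∫ t in Ioo 0 T, ∫ x in Ioi (0 : ℝ),
        (inner ℝ (fderiv ℝ φ (t, x) (1, 0)) (U t x)
          + inner ℝ (fderiv ℝ φ (t, x) (0, 1)) (A.toEuclideanLin (U t x))
          + inner ℝ (φ (t, x)) ((ε⁻¹ • Q + Qbar).toEuclideanLin (U t x))))
      + (∫ t in Ioo 0 T, inner ℝ (φ (t, 0)) (A.toEuclideanLin (g t)))
      + (∫ x in Ioi (0 : ℝ), inner ℝ (φ (0, x)) (U₀ x)) = 0
  boundary : ∀ᵐ t ∂(volume.restrict (Ioo 0 T)), B.toEuclideanLin (g t) = b t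

/-!
The boundary trace `g = U(0, ·)` is estimated by `b` on the Laplace side, and the solution by its
trace through the energy identity. With `η = 1 / ε` and `H = η Q + Qbar`, all constants have to be
uniform in `η ≥ 0`.

*The Laplace-transformed problem.* A solution cut off near time `T` and transformed in time solves
`A V' = (H - ξ) V` on the half-line, up to a forcing due to the cutoff. Let the stable subspace of
a matrix `M` be the space of initial values of exponentially decaying solutions of `V' = M V`
(`stableSpace`). For `A M = D` with `D` dissipative, the form `⟪V, A V⟫` is monotone along solutions,
whence the stable subspace has dimension `p`, and it is the annihilator of `A Z(0)`, for `Z` decaying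
solutions of the adjoint system (`finrank_stableSpace_eq`, `orthogonal_stableSpace`). By Cramer's
rule, the Kreiss condition says that `|v| ≤ c |B v|` on the stable subspaces of `M(ξ, η)`
(`GeneralizedKreissCondition.exists_norm_le`). The bounded perturbation `Qbar` turns
these subspaces by an angle of order `(Re ξ)^(-1/2)`, uniformly in `η`, because both the pairing
`⟪A Z, V⟫` of a perturbed solution with an unperturbed adjoint solution and the forms of `A`
are controlled by the dissipation (`norm_inner_le_of_mem_stableSpace`). So for `Re ξ > γ₀` the bound
persists for `A⁻¹ (H - ξ)`: boundary values have a unique stable lift `r(ξ)`, bounded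
uniformly in `ξ` and `η`. The lift is holomorphic in `ξ`
(`exists_differentiableOn_stable_lift`): the equations `⟪A Z(0), v⟫ = 0` of the stable subspace expand
to second order in `ξ`, the first-order term being given by a resonant solution of the adjoint
system. These facts are collected in `exists_uniform_boundary_lift`.

*The trace.* Pairing the transformed equation with decaying adjoint solutions shows that the
transform of the cut off trace equals `r(ξ)` applied to the transform of `b`, up to an error
`O(e^(-T' Re ξ))`, where the cutoff acts after time `T'` (`exists_norm_inner_average_le`). The pairing
of `g` with a test function supported before `T'` is an integral over a vertical line in `ξ`.
When the line moves to the right, the error disappears, while the part with `r` is unchanged by Cauchy's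
theorem; on a fixed line, Plancherel's theorem bounds it by the `L²` norms of `b` and of the test
function (`norm_integral_mul_le_of_laplace`). By duality, `g` is in `L²` with norm at most
`C e^((γ₀ + 1) T)` times that of `b` (`norm_integral_mul_inner_trace_le`).

*The solution.* Averages of `U` over short times have a weak derivative in `x` in `L²`, so that they
satisfy the energy identity on the half-line; Gronwall's inequality and passage to the limit bound
`|U(t)|²` by the integral of `|g|²` (`sq_norm_le_integral_trace`). Since `Q ≤ 0`, the growth rate
depends only on `Qbar`.
-/

open Filter Topology


/-! ### Exponentially decaying solutions and stable subspaces -/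

section StableSpace

/-- The function `V` decays exponentially on the half-line `x ≥ 0`. -/
def ExpDecay {E : Type*} [NormedAddCommGroup E] (V : ℝ → E) : Prop :=
  ∃ C c : ℝ, 0 < c ∧ ∀ x, 0 ≤ x → ‖V x‖ ≤ C * Real.exp (-c * x)

namespace ExpDecay

variable {E F G : Type*} [NormedAddCommGroup E] [NormedAddCommGroup F] [NormedAddCommGroup G]

theorem mono {V : ℝ → E} {W : ℝ → F} (hV : ExpDecay V) {K : ℝ} (h : ∀ x, ‖W x‖ ≤ K * ‖V x‖) :
    ExpDecay W := by
  obtain ⟨C, c, hc, hC⟩ := hV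
  refine ⟨|K| * C, c, hc, fun x hx => (h x).trans ?_⟩
  calc K * ‖V x‖ ≤ |K| * ‖V x‖ := by gcongr; exact le_abs_self K
    _ ≤ |K| * (C * Real.exp (-c * x)) := by gcongr; exact hC x hx
    _ = _ := by ring

theorem add {V W : ℝ → E} (hV : ExpDecay V) (hW : ExpDecay W) :
    ExpDecay (fun x => V x + W x) := by
  obtain ⟨C, c, hc, hC⟩ := hV
  obtain ⟨D, d, hd, hD⟩ := hW
  refine ⟨|C| + |D|, min c d, lt_min hc hd, fun x hx => (norm_add_le _ _).trans ?_⟩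
  have h1 : Real.exp (-c * x) ≤ Real.exp (-(min c d) * x) := by
    gcongr; exact min_le_left c d
  have h2 : Real.exp (-d * x) ≤ Real.exp (-(min c d) * x) := by
    gcongr; exact min_le_right c d
  calc ‖V x‖ + ‖W x‖ ≤ C * Real.exp (-c * x) + D * Real.exp (-d * x) :=
        add_le_add (hC x hx) (hD x hx)
    _ ≤ |C| * Real.exp (-c * x) + |D| * Real.exp (-d * x) := by
        gcongr <;> exact le_abs_self _
    _ ≤ |C| * Real.exp (-(min c d) * x) + |D| * Real.exp (-(min c d) * x) := by gcongr
    _ = _ := by ring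

theorem tendsto {V : ℝ → E} (hV : ExpDecay V) : Tendsto V atTop (𝓝 0) := by
  obtain ⟨C, c, hc, hC⟩ := hV
  have h0 : Tendsto (fun x : ℝ => C * Real.exp (-c * x)) atTop (𝓝 0) := by
    have : Tendsto (fun x : ℝ => Real.exp (-c * x)) atTop (𝓝 0) :=
      Real.tendsto_exp_atBot.comp (tendsto_id.const_mul_atTop_of_neg (by linarith))
    simpa using this.const_mul C
  refine squeeze_zero_norm' ?_ h0
  filter_upwards [eventually_ge_atTop 0] with x hx using hC x hx

/-- A product of two decaying functions decays. -/
theorem of_norm_le_mul {V : ℝ → E} {W : ℝ → F} {f : ℝ → G} (hV : ExpDecay V) (hW : ExpDecay W)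
    {K : ℝ} (h : ∀ x, ‖f x‖ ≤ K * (‖V x‖ * ‖W x‖)) : ExpDecay f := by
  obtain ⟨C, c, hc, hC⟩ := hV
  obtain ⟨D, d, hd, hD⟩ := hW
  refine ⟨|K| * (C * D), c + d, by positivity, fun x hx => (h x).trans ?_⟩
  have := (norm_nonneg _).trans (hC x hx)
  calc K * (‖V x‖ * ‖W x‖) ≤ |K| * (‖V x‖ * ‖W x‖) := by gcongr; exact le_abs_self K
    _ ≤ |K| * ((C * Real.exp (-c * x)) * (D * Real.exp (-d * x))) := by
        gcongr
        · exact hC x hx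
        · exact hD x hx
    _ = |K| * (C * D) * (Real.exp (-c * x) * Real.exp (-d * x)) := by ring
    _ = _ := by rw [← Real.exp_add]; ring_nf

end ExpDecay

/-- If the derivative of `f` is dominated by that of a decreasing function `k`, and both vanish at
infinity, then `f` is dominated by `k`. This replaces all integrations over the half-line in the
energy arguments. -/
theorem norm_le_of_norm_deriv_le_neg_deriv {F : Type*} [NormedAddCommGroup F] [NormedSpace ℝ F]
    {f f' : ℝ → F} {k k' : ℝ → ℝ} (hf : ∀ x, HasDerivAt f (f' x) x)
    (hk : ∀ x, HasDerivAt k (k' x) x) (h : ∀ x, 0 ≤ x → ‖f' x‖ ≤ -k' x)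
    (hf0 : Tendsto f atTop (𝓝 0)) (hk0 : Tendsto k atTop (𝓝 0)) : ‖f 0‖ ≤ k 0 := by
  have key : ∀ X : ℝ, 0 ≤ X → ‖f X - f 0‖ ≤ k 0 - k X := by
    intro X hX
    refine image_norm_le_of_norm_deriv_right_le_deriv_boundary (a := 0) (b := X)
      (f := fun x => f x - f 0) (f' := f') (B := fun x => k 0 - k x) (B' := fun x => -k' x)
      ?_ ?_ (by simp) ?_ ?_ ⟨hX, le_rfl⟩
    · exact fun x _ => ((hf x).continuousAt.sub continuousAt_const).continuousWithinAt
    · exact fun x _ => ((hf x).sub_const _).hasDerivWithinAt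
    · exact fun x => by simpa using (hk x).const_sub (k 0)
    · exact fun x hx => h x hx.1
  have h1 : Tendsto (fun X => ‖f X - f 0‖) atTop (𝓝 ‖(0 : F) - f 0‖) := (hf0.sub_const _).norm
  have h2 : Tendsto (fun X => k 0 - k X) atTop (𝓝 (k 0 - 0)) := hk0.const_sub _
  have := le_of_tendsto_of_tendsto h1 h2 ((eventually_ge_atTop 0).mono key)
  simpa using this

variable {E : Type*} [NormedAddCommGroup E] [NormedSpace ℂ E]

/-- `V` solves the linear system `V' = M V` on the line and decays exponentially at `+∞`. -/
structure IsStableOrbit (M : E →L[ℂ] E) (V : ℝ → E) : Prop where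
  hasDerivAt : ∀ x, HasDerivAt V (M (V x)) x
  decay : ExpDecay V

/-- The stable subspace of `M`: the initial values of the exponentially decaying solutions of
`V' = M V`. The unstable subspace is `stableSpace (-M)`. -/
def stableSpace (M : E →L[ℂ] E) : Submodule ℂ E where
  carrier := {v | ∃ V, IsStableOrbit M V ∧ V 0 = v}
  add_mem' := by
    rintro v w ⟨V, hV, rfl⟩ ⟨W, hW, rfl⟩
    refine ⟨fun x => V x + W x, ⟨fun x => ?_, hV.decay.add hW.decay⟩, rfl⟩
    simpa using (hV.hasDerivAt x).fun_add (hW.hasDerivAt x)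
  zero_mem' := ⟨fun _ => 0, ⟨fun x => by simpa using hasDerivAt_const x (0 : E),
    ⟨0, 1, one_pos, fun x _ => by simp⟩⟩, rfl⟩
  smul_mem' := by
    rintro c v ⟨V, hV, rfl⟩
    refine ⟨fun x => c • V x, ⟨fun x => ?_, hV.decay.mono (K := ‖c‖) fun x => ?_⟩, rfl⟩
    · simpa using (hV.hasDerivAt x).fun_const_smul c
    · rw [norm_smul]

theorem apply_mem_stableSpace {M : E →L[ℂ] E} {v : E} (hv : v ∈ stableSpace M) :
    M v ∈ stableSpace M := by
  obtain ⟨V, hV, rfl⟩ := hv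
  refine ⟨fun x => M (V x), ⟨fun x => ?_, hV.decay.mono fun x => M.le_opNorm _⟩, rfl⟩
  exact ((M.restrictScalars ℝ).hasFDerivAt (x := V x)).comp_hasDerivAt x (hV.hasDerivAt x)

/-- Generalized eigenvectors `v` of a stable eigenvalue `μ` are stable: the solution is
`e^{μ x} ∑ xʲ/j! (M - μ)ʲ v`. -/
theorem mem_stableSpace_of_pow_sub_smul_eq_zero {M : E →L[ℂ] E} {μ : ℂ} (hμ : μ.re < 0) {k : ℕ}
    {v : E} (hv : ((M - μ • 1) ^ k) v = 0) : v ∈ stableSpace M := by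
  set N : E →L[ℂ] E := M - μ • 1 with hN
  have hMN : ∀ w, M w = N w + μ • w := by intro w; simp [hN]
  set P : ℝ → E := fun x => ∑ j ∈ Finset.range k, (x ^ j / (j.factorial : ℝ)) • (N ^ j) v with hP
  have hPd : ∀ x, HasDerivAt P (N (P x)) x := by
    intro x
    have h1 : ∀ j : ℕ, HasDerivAt (fun x : ℝ => (x ^ j / (j.factorial : ℝ)) • (N ^ j) v)
        (((j : ℝ) * x ^ (j - 1) / (j.factorial : ℝ)) • (N ^ j) v) x := fun j =>
      ((hasDerivAt_pow j x).div_const _).smul_const _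
    have h2 := HasDerivAt.fun_sum (u := Finset.range k) fun j _ => h1 j
    convert h2 using 1
    have h3 : N (P x) = ∑ j ∈ Finset.range k, (x ^ j / (j.factorial : ℝ)) • (N ^ (j + 1)) v := by
      simp only [hP, map_sum]
      refine Finset.sum_congr rfl fun j _ => ?_
      rw [pow_succ' N j]
      exact (N.restrictScalars ℝ).map_smul _ _
    rw [h3]
    rcases k with _ | k
    · simp
    · rw [Finset.sum_range_succ, hv, smul_zero, add_zero, Finset.sum_range_succ']
      simp only [Nat.cast_zero, zero_mul, zero_div, zero_smul, add_zero]
      refine Finset.sum_congr rfl fun j _ => ?_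
      congr 1
      rw [Nat.factorial_succ]
      push_cast
      field_simp
  set e : ℝ → ℂ := fun x => Complex.exp (μ * x) with he
  have hed : ∀ x : ℝ, HasDerivAt e (μ * e x) x := by
    intro x
    have h1 : HasDerivAt (fun x : ℝ => μ * (x : ℂ)) μ x := by
      simpa using (Complex.ofRealCLM.hasDerivAt (x := x)).const_mul μ
    simpa [he, mul_comm] using h1.cexp
  refine ⟨fun x => e x • P x, ⟨fun x => ?_, ?_⟩, ?_⟩
  · have := (hed x).fun_smul (hPd x)
    convert this using 1
    rw [map_smul, hMN, smul_add, smul_smul, mul_comm μ]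
  · -- half of the decay rate absorbs the polynomial factor
    set δ : ℝ := -μ.re / 2 with hδ
    have hδ0 : 0 < δ := by rw [hδ]; linarith
    refine ⟨∑ j ∈ Finset.range k, ‖(N ^ j) v‖ / δ ^ j, δ, hδ0, fun x hx => ?_⟩
    have hP1 : ‖P x‖ ≤ Real.exp (δ * x) * ∑ j ∈ Finset.range k, ‖(N ^ j) v‖ / δ ^ j := by
      rw [Finset.mul_sum]
      refine (norm_sum_le _ _).trans (Finset.sum_le_sum fun j _ => ?_)
      rw [norm_smul, Real.norm_of_nonneg (by positivity)]
      have h4 : x ^ j / (j.factorial : ℝ) ≤ Real.exp (δ * x) / δ ^ j := by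
        rw [le_div_iff₀ (by positivity)]
        have := Real.pow_div_factorial_le_exp (δ * x) (by positivity) j
        calc x ^ j / (j.factorial : ℝ) * δ ^ j = (δ * x) ^ j / (j.factorial : ℝ) := by
              rw [mul_pow]; ring
          _ ≤ _ := this
      calc _ ≤ Real.exp (δ * x) / δ ^ j * ‖(N ^ j) v‖ := by gcongr
        _ = _ := by ring
    have he1 : ‖e x‖ = Real.exp (-δ * x) * Real.exp (-δ * x) := by
      rw [he, ← Real.exp_add]
      simp only [Complex.norm_exp, Complex.mul_re, Complex.ofReal_re, Complex.ofReal_im]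
      congr 1
      rw [hδ]; ring
    rw [norm_smul, he1]
    calc _ ≤ Real.exp (-δ * x) * Real.exp (-δ * x) *
          (Real.exp (δ * x) * ∑ j ∈ Finset.range k, ‖(N ^ j) v‖ / δ ^ j) := by gcongr
      _ = (∑ j ∈ Finset.range k, ‖(N ^ j) v‖ / δ ^ j) * Real.exp (-δ * x) *
          (Real.exp (-δ * x) * Real.exp (δ * x)) := by ring
      _ = _ := by rw [← Real.exp_add]; simp
  · rcases k with _ | k
    · have : v = 0 := by simpa using hv
      simp [hP, this]
    · simp [he, hP, Finset.sum_range_succ', zero_pow]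

/-- Without imaginary eigenvalues, the space is spanned by the generalized eigenvectors of stable and
of unstable eigenvalues. -/
theorem stableSpace_sup_stableSpace_neg [FiniteDimensional ℂ E] {M : E →L[ℂ] E}
    (hM : ∀ (μ : ℂ) (v : E), M v = μ • v → v ≠ 0 → μ.re ≠ 0) :
    stableSpace M ⊔ stableSpace (-M) = ⊤ := by
  rw [eq_top_iff, ← Module.End.iSup_maxGenEigenspace_eq_top (M : E →ₗ[ℂ] E)]
  refine iSup_le fun μ v hv => ?_
  have hcoe : ∀ k : ℕ, ∀ w, (((M : E →ₗ[ℂ] E) - μ • 1) ^ k) w = ((M - μ • 1) ^ k) w := by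
    intro k
    induction k with
    | zero => simp
    | succ k ih => intro w; rw [pow_succ', pow_succ']; simp [ih]
  obtain ⟨k, hk⟩ := (Module.End.mem_maxGenEigenspace _ _ _).1 hv
  rw [hcoe] at hk
  rcases lt_trichotomy μ.re 0 with h | h | h
  · exact Submodule.mem_sup_left (mem_stableSpace_of_pow_sub_smul_eq_zero h hk)
  · -- `μ` is not an eigenvalue, hence the generalized eigenspace is trivial
    have hinj : ∀ j : ℕ, ∀ w, ((M - μ • 1) ^ j) w = 0 → w = 0 := by
      intro j
      induction j with
      | zero => intro w hw; simpa using hw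
      | succ j ih =>
        intro w hw
        rw [pow_succ] at hw
        have h1 := ih _ hw
        by_contra hw0
        refine hM μ w ?_ hw0 h
        simpa [sub_eq_zero] using h1
    rw [hinj k v hk]
    exact Submodule.zero_mem _
  · refine Submodule.mem_sup_right
      (mem_stableSpace_of_pow_sub_smul_eq_zero (μ := -μ) (k := k) (by simpa using h) ?_)
    have : (-M - (-μ) • (1 : E →L[ℂ] E)) = -(M - μ • 1) := by simp; abel
    rw [this, neg_pow]
    rcases neg_one_pow_eq_or (E →L[ℂ] E) k with h' | h' <;> simp [h', hk]

end StableSpace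

/-! ### Stable subspaces of dissipative systems -/

section Dissipative

variable {E : Type*} [NormedAddCommGroup E] [InnerProductSpace ℂ E]

local notation "⟪" x ", " y "⟫" => inner ℂ x y

/-- The Hermitian form of `A` is positive definite on a subspace of dimension `p` and negative
definite on a subspace of the complementary dimension `q`. -/
structure HasSignature (A : E →L[ℂ] E) (p q : ℕ) : Prop where
  add_eq : p + q = Module.finrank ℂ E
  pos : ∃ P : Submodule ℂ E, Module.finrank ℂ P = p ∧ ∀ v ∈ P, v ≠ 0 → 0 < (⟪v, A v⟫).re
  neg : ∃ N : Submodule ℂ E, Module.finrank ℂ N = q ∧ ∀ v ∈ N, v ≠ 0 → (⟪v, A v⟫).re < 0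

theorem HasSignature.neg_left {A : E →L[ℂ] E} {p q : ℕ} (h : HasSignature A p q) :
    HasSignature (-A) q p := by
  obtain ⟨h1, ⟨P, hP, hP'⟩, ⟨N, hN, hN'⟩⟩ := h
  exact ⟨by omega, ⟨N, hN, fun v hv h0 => by simpa using hN' v hv h0⟩,
    ⟨P, hP, fun v hv h0 => by simpa using hP' v hv h0⟩⟩

theorem hasDerivAt_inner_apply {A : E →L[ℂ] E} (hA : ∀ v w, ⟪A v, w⟫ = ⟪v, A w⟫)
    {V W : ℝ → E} {V' W' : E} {x : ℝ} (hV : HasDerivAt V V' x) (hW : HasDerivAt W W' x) :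
    HasDerivAt (fun x => ⟪W x, A (V x)⟫) (⟪A W', V x⟫ + ⟪W x, A V'⟫) x := by
  have h1 : HasDerivAt (fun x => A (V x)) (A V') x :=
    ((A.restrictScalars ℝ).hasFDerivAt (x := V x)).comp_hasDerivAt x hV
  have := hW.inner ℂ h1
  rw [add_comm, ← hA] at this
  exact this

theorem ExpDecay.inner_apply {V W : ℝ → E} (hV : ExpDecay V) (hW : ExpDecay W) (A : E →L[ℂ] E) :
    ExpDecay (fun x => ⟪W x, A (V x)⟫) := by
  refine hW.of_norm_le_mul hV (K := ‖A‖) fun x => ?_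
  calc ‖⟪W x, A (V x)⟫‖ ≤ ‖W x‖ * ‖A (V x)‖ := norm_inner_le_norm _ _
    _ ≤ ‖W x‖ * (‖A‖ * ‖V x‖) := by gcongr; exact A.le_opNorm _
    _ = _ := by ring

theorem hasDerivAt_re_inner_apply {A : E →L[ℂ] E} (hA : ∀ v w, ⟪A v, w⟫ = ⟪v, A w⟫)
    {V : ℝ → E} {V' : E} {x : ℝ} (hV : HasDerivAt V V' x) :
    HasDerivAt (fun x => (⟪V x, A (V x)⟫).re) (2 * (⟪V x, A V'⟫).re) x := by
  have h := Complex.reCLM.hasFDerivAt.comp_hasDerivAt x (hasDerivAt_inner_apply hA hV hV)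
  refine h.congr_deriv ?_
  have : (⟪A V', V x⟫).re = (⟪V x, A V'⟫).re := by
    rw [← inner_conj_symm, Complex.conj_re]
  rw [Complex.reCLM_apply, Complex.add_re, this, two_mul]

theorem ExpDecay.re_inner_apply {V : ℝ → E} (hV : ExpDecay V) (A : E →L[ℂ] E) :
    Tendsto (fun x => (⟪V x, A (V x)⟫).re) atTop (𝓝 0) := by
  exact (Complex.continuous_re.tendsto 0).comp (hV.inner_apply hV A).tendsto

theorem abs_re_inner_apply_le (A : E →L[ℂ] E) (v : E) : |(⟪v, A v⟫).re| ≤ ‖A‖ * ‖v‖ ^ 2 := by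
  calc |(⟪v, A v⟫).re| ≤ ‖⟪v, A v⟫‖ := Complex.abs_re_le_norm _
    _ ≤ ‖v‖ * ‖A v‖ := norm_inner_le_norm _ _
    _ ≤ ‖v‖ * (‖A‖ * ‖v‖) := by gcongr; exact A.le_opNorm _
    _ = _ := by ring

/-- Lyapunov: for `A M = D` with `D` dissipative, the form of `A` is nonnegative on the stable
subspace of `M`, as it decreases to `0` along the solutions of `V' = M V`. -/
theorem re_inner_nonneg_of_mem_stableSpace {A D M : E →L[ℂ] E}
    (hA : ∀ v w, ⟪A v, w⟫ = ⟪v, A w⟫) (hM : ∀ v, A (M v) = D v)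
    (hD : ∀ v, (⟪v, D v⟫).re ≤ 0) {v : E} (hv : v ∈ stableSpace M) : 0 ≤ (⟪v, A v⟫).re := by
  obtain ⟨V, hV, rfl⟩ := hv
  have := norm_le_of_norm_deriv_le_neg_deriv (f := fun _ => (0 : ℝ)) (f' := fun _ => 0)
    (fun x => hasDerivAt_const x 0)
    (fun x => hasDerivAt_re_inner_apply hA (hV.hasDerivAt x)) (fun x _ => by
      have := hD (V x); rw [hM]; simp; linarith) tendsto_const_nhds (hV.decay.re_inner_apply A)
  simpa using this

/-- A bounded perturbation `K` of `D` rotates the stable subspace by an angle that is small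
compared with the dissipation `γ`: stable vectors of the perturbed system are nearly orthogonal to
the annihilator of the unperturbed stable subspace. -/
theorem norm_inner_le_of_mem_stableSpace {A D K M M' : E →L[ℂ] E} {κ γ : ℝ}
    (hA : ∀ v w, ⟪A v, w⟫ = ⟪v, A w⟫) (hM : ∀ v, A (M v) = D v + K v)
    (hM' : ∀ v w, ⟪A (M' v), w⟫ = -⟪v, D w⟫) (hγ : 0 < γ) (hK : ‖K‖ ≤ κ)
    (hD : ∀ v, (⟪v, D v⟫).re ≤ -γ * ‖v‖ ^ 2) (hDK : ∀ v, (⟪v, D v + K v⟫).re ≤ -γ * ‖v‖ ^ 2)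
    {v z : E} (hv : v ∈ stableSpace M) (hz : z ∈ stableSpace M') :
    ‖⟪A z, v⟫‖ ≤ κ * ‖A‖ / (4 * γ) * (‖v‖ ^ 2 + ‖z‖ ^ 2) := by
  obtain ⟨V, hV, rfl⟩ := hv
  obtain ⟨Z, hZ, rfl⟩ := hz
  have hκ : 0 ≤ κ := (norm_nonneg _).trans hK
  have hkV := fun x => hasDerivAt_re_inner_apply hA (hV.hasDerivAt x)
  have hkZ := fun x => hasDerivAt_re_inner_apply hA (hZ.hasDerivAt x)
  have key := norm_le_of_norm_deriv_le_neg_deriv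
    (fun x => hasDerivAt_inner_apply hA (hV.hasDerivAt x) (hZ.hasDerivAt x))
    (fun x => ((hkV x).sub (hkZ x)).const_mul (κ / (4 * γ))) (fun x _ => ?_)
    (hV.decay.inner_apply hZ.decay A).tendsto ?_
  · rw [hA]
    refine key.trans ?_
    have h1 := (abs_le.1 (abs_re_inner_apply_le A (V 0))).2
    have h2 := (abs_le.1 (abs_re_inner_apply_le A (Z 0))).1
    calc _ ≤ κ / (4 * γ) * (‖A‖ * ‖V 0‖ ^ 2 + ‖A‖ * ‖Z 0‖ ^ 2) := by
          refine mul_le_mul_of_nonneg_left ?_ (by positivity)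
          simp only [Pi.sub_apply]
          linarith
      _ = _ := by ring
  · have h1 : ⟪A (M' (Z x)), V x⟫ + ⟪Z x, A (M (V x))⟫ = ⟪Z x, K (V x)⟫ := by
      rw [hM', hM, inner_add_right]; ring
    have h2 : (⟪Z x, A (M' (Z x))⟫).re = -(⟪Z x, D (Z x)⟫).re := by
      rw [← inner_conj_symm, Complex.conj_re, hM', Complex.neg_re]
    rw [h1, hM, h2]
    have h3 := hD (Z x)
    have h4 := hDK (V x)
    calc ‖⟪Z x, K (V x)⟫‖ ≤ ‖Z x‖ * ‖K (V x)‖ := norm_inner_le_norm _ _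
      _ ≤ ‖Z x‖ * (κ * ‖V x‖) := by
          gcongr; exact (K.le_opNorm _).trans (by gcongr)
      _ ≤ κ / 2 * (‖V x‖ ^ 2 + ‖Z x‖ ^ 2) := by
          nlinarith [mul_nonneg hκ (sq_nonneg (‖V x‖ - ‖Z x‖))]
      _ = κ / (4 * γ) * (2 * (γ * ‖V x‖ ^ 2) + 2 * (γ * ‖Z x‖ ^ 2)) := by field_simp; ring
      _ ≤ κ / (4 * γ) * (2 * -(⟪V x, D (V x) + K (V x)⟫).re + 2 * -(⟪Z x, D (Z x)⟫).re) := by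
          gcongr <;> linarith
      _ = _ := by ring
  · have := ((hV.decay.re_inner_apply A).sub (hZ.decay.re_inner_apply A)).const_mul (κ / (4 * γ))
    simpa using this

variable [FiniteDimensional ℂ E]

/-- An eigenvector `v` of an imaginary eigenvalue `μ` would give `Re ⟪v, D v⟫ = Re (μ ⟪v, A v⟫) = 0`,
as `⟪v, A v⟫` is real. -/
theorem sup_stableSpace_eq_top_of_dissipative {A D M : E →L[ℂ] E}
    (hA : ∀ v w, ⟪A v, w⟫ = ⟪v, A w⟫) (hM : ∀ v, A (M v) = D v)
    (hD : ∀ v, v ≠ 0 → (⟪v, D v⟫).re < 0) : stableSpace M ⊔ stableSpace (-M) = ⊤ := by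
  refine stableSpace_sup_stableSpace_neg fun μ v hv h0 hμ => ?_
  have h1 := hD v h0
  have h2 : (⟪v, A v⟫).im = 0 := by
    rw [← Complex.conj_eq_iff_im, inner_conj_symm, hA]
  rw [← hM, hv, map_smul, inner_smul_right, Complex.mul_re, hμ, h2] at h1
  simp at h1

/-- The stable subspace meets the negative subspace of `A` trivially. -/
theorem finrank_stableSpace_le {A D M : E →L[ℂ] E} {p q : ℕ} (hsig : HasSignature A p q)
    (hA : ∀ v w, ⟪A v, w⟫ = ⟪v, A w⟫) (hM : ∀ v, A (M v) = D v)
    (hD : ∀ v, (⟪v, D v⟫).re ≤ 0) : Module.finrank ℂ (stableSpace M) ≤ p := by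
  obtain ⟨hpq, -, ⟨N, hNq, hN⟩⟩ := hsig
  have hdisj : stableSpace M ⊓ N = ⊥ := by
    refine (Submodule.eq_bot_iff _).2 fun v hv => ?_
    by_contra h0
    have := re_inner_nonneg_of_mem_stableSpace hA hM hD hv.1
    linarith [hN v hv.2 h0]
  have h1 := Submodule.finrank_sup_add_finrank_inf_eq (stableSpace M) N
  rw [hdisj, finrank_bot] at h1
  have h2 := Submodule.finrank_le (stableSpace M ⊔ N)
  omega

/-- The Lyapunov argument bounds the dimensions of the stable and of the unstable subspace, and
these two span; hence both bounds are attained. -/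
theorem finrank_stableSpace_eq {A D M : E →L[ℂ] E} {p q : ℕ} (hsig : HasSignature A p q)
    (hA : ∀ v w, ⟪A v, w⟫ = ⟪v, A w⟫) (hM : ∀ v, A (M v) = D v)
    (hD : ∀ v, v ≠ 0 → (⟪v, D v⟫).re < 0) :
    Module.finrank ℂ (stableSpace M) = p ∧ Module.finrank ℂ (stableSpace (-M)) = q ∧
      IsCompl (stableSpace M) (stableSpace (-M)) := by
  have hD' : ∀ v, (⟪v, D v⟫).re ≤ 0 := fun v => by
    rcases eq_or_ne v 0 with rfl | h
    · simp
    · exact (hD v h).le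
  have h1 := finrank_stableSpace_le hsig hA hM hD'
  have h2 := finrank_stableSpace_le (M := -M) (D := D) hsig.neg_left
    (fun v w => by simp [hA]) (fun v => by simp [hM]) hD'
  have h3 := sup_stableSpace_eq_top_of_dissipative hA hM hD
  have h4 := Submodule.finrank_sup_add_finrank_inf_eq (stableSpace M) (stableSpace (-M))
  rw [h3, finrank_top] at h4
  have h5 := hsig.add_eq
  refine ⟨by omega, by omega, ⟨?_, codisjoint_iff.2 h3⟩⟩
  rw [disjoint_iff, ← Submodule.finrank_eq_zero (R := ℂ)]
  omega

/-- The annihilator of the stable subspace consists of the initial values of the decaying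
solutions of the adjoint system: `⟪A Z, V⟫` is constant for `A V' = D V`, `A Z' = - D* Z`. -/
theorem orthogonal_stableSpace {A D M M' : E →L[ℂ] E} {p q : ℕ} (hsig : HasSignature A p q)
    (hA : ∀ v w, ⟪A v, w⟫ = ⟪v, A w⟫) (hAinj : Function.Injective A) (hM : ∀ v, A (M v) = D v)
    (hM' : ∀ v w, ⟪A (M' v), w⟫ = -⟪v, D w⟫)
    (hD : ∀ v, v ≠ 0 → (⟪v, D v⟫).re < 0) :
    (stableSpace M)ᗮ = (stableSpace M').map (A : E →ₗ[ℂ] E) := by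
  have hle : (stableSpace M').map (A : E →ₗ[ℂ] E) ≤ (stableSpace M)ᗮ := by
    rintro _ ⟨_, ⟨Z, hZ, rfl⟩, rfl⟩
    rw [Submodule.mem_orthogonal']
    rintro _ ⟨V, hV, rfl⟩
    have := norm_le_of_norm_deriv_le_neg_deriv (k := fun _ => (0 : ℝ)) (k' := fun _ => 0)
      (fun x => hasDerivAt_inner_apply hA (hV.hasDerivAt x) (hZ.hasDerivAt x))
      (fun x => hasDerivAt_const x 0) (fun x _ => by simp [hM', hM])
      (hV.decay.inner_apply hZ.decay A).tendsto tendsto_const_nhds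
    simpa [hA] using this
  symm
  refine Submodule.eq_of_le_of_finrank_eq hle ?_
  have h1 := (finrank_stableSpace_eq hsig hA hM hD).1
  have h2 : Module.finrank ℂ (stableSpace M') = q := by
    refine (finrank_stableSpace_eq (D := ContinuousLinearMap.adjoint D) (M := M') hsig.neg_left
      (fun v w => by simp [hA]) (fun v => ?_) (fun v hv => ?_)).1
    · refine ext_inner_right ℂ fun w => ?_
      rw [ContinuousLinearMap.adjoint_inner_left]
      simp [hM']
    · rw [ContinuousLinearMap.adjoint_inner_right, ← inner_conj_symm, Complex.conj_re]
      exact hD v hv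
  have h0 := (Submodule.equivMapOfInjective (A : E →ₗ[ℂ] E) hAinj (stableSpace M')).finrank_eq
  have h3 := Submodule.finrank_add_finrank_orthogonal (stableSpace M)
  have h4 := hsig.add_eq
  omega

/-- If `B` is bounded below on the stable subspace of the unperturbed system, with constant `c`,
it is bounded below on that of the perturbed one, with constant `2 c`, as soon as the dissipation
`γ` is large compared with the perturbation. -/
theorem norm_le_of_mem_stableSpace_perturbed {F : Type*} [NormedAddCommGroup F] [NormedSpace ℂ F]
    {A D K M₀ M M' : E →L[ℂ] E} {B : E →L[ℂ] F} {p q : ℕ} {κ γ c α : ℝ}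
    (hsig : HasSignature A p q)
    (hA : ∀ v w, ⟪A v, w⟫ = ⟪v, A w⟫) (hα : ∀ v, ‖v‖ ≤ α * ‖A v‖)
    (hM₀ : ∀ v, A (M₀ v) = D v) (hM : ∀ v, A (M v) = D v + K v)
    (hM' : ∀ v w, ⟪A (M' v), w⟫ = -⟪v, D w⟫) (hγ : 0 < γ) (hK : ‖K‖ ≤ κ)
    (hD : ∀ v, (⟪v, D v⟫).re ≤ -γ * ‖v‖ ^ 2) (hDK : ∀ v, (⟪v, D v + K v⟫).re ≤ -γ * ‖v‖ ^ 2)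
    (hc : 0 ≤ c) (hB : ∀ v ∈ stableSpace M₀, ‖v‖ ≤ c * ‖B v‖)
    (hsmall : (1 + c * ‖B‖) ^ 2 * (κ * ‖A‖ / (4 * γ) * (1 + α ^ 2)) ≤ 1 / 4)
    {v : E} (hv : v ∈ stableSpace M) : ‖v‖ ≤ 2 * c * ‖B v‖ := by
  have hD' : ∀ v, v ≠ 0 → (⟪v, D v⟫).re < 0 := fun v hv0 =>
    (hD v).trans_lt (by
      have := norm_pos_iff.2 hv0
      simp only [neg_mul, Left.neg_neg_iff]
      positivity)
  have hinj : Function.Injective A := by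
    refine (injective_iff_map_eq_zero A).2 fun v hv0 => ?_
    have := hα v
    rw [hv0, norm_zero, mul_zero] at this
    exact norm_le_zero_iff.1 this
  have hκ : 0 ≤ κ := (norm_nonneg _).trans hK
  -- the part `w` of `v` that is orthogonal to the unperturbed stable subspace is small
  set S := stableSpace M₀
  set u := (S.starProjection v : E)
  set w := v - u with hw
  have hwS : w ∈ Sᗮ := S.sub_starProjection_mem_orthogonal v
  have huS : u ∈ S := S.starProjection_apply_mem v
  obtain ⟨z, hz, hzw⟩ : ∃ z ∈ stableSpace M', A z = w := by
    have h := hwS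
    rw [orthogonal_stableSpace hsig hA hinj hM₀ hM' hD'] at h
    exact h
  have hvw : ⟪w, v⟫ = ⟪w, w⟫ := by
    have : ⟪w, u⟫ = 0 := S.inner_left_of_mem_orthogonal huS hwS
    rw [hw, inner_sub_right (𝕜 := ℂ) (v - u), ← hw, this, sub_zero]
  have hwv : ‖w‖ ≤ ‖v‖ := by
    rcases eq_or_ne w 0 with h | h
    · rw [h, norm_zero]; positivity
    · have h1 : ‖w‖ * ‖w‖ ≤ ‖w‖ * ‖v‖ := by
        rw [← inner_self_eq_norm_mul_norm (𝕜 := ℂ), ← hvw]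
        exact (Complex.re_le_norm _).trans (norm_inner_le_norm _ _)
      exact le_of_mul_le_mul_left h1 (norm_pos_iff.2 h)
  have hzn : ‖z‖ ^ 2 ≤ α ^ 2 * ‖v‖ ^ 2 := by
    have h1 := hα z
    rw [hzw] at h1
    have h2 : ‖z‖ ≤ |α| * ‖v‖ := h1.trans (mul_le_mul (le_abs_self _) hwv (norm_nonneg _)
      (abs_nonneg _))
    calc ‖z‖ ^ 2 ≤ (|α| * ‖v‖) ^ 2 := by gcongr
      _ = _ := by rw [mul_pow, sq_abs]
  have hw2 : ‖w‖ ^ 2 ≤ κ * ‖A‖ / (4 * γ) * (1 + α ^ 2) * ‖v‖ ^ 2 := by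
    have h1 := norm_inner_le_of_mem_stableSpace hA hM hM' hγ hK hD hDK hv hz
    rw [hzw, hvw, inner_self_eq_norm_sq_to_K, norm_pow, RCLike.norm_ofReal, abs_norm] at h1
    calc ‖w‖ ^ 2 ≤ κ * ‖A‖ / (4 * γ) * (‖v‖ ^ 2 + ‖z‖ ^ 2) := h1
      _ ≤ κ * ‖A‖ / (4 * γ) * (‖v‖ ^ 2 + α ^ 2 * ‖v‖ ^ 2) := by gcongr
      _ = _ := by ring
  have hw3 : (1 + c * ‖B‖) * ‖w‖ ≤ ‖v‖ / 2 := by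
    refine le_of_sq_le_sq ?_ (by positivity)
    calc ((1 + c * ‖B‖) * ‖w‖) ^ 2 = (1 + c * ‖B‖) ^ 2 * ‖w‖ ^ 2 := by ring
      _ ≤ (1 + c * ‖B‖) ^ 2 * (κ * ‖A‖ / (4 * γ) * (1 + α ^ 2) * ‖v‖ ^ 2) := by gcongr
      _ = (1 + c * ‖B‖) ^ 2 * (κ * ‖A‖ / (4 * γ) * (1 + α ^ 2)) * ‖v‖ ^ 2 := by ring
      _ ≤ 1 / 4 * ‖v‖ ^ 2 := by gcongr
      _ = _ := by ring
  have hu : ‖u‖ ≤ c * (‖B v‖ + ‖B‖ * ‖w‖) := by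
    refine (hB u huS).trans ?_
    gcongr
    have : B u = B v - B w := by rw [hw]; simp
    rw [this]
    exact (norm_sub_le _ _).trans (by gcongr; exact B.le_opNorm w)
  have hvu : ‖v‖ ≤ ‖u‖ + ‖w‖ := by
    have : v = u + w := by rw [hw]; abel
    calc ‖v‖ = ‖u + w‖ := by rw [← this]
      _ ≤ _ := norm_add_le _ _
  nlinarith

end Dissipative

/-! ### Holomorphic dependence on the spectral parameter -/

section Holomorphy

variable {E : Type*} [NormedAddCommGroup E] [InnerProductSpace ℂ E]

local notation "⟪" x ", " y "⟫" => inner ℂ x y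

/-- The resonant system `Z' = M Z`, `Y' = M Y + G Z` has a decaying solution for every stable
initial value of `Z`: the doubled system has the same eigenvalues as `M`. -/
theorem exists_resonant_orbit {E : Type*} [NormedAddCommGroup E] [NormedSpace ℂ E]
    [FiniteDimensional ℂ E] {M : E →L[ℂ] E} (G : E →L[ℂ] E)
    (hM : ∀ (μ : ℂ) (v : E), M v = μ • v → v ≠ 0 → μ.re ≠ 0)
    (hdisj : Disjoint (stableSpace M) (stableSpace (-M))) {z : E} (hz : z ∈ stableSpace M) :
    ∃ Y Z : ℝ → E, IsStableOrbit M Z ∧ Z 0 = z ∧ ExpDecay Y ∧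
      ∀ x, HasDerivAt Y (M (Y x) + G (Z x)) x := by
  set N : E × E →L[ℂ] E × E :=
    (M.comp (ContinuousLinearMap.fst ℂ E E) + G.comp (ContinuousLinearMap.snd ℂ E E)).prod
      (M.comp (ContinuousLinearMap.snd ℂ E E)) with hN
  have hN' : ∀ u : E × E, N u = (M u.1 + G u.2, M u.2) := fun u => by simp [hN]
  have hsnd : ∀ {L : E →L[ℂ] E} {K : E × E →L[ℂ] E × E} (_ : ∀ u, (K u).2 = L u.2) {V : ℝ → E × E},
      IsStableOrbit K V → IsStableOrbit L (fun x => (V x).2) := by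
    intro L K hK V hV
    refine ⟨fun x => ?_, hV.decay.mono (K := 1) fun x => ?_⟩
    · rw [← hK]
      exact (hV.hasDerivAt x).snd
    · rw [one_mul]; exact norm_snd_le _
  have htop := stableSpace_sup_stableSpace_neg (M := N) fun μ u hu h0 => by
    rw [hN', Prod.ext_iff] at hu
    rcases eq_or_ne u.2 0 with h | h
    · refine hM μ u.1 (by simpa [h] using hu.1) fun h1 => h0 (Prod.ext h1 h)
    · exact hM μ u.2 hu.2 h
  obtain ⟨a, ha, b, hb, hab⟩ := Submodule.mem_sup.1
    (htop ▸ Submodule.mem_top : ((0 : E), z) ∈ stableSpace N ⊔ stableSpace (-N))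
  obtain ⟨V, hV, rfl⟩ := ha
  obtain ⟨W, hW, rfl⟩ := hb
  have hV2 := hsnd (L := M) (fun u => by rw [hN']) hV
  have hW2 := hsnd (L := -M) (fun u => by simp [hN']) hW
  have h2 : (V 0).2 + (W 0).2 = z := (Prod.ext_iff.1 hab).2
  -- the unstable part of `(0, z)` has vanishing second component
  have hW0 : (W 0).2 = 0 := by
    refine Submodule.disjoint_def.1 hdisj _ ?_ ⟨_, hW2, rfl⟩
    rw [← eq_sub_iff_add_eq'] at h2
    rw [h2]
    exact Submodule.sub_mem _ hz ⟨_, hV2, rfl⟩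
  refine ⟨fun x => (V x).1, fun x => (V x).2, hV2, by rw [← h2, hW0, add_zero],
    hV.decay.mono (K := 1) fun x => by rw [one_mul]; exact norm_fst_le _, fun x => ?_⟩
  have h3 := (hV.hasDerivAt x).fst
  rw [hN'] at h3
  exact h3

/-- Second-order expansion in the spectral parameter of the equations `⟪A z, v⟫ = 0` that
characterize the stable subspace. The vector `y` comes from the resonant solution `Y`, which is the
formal derivative of the adjoint solution `Z` with respect to the parameter. -/
theorem exists_norm_inner_add_le [FiniteDimensional ℂ E] {A Ai H M' : E →L[ℂ] E}
    {M : ℂ → E →L[ℂ] E} {c γ₀ : ℝ} {ξ₀ : ℂ}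
    (hA : ∀ v w, ⟪A v, w⟫ = ⟪v, A w⟫) (hAi : ∀ v, A (Ai v) = v)
    (hH : ∀ v w, ⟪H v, w⟫ = ⟪v, H w⟫) (hM : ∀ ξ v, A (M ξ v) = H v - ξ • v)
    (hM' : ∀ v, A (M' v) = -(H v - (starRingEnd ℂ ξ₀) • v)) (hc : 0 < c)
    (hD : ∀ ξ : ℂ, γ₀ < ξ.re → ∀ v, (⟪v, H v - ξ • v⟫).re ≤ -c * ‖v‖ ^ 2)
    (hev : ∀ (μ : ℂ) (v : E), M' v = μ • v → v ≠ 0 → μ.re ≠ 0)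
    (hdisj : Disjoint (stableSpace M') (stableSpace (-M'))) {z : E} (hz : z ∈ stableSpace M') :
    ∃ (y : E) (K : ℝ), ∀ ξ : ℂ, γ₀ < ξ.re → ∀ v ∈ stableSpace (M ξ),
      ‖⟪A z, v⟫ + (ξ - ξ₀) * ⟪A y, v⟫‖ ≤ ‖ξ - ξ₀‖ ^ 2 * (K + ‖A‖ / (4 * c) * ‖v‖ ^ 2) := by
  obtain ⟨Y, Z, hZ, rfl, hY, hYd⟩ := exists_resonant_orbit Ai hev hdisj hz
  have hYdec := hY
  obtain ⟨CY, cY, hcY, hCY⟩ := hY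
  refine ⟨Y 0, CY ^ 2 / (4 * cY), fun ξ hξ v hv => ?_⟩
  obtain ⟨V, hV, rfl⟩ := hv
  set h := ξ - ξ₀ with hh
  have hkV := fun x => hasDerivAt_re_inner_apply hA (hV.hasDerivAt x)
  have hexp : ∀ x : ℝ, HasDerivAt (fun x : ℝ => Real.exp (-(2 * cY) * x))
      (Real.exp (-(2 * cY) * x) * -(2 * cY)) x := fun x => by
    simpa using ((hasDerivAt_id x).const_mul (-(2 * cY))).exp
  have key := norm_le_of_norm_deriv_le_neg_deriv
    (fun x => (hasDerivAt_inner_apply hA (hV.hasDerivAt x) (hZ.hasDerivAt x)).fun_add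
      ((hasDerivAt_inner_apply hA (hV.hasDerivAt x) (hYd x)).const_mul h))
    (fun x => (((hkV x).const_mul (1 / (4 * c))).fun_add
      ((hexp x).const_mul (CY ^ 2 / (4 * cY)))).const_mul (‖h‖ ^ 2)) (fun x hx => ?_) ?_ ?_
  · rw [hA, hA]
    refine key.trans ?_
    have h1 := (abs_le.1 (abs_re_inner_apply_le A (V 0))).2
    refine mul_le_mul_of_nonneg_left ?_ (by positivity)
    rw [mul_zero, Real.exp_zero, mul_one, add_comm]
    refine add_le_add le_rfl ?_
    calc 1 / (4 * c) * (⟪V 0, A (V 0)⟫).re ≤ 1 / (4 * c) * (‖A‖ * ‖V 0‖ ^ 2) := by gcongr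
      _ = _ := by ring
  · have e1 : ⟪A (M' (Z x)), V x⟫ + ⟪Z x, A (M ξ (V x))⟫ = -h * ⟪Z x, V x⟫ := by
      rw [hM', hM, inner_neg_left, inner_sub_left, inner_sub_right, inner_smul_left,
        inner_smul_right, hH, Complex.conj_conj, hh]
      ring
    have e2 : ⟪A (M' (Y x) + Ai (Z x)), V x⟫ + ⟪Y x, A (M ξ (V x))⟫
        = -h * ⟪Y x, V x⟫ + ⟪Z x, V x⟫ := by
      rw [map_add, hAi, hM', hM, inner_add_left, inner_neg_left, inner_sub_left, inner_sub_right,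
        inner_smul_left, inner_smul_right, hH, Complex.conj_conj, hh]
      ring
    rw [e1, e2, hM]
    have h3 : ‖Y x‖ ^ 2 ≤ CY ^ 2 * Real.exp (-(2 * cY) * x) := by
      calc ‖Y x‖ ^ 2 ≤ (CY * Real.exp (-cY * x)) ^ 2 := by gcongr; exact hCY x hx
        _ = CY ^ 2 * (Real.exp (-cY * x) * Real.exp (-cY * x)) := by ring
        _ = _ := by rw [← Real.exp_add]; ring_nf
    have h4 := hD ξ hξ (V x)
    calc ‖-h * ⟪Z x, V x⟫ + h * (-h * ⟪Y x, V x⟫ + ⟪Z x, V x⟫)‖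
        = ‖h‖ ^ 2 * ‖⟪Y x, V x⟫‖ := by
          rw [← norm_pow, ← norm_mul, ← norm_neg]; congr 1; ring
      _ ≤ ‖h‖ ^ 2 * (‖Y x‖ * ‖V x‖) := by gcongr; exact norm_inner_le_norm _ _
      _ ≤ ‖h‖ ^ 2 * (1 / (2 * c) * (c * ‖V x‖ ^ 2) + 1 / 2 * ‖Y x‖ ^ 2) := by
          gcongr
          have : 1 / (2 * c) * (c * ‖V x‖ ^ 2) = 1 / 2 * ‖V x‖ ^ 2 := by field_simp
          rw [this]
          nlinarith [sq_nonneg (‖V x‖ - ‖Y x‖)]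
      _ ≤ ‖h‖ ^ 2 * (1 / (2 * c) * -(⟪V x, H (V x) - ξ • V x⟫).re
            + 1 / 2 * (CY ^ 2 * Real.exp (-(2 * cY) * x))) := by
          gcongr; linarith
      _ = _ := by field_simp; ring
  · have := ((hV.decay.inner_apply hZ.decay A).tendsto).add
      ((hV.decay.inner_apply hYdec A).tendsto.const_mul h)
    simpa using this
  · have h5 : Tendsto (fun x : ℝ => Real.exp (-(2 * cY) * x)) atTop (𝓝 0) :=
      Real.tendsto_exp_atBot.comp (tendsto_id.const_mul_atTop_of_neg (by linarith))
    have := ((((hV.decay.re_inner_apply A).const_mul (1 / (4 * c))).add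
      (h5.const_mul (CY ^ 2 / (4 * cY)))).const_mul (‖h‖ ^ 2))
    simpa using this

variable {F : Type*} [NormedAddCommGroup F] [InnerProductSpace ℂ F]

/-- A subspace containing the annihilator of `S` and the range of `B*` is everything when `B` is
injective on `S`. -/
theorem eq_top_of_orthogonal_le_of_adjoint_mem [FiniteDimensional ℂ E] [FiniteDimensional ℂ F]
    {B : E →L[ℂ] F} {S T : Submodule ℂ E}
    (hB : ∀ v ∈ S, B v = 0 → v = 0) (h1 : Sᗮ ≤ T)
    (h2 : ∀ y, ContinuousLinearMap.adjoint B y ∈ T) : T = ⊤ := by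
  rw [← Submodule.orthogonal_eq_bot_iff, Submodule.eq_bot_iff]
  intro v hv
  refine hB v ?_ ?_
  · rw [← Submodule.orthogonal_orthogonal S]
    exact Submodule.orthogonal_le h1 hv
  · refine ext_inner_left ℂ fun y => ?_
    rw [← ContinuousLinearMap.adjoint_inner_left, inner_zero_right]
    exact (Submodule.mem_orthogonal T v).1 hv _ (h2 y)

/-- If `B` is uniformly bounded below on the stable subspaces of `M(ξ)`, `A M(ξ) = H - ξ`, then
the boundary value `β` has a unique lift to the stable subspace, and the lift depends
holomorphically on `ξ`. -/
theorem exists_differentiableOn_stable_lift [FiniteDimensional ℂ E] [FiniteDimensional ℂ F]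
    {A Ai H : E →L[ℂ] E} {B : E →L[ℂ] F} {M : ℂ → E →L[ℂ] E} {p q : ℕ} {c C γ₀ : ℝ}
    (hsig : HasSignature A p q) (hF : Module.finrank ℂ F = p)
    (hA : ∀ v w, ⟪A v, w⟫ = ⟪v, A w⟫) (hAi : ∀ v, A (Ai v) = v) (hAi' : ∀ v, Ai (A v) = v)
    (hH : ∀ v w, ⟪H v, w⟫ = ⟪v, H w⟫) (hM : ∀ ξ v, A (M ξ v) = H v - ξ • v) (hc : 0 < c)
    (hD : ∀ ξ : ℂ, γ₀ < ξ.re → ∀ v, (⟪v, H v - ξ • v⟫).re ≤ -c * ‖v‖ ^ 2)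
    (hB : ∀ ξ : ℂ, γ₀ < ξ.re → ∀ v ∈ stableSpace (M ξ), ‖v‖ ≤ C * ‖B v‖) (β : F) :
    ∃ r : ℂ → E, (∀ ξ : ℂ, γ₀ < ξ.re → r ξ ∈ stableSpace (M ξ) ∧ B (r ξ) = β) ∧
      ∀ w, DifferentiableOn ℂ (fun ξ => ⟪w, r ξ⟫) {ξ | γ₀ < ξ.re} := by
  have hinj : Function.Injective A := Function.LeftInverse.injective hAi'
  have hD' : ∀ ξ : ℂ, γ₀ < ξ.re → ∀ v, v ≠ 0 → (⟪v, H v - ξ • v⟫).re < 0 := fun ξ hξ v hv0 =>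
    (hD ξ hξ v).trans_lt
      (by have := norm_pos_iff.2 hv0; simp only [neg_mul, Left.neg_neg_iff]; positivity)
  have hex : ∀ ξ : ℂ, ∃ v : E, γ₀ < ξ.re → v ∈ stableSpace (M ξ) ∧ B v = β := by
    intro ξ
    by_cases hξ : γ₀ < ξ.re
    · have hfr := (finrank_stableSpace_eq (D := H - ξ • 1) (M := M ξ) hsig hA
        (fun v => by simp [hM]) (fun v hv => by simpa using hD' ξ hξ v hv)).1
      have hsurj : Function.Surjective ((B : E →ₗ[ℂ] F).domRestrict (stableSpace (M ξ))) := by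
        rw [← LinearMap.injective_iff_surjective_of_finrank_eq_finrank (hfr.trans hF.symm)]
        refine (injective_iff_map_eq_zero _).2 fun v hv => ?_
        have h1 := hB ξ hξ v v.2
        have h2 : B v = 0 := hv
        rw [h2, norm_zero, mul_zero] at h1
        exact Subtype.ext (norm_le_zero_iff.1 h1)
      obtain ⟨v, hv⟩ := hsurj β
      exact ⟨v, fun _ => ⟨v.2, hv⟩⟩
    · exact ⟨0, fun h => absurd h hξ⟩
  choose r hr using hex
  refine ⟨r, hr, fun w ξ₀ hξ₀ => DifferentiableAt.differentiableWithinAt ?_⟩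
  have hopen : ∀ᶠ ξ : ℂ in 𝓝 ξ₀, γ₀ < ξ.re :=
    (isOpen_lt continuous_const Complex.continuous_re).mem_nhds hξ₀
  set R := C * ‖β‖
  have hR : ∀ ξ : ℂ, γ₀ < ξ.re → ‖r ξ‖ ≤ R := fun ξ hξ => by
    have := hB ξ hξ _ (hr ξ hξ).1
    rwa [(hr ξ hξ).2] at this
  have hBinj : ∀ v ∈ stableSpace (M ξ₀), B v = 0 → v = 0 := fun v hv h => by
    have h1 := hB ξ₀ hξ₀ v hv
    rw [h, norm_zero, mul_zero] at h1
    exact norm_le_zero_iff.1 h1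
  -- the adjoint system at `ξ₀`; its decaying solutions supply the annihilator of the stable subspace
  set D' : E →L[ℂ] E := H - (starRingEnd ℂ ξ₀) • 1 with hD'def
  set M' : E →L[ℂ] E := -(Ai.comp D') with hM'def
  have hM' : ∀ v, A (M' v) = -(H v - (starRingEnd ℂ ξ₀) • v) := fun v => by
    simp only [hM'def, hD'def, neg_apply, ContinuousLinearMap.comp_apply,
      map_neg, hAi]
    simp
  have hdis' : ∀ v, v ≠ 0 → (⟪v, D' v⟫).re < 0 := fun v hv => by
    have h1 := hD' ξ₀ hξ₀ v hv
    simp only [hD'def, sub_apply, smul_apply,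
      one_apply_eq_self, inner_sub_right, inner_smul_right, Complex.sub_re,
      Complex.mul_re, Complex.conj_re, Complex.conj_im] at h1 ⊢
    have h2 : (⟪v, v⟫).im = 0 := inner_self_im (𝕜 := ℂ) v
    rw [h2] at h1 ⊢
    linarith
  have hcompl := (finrank_stableSpace_eq (D := D') (M := M') hsig.neg_left
    (fun v w => by simp [hA]) (fun v => by simp [hM', hD'def]) hdis').2.2
  have hev : ∀ (μ : ℂ) (v : E), M' v = μ • v → v ≠ 0 → μ.re ≠ 0 := by
    intro μ v hv h0 hμ
    have h1 := hdis' v h0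
    have h2 : (⟪v, A v⟫).im = 0 := by
      rw [← Complex.conj_eq_iff_im, inner_conj_symm, hA]
    have h3 : D' v = -(A (M' v)) := by rw [hM']; simp [hD'def]
    rw [h3, hv, map_smul, inner_neg_right, inner_smul_right, Complex.neg_re, Complex.mul_re, hμ,
      h2] at h1
    simp at h1
  have horth := orthogonal_stableSpace (D := H - ξ₀ • 1) (M := M ξ₀) (M' := M') hsig hA hinj
    (fun v => by simp [hM]) (fun v w => by
      rw [hM', inner_neg_left, inner_sub_left, inner_smul_left, hH, Complex.conj_conj]
      simp)
    (fun v hv => by simpa using hD' ξ₀ hξ₀ v hv)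
  have hadj : ∀ y, ∀ᶠ ξ in 𝓝 ξ₀, ⟪ContinuousLinearMap.adjoint B y, r ξ⟫ = ⟪y, β⟫ := fun y => by
    filter_upwards [hopen] with ξ hξ
    rw [ContinuousLinearMap.adjoint_inner_left, (hr ξ hξ).2]
  have hexp : ∀ w ∈ (stableSpace (M ξ₀))ᗮ, ⟪w, r ξ₀⟫ = 0 ∧ ∃ (y : E) (K : ℝ),
      ∀ᶠ ξ in 𝓝 ξ₀, ‖⟪w, r ξ⟫ + (ξ - ξ₀) * ⟪y, r ξ⟫‖ ≤ K * ‖ξ - ξ₀‖ ^ 2 := by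
    intro w hw
    refine ⟨Submodule.inner_left_of_mem_orthogonal (hr ξ₀ hξ₀).1 hw, ?_⟩
    rw [horth] at hw
    obtain ⟨z, hz, rfl⟩ := hw
    obtain ⟨y, K, hK⟩ := exists_norm_inner_add_le hA hAi hH hM hM' hc hD hev hcompl.disjoint hz
    refine ⟨A y, K + ‖A‖ / (4 * c) * R ^ 2, ?_⟩
    filter_upwards [hopen] with ξ hξ
    refine (hK ξ hξ _ (hr ξ hξ).1).trans ?_
    rw [mul_comm]
    gcongr
    exact hR ξ hξ
  have hlim : ∀ K : ℝ, Tendsto (fun ξ : ℂ => K * ‖ξ - ξ₀‖ ^ 2) (𝓝 ξ₀) (𝓝 0) := fun K => by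
    have : Continuous fun ξ : ℂ => K * ‖ξ - ξ₀‖ ^ 2 := by fun_prop
    simpa using this.tendsto ξ₀
  -- The vectors `w` for which `⟪w, r ξ⟫` is continuous at `ξ₀` form a subspace. It contains the
  -- annihilator of the stable subspace, where the expansion applies, and the range of the adjoint of
  -- `B`, where `⟪w, r ξ⟫` is constant; hence it is everything.
  have hcont : ∀ w, ContinuousAt (fun ξ => ⟪w, r ξ⟫) ξ₀ := by
    let T : Submodule ℂ E :=
      { carrier := {w | ContinuousAt (fun ξ => ⟪w, r ξ⟫) ξ₀}
        add_mem' := fun {a b} ha hb => by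
          simp only [mem_ofPred_eq, inner_add_left] at *
          exact ha.add hb
        zero_mem' := by simpa using continuousAt_const
        smul_mem' := fun a b hb => by
          simp only [mem_ofPred_eq, inner_smul_left] at *
          exact hb.const_mul _ }
    have hT : T = ⊤ := by
      refine eq_top_of_orthogonal_le_of_adjoint_mem hBinj (fun w hw => ?_) fun y => ?_
      · obtain ⟨h0, y, K, hK⟩ := hexp w hw
        change Tendsto _ _ _
        simp only [h0]
        refine squeeze_zero_norm' (a := fun ξ => K * ‖ξ - ξ₀‖ ^ 2 + ‖ξ - ξ₀‖ * (‖y‖ * R)) ?_ ?_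
        · filter_upwards [hK, hopen] with ξ h hξ
          calc ‖⟪w, r ξ⟫‖ = ‖(⟪w, r ξ⟫ + (ξ - ξ₀) * ⟪y, r ξ⟫) - (ξ - ξ₀) * ⟪y, r ξ⟫‖ := by
                rw [add_sub_cancel_right]
            _ ≤ _ := norm_sub_le _ _
            _ ≤ _ := by
                rw [norm_mul]
                gcongr
                exact (norm_inner_le_norm _ _).trans (by gcongr; exact hR ξ hξ)
        · have h1 : Continuous fun ξ : ℂ => ‖ξ - ξ₀‖ * (‖y‖ * R) := by fun_prop
          simpa using (hlim K).add (h1.tendsto ξ₀)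
      · exact (continuousAt_const (y := ⟪y, β⟫)).congr ((hadj y).mono fun _ h => h.symm)
    exact fun w => (hT ▸ Submodule.mem_top : w ∈ T)
  -- with continuity at hand, the same argument gives differentiability
  let T : Submodule ℂ E :=
    { carrier := {w | DifferentiableAt ℂ (fun ξ => ⟪w, r ξ⟫) ξ₀}
      add_mem' := fun {a b} ha hb => by
        simp only [mem_ofPred_eq, inner_add_left] at *
        exact ha.add hb
      zero_mem' := by simp
      smul_mem' := fun a b hb => by
        simp only [mem_ofPred_eq, inner_smul_left] at *
        exact hb.const_mul _ }
  have hT : T = ⊤ := by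
    refine eq_top_of_orthogonal_le_of_adjoint_mem hBinj (fun w hw => ?_) fun y => ?_
    · obtain ⟨h0, y, K, hK⟩ := hexp w hw
      refine HasDerivAt.differentiableAt (f' := -⟪y, r ξ₀⟫) ?_
      rw [hasDerivAt_iff_isLittleO]
      have e : (fun ξ => ⟪w, r ξ⟫ - ⟪w, r ξ₀⟫ - (ξ - ξ₀) • -⟪y, r ξ₀⟫) = fun ξ =>
          (⟪w, r ξ⟫ + (ξ - ξ₀) * ⟪y, r ξ⟫) - (ξ - ξ₀) * (⟪y, r ξ⟫ - ⟪y, r ξ₀⟫) := by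
        funext ξ
        rw [h0, smul_eq_mul]
        ring
      rw [e]
      refine Asymptotics.IsLittleO.sub ?_ ?_
      · have h1 : (fun ξ => ⟪w, r ξ⟫ + (ξ - ξ₀) * ⟪y, r ξ⟫) =O[𝓝 ξ₀] fun ξ => (ξ - ξ₀) ^ 2 :=
          Asymptotics.IsBigO.of_bound K (by simpa using hK)
        refine h1.trans_isLittleO ?_
        have h2 := Asymptotics.isLittleO_pow_id (𝕜 := ℂ) (n := 2) one_lt_two
        have h3 : Tendsto (fun ξ => ξ - ξ₀) (𝓝 ξ₀) (𝓝 0) := by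
          have : Continuous fun ξ : ℂ => ξ - ξ₀ := by fun_prop
          simpa using this.tendsto ξ₀
        exact h2.comp_tendsto h3
      · have h1 : (fun ξ => ⟪y, r ξ⟫ - ⟪y, r ξ₀⟫) =o[𝓝 ξ₀] fun _ => (1 : ℂ) := by
          rw [Asymptotics.isLittleO_one_iff]
          simpa using (hcont y).tendsto.sub_const ⟪y, r ξ₀⟫
        simpa using (Asymptotics.isBigO_refl (fun ξ : ℂ => ξ - ξ₀) (𝓝 ξ₀)).mul_isLittleO h1
    · exact (differentiableAt_const (c := ⟪y, β⟫)).congr_of_eventuallyEq (hadj y)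
  exact (hT ▸ Submodule.mem_top : w ∈ T)

end Holomorphy

/-! ### Matrices as operators, and the signature of a symmetric matrix -/

section MatrixOperators

variable {ι κ ν : Type*} [Fintype ι] [DecidableEq ι] [Fintype κ] [DecidableEq κ] [Fintype ν]
  [DecidableEq ν]

local notation "⟪" x ", " y "⟫" => inner ℂ x y

/-- A complex matrix as a continuous linear map between Euclidean spaces. -/
noncomputable def Matrix.euclideanCLM (X : Matrix ι κ ℂ) :
    EuclideanSpace ℂ κ →L[ℂ] EuclideanSpace ℂ ι :=
  LinearMap.toContinuousLinearMap (Matrix.toEuclideanLin X)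

/-- The complexification of a real matrix, as a continuous linear map. -/
noncomputable def Matrix.complexCLM (X : Matrix ι κ ℝ) :
    EuclideanSpace ℂ κ →L[ℂ] EuclideanSpace ℂ ι :=
  (X.map ((↑) : ℝ → ℂ)).euclideanCLM

open Matrix

omit [DecidableEq ι] in
theorem Matrix.ofLp_euclideanCLM (X : Matrix ι κ ℂ) (v : EuclideanSpace ℂ κ) :
    (X.euclideanCLM v).ofLp = X *ᵥ v.ofLp := rfl

omit [DecidableEq ι] in
theorem Matrix.euclideanCLM_mul (X : Matrix ι κ ℂ) (Y : Matrix κ ν ℂ) (v : EuclideanSpace ℂ ν) :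
    (X * Y).euclideanCLM v = X.euclideanCLM (Y.euclideanCLM v) := by
  apply WithLp.ofLp_injective
  simp [ofLp_euclideanCLM]

theorem Matrix.isUnit_det_map_ofReal {A : Matrix κ κ ℝ} (hA : A.det ≠ 0) :
    IsUnit (A.map ((↑) : ℝ → ℂ)).det := by
  have h : (A.map ((↑) : ℝ → ℂ)).det = (A.det : ℂ) := (RingHom.map_det Complex.ofRealHom A).symm
  rw [h, isUnit_iff_ne_zero]
  exact_mod_cast hA

theorem Matrix.euclideanCLM_one (v : EuclideanSpace ℂ κ) :
    (1 : Matrix κ κ ℂ).euclideanCLM v = v := by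
  apply WithLp.ofLp_injective
  simp [ofLp_euclideanCLM]

theorem Matrix.complexCLM_inv_apply {A : Matrix κ κ ℝ} (hA : A.det ≠ 0)
    (v : EuclideanSpace ℂ κ) :
    A.complexCLM (((A.map ((↑) : ℝ → ℂ))⁻¹).euclideanCLM v) = v := by
  rw [Matrix.complexCLM, ← Matrix.euclideanCLM_mul,
    Matrix.mul_nonsing_inv _ (Matrix.isUnit_det_map_ofReal hA), Matrix.euclideanCLM_one]

theorem Matrix.inv_complexCLM_apply {A : Matrix κ κ ℝ} (hA : A.det ≠ 0)
    (v : EuclideanSpace ℂ κ) :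
    ((A.map ((↑) : ℝ → ℂ))⁻¹).euclideanCLM (A.complexCLM v) = v := by
  rw [Matrix.complexCLM, ← Matrix.euclideanCLM_mul,
    Matrix.nonsing_inv_mul _ (Matrix.isUnit_det_map_ofReal hA), Matrix.euclideanCLM_one]

theorem Matrix.inner_euclideanCLM_left (X : Matrix ι κ ℂ) (v : EuclideanSpace ℂ κ)
    (w : EuclideanSpace ℂ ι) : ⟪X.euclideanCLM v, w⟫ = ⟪v, Xᴴ.euclideanCLM w⟫ := by
  have h := Matrix.toEuclideanLin_conjTranspose_eq_adjoint X
  change ⟪toEuclideanLin X v, w⟫ = ⟪v, toEuclideanLin Xᴴ w⟫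
  rw [h, LinearMap.adjoint_inner_right]

omit [Fintype ι] [DecidableEq ι] in
theorem Matrix.IsSymm.isHermitian_map {A : Matrix ι ι ℝ} (hA : A.IsSymm) :
    (A.map ((↑) : ℝ → ℂ)).IsHermitian := by
  ext i j
  simp [Matrix.conjTranspose_apply, hA.apply i j]

theorem Matrix.IsSymm.inner_complexCLM {A : Matrix ι ι ℝ} (hA : A.IsSymm)
    (v w : EuclideanSpace ℂ ι) : ⟪A.complexCLM v, w⟫ = ⟪v, A.complexCLM w⟫ := by
  rw [Matrix.complexCLM, Matrix.inner_euclideanCLM_left, hA.isHermitian_map.eq]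

theorem Matrix.IsHermitian.euclideanCLM_eigenvectorBasis {A : Matrix ι ι ℂ} (hA : A.IsHermitian)
    (j : ι) : A.euclideanCLM (hA.eigenvectorBasis j) =
      (hA.eigenvalues j : ℂ) • hA.eigenvectorBasis j := by
  apply WithLp.ofLp_injective
  rw [Matrix.ofLp_euclideanCLM, hA.mulVec_eigenvectorBasis]
  rfl

theorem Matrix.IsHermitian.re_inner_euclideanCLM {A : Matrix ι ι ℂ} (hA : A.IsHermitian)
    (v : EuclideanSpace ℂ ι) : (⟪v, A.euclideanCLM v⟫).re =
      ∑ i, hA.eigenvalues i * ‖⟪hA.eigenvectorBasis i, v⟫‖ ^ 2 := by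
  rw [← hA.eigenvectorBasis.sum_inner_mul_inner, Complex.re_sum]
  refine Finset.sum_congr rfl fun i _ => ?_
  have h : ⟪hA.eigenvectorBasis i, A.euclideanCLM v⟫
      = hA.eigenvalues i * ⟪hA.eigenvectorBasis i, v⟫ := by
    have h0 := Matrix.inner_euclideanCLM_left A (hA.eigenvectorBasis i) v
    rw [hA.eq, hA.euclideanCLM_eigenvectorBasis, inner_smul_left, Complex.conj_ofReal] at h0
    exact h0.symm
  rw [h, mul_left_comm, ← inner_conj_symm, mul_comm (starRingEnd ℂ _), Complex.mul_conj,
    Complex.normSq_eq_norm_sq]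
  norm_cast

theorem numPosEigenvalues_eq_card {A : Matrix ι ι ℝ} (hA : A.IsSymm) :
    numPosEigenvalues A = Fintype.card {i // 0 < hA.isHermitian_map.eigenvalues i} := by
  have h1 : A.IsHermitian := by ext i j; simp [hA.apply i j]
  have h2 : A.charpoly.Splits := by
    rw [h1.charpoly_eq]
    exact Polynomial.Splits.prod fun i _ => Polynomial.Splits.X_sub_C _
  have h3 := h2.roots_map (algebraMap ℝ ℂ)
  rw [← Matrix.charpoly_map] at h3
  have h4 := hA.isHermitian_map.roots_charpoly_eq_eigenvalues
  have h5 : Multiset.map (fun x : ℝ => (x : ℂ)) A.charpoly.roots =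
      Multiset.map (fun x : ℝ => (x : ℂ))
        (Multiset.map hA.isHermitian_map.eigenvalues Finset.univ.val) := by
    rw [Multiset.map_map]
    exact h3.symm.trans h4
  rw [numPosEigenvalues, Multiset.map_injective Complex.ofReal_injective h5, Multiset.filter_map,
    Multiset.card_map, Fintype.card_subtype]
  rfl

/-- The definite subspaces are spanned by the eigenvectors of positive and of negative eigenvalues. -/
theorem hasSignature_complexCLM {A : Matrix ι ι ℝ} (hA : A.IsSymm) (hdet : A.det ≠ 0) :
    HasSignature A.complexCLM (numPosEigenvalues A) (Fintype.card ι - numPosEigenvalues A) := by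
  set hH := hA.isHermitian_map
  have hne : ∀ i, hH.eigenvalues i ≠ 0 := by
    intro i hi
    have h1 := hH.det_eq_prod_eigenvalues
    have h2 : (A.map ((↑) : ℝ → ℂ)).det = (A.det : ℂ) := (RingHom.map_det Complex.ofRealHom A).symm
    rw [h2, Finset.prod_eq_zero (Finset.mem_univ i) (by simp [hi])] at h1
    exact hdet (by exact_mod_cast h1)
  have hfr : ∀ s : ι → Prop, Module.finrank ℂ
      (Submodule.span ℂ (range fun i : {i // s i} => hH.eigenvectorBasis i)) =
        Nat.card {i // s i} := by
    intro s
    classical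
    rw [finrank_span_eq_card, Nat.card_eq_fintype_card]
    exact hH.eigenvectorBasis.toBasis.linearIndependent.comp _ Subtype.val_injective
      |> fun h => by simpa [Function.comp_def] using h
  have horth : ∀ s : ι → Prop, ∀ v ∈ Submodule.span ℂ
      (range fun i : {i // s i} => hH.eigenvectorBasis i), ∀ j, ¬ s j →
        ⟪hH.eigenvectorBasis j, v⟫ = 0 := by
    intro s v hv j hj
    have hle : Submodule.span ℂ (range fun i : {i // s i} => hH.eigenvectorBasis i)
        ≤ (Submodule.span ℂ {hH.eigenvectorBasis j})ᗮ := by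
      rw [Submodule.span_le]
      rintro _ ⟨i, rfl⟩
      rw [SetLike.mem_coe, Submodule.mem_orthogonal_singleton_iff_inner_right]
      exact hH.eigenvectorBasis.orthonormal.2 (fun h => hj (h ▸ i.2))
    exact (Submodule.mem_orthogonal_singleton_iff_inner_right).1 (hle hv)
  have hex : ∀ v, v ≠ 0 → ∃ i, ⟪hH.eigenvectorBasis i, v⟫ ≠ 0 := by
    intro v hv
    by_contra! h
    have := hH.eigenvectorBasis.sum_repr' v
    simp [h] at this
    exact hv this.symm
  have hpos := numPosEigenvalues_eq_card hA
  refine ⟨?_, ⟨_, (hfr fun i => 0 < hH.eigenvalues i).trans ?_, fun v hv h0 => ?_⟩,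
    ⟨_, (hfr fun i => ¬ 0 < hH.eigenvalues i).trans ?_, fun v hv h0 => ?_⟩⟩
  · rw [finrank_euclideanSpace]
    have := Fintype.card_subtype_le (fun i => 0 < hH.eigenvalues i)
    omega
  · rw [Nat.card_eq_fintype_card, hpos]
  · rw [Matrix.complexCLM, hH.re_inner_euclideanCLM]
    obtain ⟨i, hi⟩ := hex v h0
    have hterm : ∀ j, 0 ≤ hH.eigenvalues j * ‖⟪hH.eigenvectorBasis j, v⟫‖ ^ 2 := fun j => by
      by_cases hj : 0 < hH.eigenvalues j
      · positivity
      · rw [horth _ v hv j hj]; simp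
    refine Finset.sum_pos' (fun j _ => hterm j) ⟨i, Finset.mem_univ i, ?_⟩
    have hi0 : 0 < hH.eigenvalues i := by
      by_contra h
      exact hi (horth _ v hv i h)
    have := norm_pos_iff.2 hi
    positivity
  · rw [Nat.card_eq_fintype_card, Fintype.card_subtype_compl, hpos]
  · rw [Matrix.complexCLM, hH.re_inner_euclideanCLM]
    obtain ⟨i, hi⟩ := hex v h0
    rw [← neg_pos, ← Finset.sum_neg_distrib]
    have hterm : ∀ j, 0 ≤ -(hH.eigenvalues j * ‖⟪hH.eigenvectorBasis j, v⟫‖ ^ 2) := fun j => by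
      by_cases hj : 0 < hH.eigenvalues j
      · rw [horth _ v hv j (not_not.2 hj)]; simp
      · rw [neg_nonneg]
        exact mul_nonpos_of_nonpos_of_nonneg (not_lt.1 hj) (by positivity)
    refine Finset.sum_pos' (fun j _ => hterm j) ⟨i, Finset.mem_univ i, ?_⟩
    have hi0 : ¬ 0 < hH.eigenvalues i := by
      intro h
      exact hi (horth _ v hv i (not_not.2 h))
    have hi1 : hH.eigenvalues i < 0 := lt_of_le_of_ne (not_lt.1 hi0) (hne i)
    have := norm_pos_iff.2 hi
    rw [neg_pos]
    exact mul_neg_of_neg_of_pos hi1 (by positivity)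

end MatrixOperators

/-! ### The generalized Kreiss condition as a lower bound -/

section Kreiss

variable {ι : Type*} [Fintype ι] [DecidableEq ι]

local notation "⟪" x ", " y "⟫" => inner ℂ x y

open Matrix

theorem card_roots_charpoly_filter {V : Type*} [AddCommGroup V] [Module ℂ V]
    [FiniteDimensional ℂ V] (f : V →ₗ[ℂ] V) (P : ℂ → Prop) [DecidablePred P] :
    ((∀ z, Module.End.HasEigenvalue f z → P z) →
      (f.charpoly.roots.filter P).card = Module.finrank ℂ V) ∧
    ((∀ z, Module.End.HasEigenvalue f z → ¬ P z) → (f.charpoly.roots.filter P).card = 0) := by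
  have hroot : ∀ z ∈ f.charpoly.roots, Module.End.HasEigenvalue f z := fun z hz =>
    (Module.End.hasEigenvalue_iff_isRoot_charpoly f z).2 (Polynomial.isRoot_of_mem_roots hz)
  refine ⟨fun h => ?_, fun h => ?_⟩
  · rw [Multiset.filter_eq_self.2 fun z hz => h z (hroot z hz),
      Polynomial.splits_iff_card_roots.1 (IsAlgClosed.splits _), LinearMap.charpoly_natDegree]
  · rw [Multiset.filter_eq_nil.2 fun z hz => h z (hroot z hz)]
    rfl

/-- The two invariant subspaces diagonalize `M` blockwise, so the stable eigenvalues, counted with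
algebraic multiplicity, are as many as the dimension of the stable subspace. -/
theorem numStableEigenvalues_eq_finrank {M : Matrix ι ι ℂ}
    (hcompl : IsCompl (stableSpace M.euclideanCLM) (stableSpace (-M.euclideanCLM)))
    (hev : ∀ (μ : ℂ) (v : EuclideanSpace ℂ ι), M.euclideanCLM v = μ • v → v ≠ 0 → μ.re ≠ 0) :
    numStableEigenvalues M = Module.finrank ℂ (stableSpace M.euclideanCLM) := by
  set L := M.euclideanCLM with hL
  have hS : ∀ v ∈ stableSpace L, (L : EuclideanSpace ℂ ι →ₗ[ℂ] EuclideanSpace ℂ ι) v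
    ∈ stableSpace L := fun v hv => apply_mem_stableSpace hv
  have hU : ∀ v ∈ stableSpace (-L), (L : EuclideanSpace ℂ ι →ₗ[ℂ] EuclideanSpace ℂ ι) v
    ∈ stableSpace (-L) := fun v hv => by
      simpa using Submodule.neg_mem _ (apply_mem_stableSpace hv)
  set f := (L : EuclideanSpace ℂ ι →ₗ[ℂ] EuclideanSpace ℂ ι).restrict hS
  set g := (L : EuclideanSpace ℂ ι →ₗ[ℂ] EuclideanSpace ℂ ι).restrict hU
  set e := Submodule.prodEquivOfIsCompl _ _ hcompl with he
  have hconj : e.conj (f.prodMap g) = (L : EuclideanSpace ℂ ι →ₗ[ℂ] EuclideanSpace ℂ ι) := by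
    refine LinearMap.ext fun v => ?_
    obtain ⟨⟨a, b⟩, rfl⟩ := e.surjective v
    simp only [LinearEquiv.conj_apply_apply, LinearEquiv.symm_apply_apply, LinearMap.prodMap_apply]
    simp [he, f, g]
  have hchar : M.charpoly = f.charpoly * g.charpoly := by
    rw [← LinearMap.charpoly_prodMap, ← LinearEquiv.charpoly_conj e, hconj, hL]
    have : ((M.euclideanCLM : EuclideanSpace ℂ ι →L[ℂ] EuclideanSpace ℂ ι) :
        EuclideanSpace ℂ ι →ₗ[ℂ] EuclideanSpace ℂ ι) = toEuclideanLin M := rfl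
    rw [this, Matrix.toEuclideanLin_eq_toLin_orthonormal, Matrix.charpoly_toLin]
  have hmem : ∀ z : ℂ, ∀ v : EuclideanSpace ℂ ι, L v = z • v → z.re < 0 → v ∈ stableSpace L :=
    fun z v h hz => mem_stableSpace_of_pow_sub_smul_eq_zero hz (k := 1) (by simp [h])
  have hmem' : ∀ z : ℂ, ∀ v : EuclideanSpace ℂ ι, L v = z • v → 0 < z.re →
      v ∈ stableSpace (-L) :=
    fun z v h hz => mem_stableSpace_of_pow_sub_smul_eq_zero (μ := -z) (by simpa using hz) (k := 1)
      (by simp [h])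
  have hdis := Submodule.disjoint_def.1 hcompl.disjoint
  rw [numStableEigenvalues, hchar, Polynomial.roots_mul
    (mul_ne_zero (LinearMap.charpoly_monic f).ne_zero (LinearMap.charpoly_monic g).ne_zero),
    Multiset.filter_add, Multiset.card_add, (card_roots_charpoly_filter f _).1,
    (card_roots_charpoly_filter g _).2, add_zero]
  · intro z hz hlt
    obtain ⟨v, hv⟩ := hz.exists_hasEigenvector
    have h1 : L v = z • (v : EuclideanSpace ℂ ι) := congrArg Subtype.val hv.apply_eq_smul
    exact hv.2 (Subtype.ext (hdis v (hmem z v h1 hlt) v.2))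
  · intro z hz
    obtain ⟨v, hv⟩ := hz.exists_hasEigenvector
    have h1 : L v = z • (v : EuclideanSpace ℂ ι) := congrArg Subtype.val hv.apply_eq_smul
    have h0 : (v : EuclideanSpace ℂ ι) ≠ 0 := fun h => hv.2 (Subtype.ext h)
    rcases lt_trichotomy z.re 0 with h | h | h
    · exact h
    · exact absurd h (hev z v h1 h0)
    · exact absurd (hdis v v.2 (hmem' z v h1 h)) h0

/-- The orthonormal bases of the stable subspace give right-stable matrices. -/
theorem exists_isRightStableMatrix {M : Matrix ι ι ℂ} {p : ℕ}
    (hcompl : IsCompl (stableSpace M.euclideanCLM) (stableSpace (-M.euclideanCLM)))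
    (hev : ∀ (μ : ℂ) (v : EuclideanSpace ℂ ι), M.euclideanCLM v = μ • v → v ≠ 0 → μ.re ≠ 0)
    (hp : Module.finrank ℂ (stableSpace M.euclideanCLM) = p) :
    ∃ R : Matrix ι (Fin p) ℂ, IsRightStableMatrix M R ∧ Rᴴ * R = 1 ∧
      ∀ v ∈ stableSpace M.euclideanCLM, R.euclideanCLM (Rᴴ.euclideanCLM v) = v := by
  set S := stableSpace M.euclideanCLM with hS
  obtain ⟨b⟩ : Nonempty (OrthonormalBasis (Fin p) ℂ S) :=
    ⟨(stdOrthonormalBasis ℂ S).reindex (finCongr hp)⟩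
  set R : Matrix ι (Fin p) ℂ := Matrix.of fun i j => (b j : EuclideanSpace ℂ ι) i with hR
  have hRa : ∀ a, R.euclideanCLM a = ∑ j, a j • (b j : EuclideanSpace ℂ ι) := by
    intro a
    ext i
    simp [Matrix.euclideanCLM, hR, Matrix.toLpLin_apply, Matrix.mulVec, dotProduct, mul_comm]
  have hRH : ∀ (v : EuclideanSpace ℂ ι) (j : Fin p), (Rᴴ.euclideanCLM v) j
      = ⟪(b j : EuclideanSpace ℂ ι), v⟫ := by
    intro v j
    simp [Matrix.euclideanCLM, hR, Matrix.toLpLin_apply, Matrix.mulVec, dotProduct,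
      PiLp.inner_apply, mul_comm]
  have hRmem : ∀ a, R.euclideanCLM a ∈ S := fun a => by
    rw [hRa]
    exact Submodule.sum_mem _ fun j _ => Submodule.smul_mem _ _ (b j).2
  have hRR : Rᴴ * R = 1 := by
    ext i j
    have h1 := orthonormal_iff_ite.1 b.orthonormal i j
    rw [Matrix.one_apply, ← h1]
    simp [Matrix.mul_apply, hR, PiLp.inner_apply, mul_comm, Submodule.coe_inner]
  have hproj : ∀ v ∈ S, R.euclideanCLM (Rᴴ.euclideanCLM v) = v := by
    intro v hv
    rw [hRa]
    have h1 := congrArg Subtype.val (b.sum_repr' ⟨v, hv⟩)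
    simp only [Submodule.coe_sum, Submodule.coe_smul, Submodule.coe_inner] at h1
    simpa [hRH] using h1
  have hinv : M * R = R * (Rᴴ * M * R) := by
    apply Matrix.toEuclideanLin.injective
    refine LinearMap.ext fun a => ?_
    change (M * R).euclideanCLM a = (R * (Rᴴ * M * R)).euclideanCLM a
    rw [Matrix.euclideanCLM_mul, Matrix.euclideanCLM_mul, Matrix.euclideanCLM_mul,
      Matrix.euclideanCLM_mul, hproj _ (apply_mem_stableSpace (hRmem a))]
  refine ⟨R, ⟨(numStableEigenvalues_eq_finrank hcompl hev).trans hp, ?_, Rᴴ * M * R, ?_, hinv⟩,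
    hRR, hproj⟩
  · open ComplexOrder in
    rw [← Matrix.rank_conjTranspose_mul_self, hRR, Matrix.rank_one, Fintype.card_fin]
  · intro z hz
    rw [← Matrix.spectrum_toLpLin 2, ← Module.End.hasEigenvalue_iff_mem_spectrum] at hz
    obtain ⟨a, ha⟩ := hz.exists_hasEigenvector
    have h1 : M.euclideanCLM (R.euclideanCLM a) = z • R.euclideanCLM a := by
      have h2 : (Rᴴ * M * R).euclideanCLM a = z • a := ha.apply_eq_smul
      rw [← Matrix.euclideanCLM_mul, hinv, Matrix.euclideanCLM_mul, h2, map_smul]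
    have h0 : R.euclideanCLM a ≠ 0 := by
      intro h
      apply ha.2
      rw [← Matrix.euclideanCLM_one a, ← hRR, Matrix.euclideanCLM_mul, h, map_zero]
    rcases lt_trichotomy z.re 0 with h | h | h
    · exact h
    · exact absurd h (hev z _ h1 h0)
    · refine absurd (Submodule.disjoint_def.1 hcompl.disjoint _ (hRmem a)
        (mem_stableSpace_of_pow_sub_smul_eq_zero (μ := -z) (by simpa using h) (k := 1) ?_)) h0
      simp [h1]

omit [DecidableEq ι] in
theorem exists_norm_adjugate_le {p : ℕ} (B : Matrix (Fin p) ι ℂ) :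
    ∃ K : ℝ, 0 ≤ K ∧ ∀ R : Matrix ι (Fin p) ℂ, (∀ i j, ‖R i j‖ ≤ 1) →
      ‖(B * R).adjugate.euclideanCLM‖ ≤ K := by
  have hcpt : IsCompact {R : Matrix ι (Fin p) ℂ | ∀ i j, ‖R i j‖ ≤ 1} := by
    have h1 : IsCompact (Set.pi univ fun _ : ι => Set.pi univ fun _ : Fin p =>
        Metric.closedBall (0 : ℂ) 1) :=
      isCompact_univ_pi fun _ => isCompact_univ_pi fun _ => isCompact_closedBall _ _
    have h2 : {R : Matrix ι (Fin p) ℂ | ∀ i j, ‖R i j‖ ≤ 1} = Set.pi univ fun _ : ι =>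
        Set.pi univ fun _ : Fin p => Metric.closedBall (0 : ℂ) 1 := by
      refine Set.ext fun R => ⟨fun h i _ j _ => ?_, fun h i j => ?_⟩
      · exact mem_closedBall_zero_iff.2 (h i j)
      · exact mem_closedBall_zero_iff.1 (h i trivial j trivial)
    rw [h2]
    exact h1
  have hlin : Continuous fun X : Matrix (Fin p) (Fin p) ℂ => X.euclideanCLM :=
    LinearMap.continuous_of_finiteDimensional
      ((LinearMap.toContinuousLinearMap (𝕜 := ℂ) (E := EuclideanSpace ℂ (Fin p))
        (F' := EuclideanSpace ℂ (Fin p))).toLinearMap ∘ₗ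
          (Matrix.toEuclideanLin (𝕜 := ℂ) (m := Fin p) (n := Fin p)).toLinearMap)
  have hcont : Continuous fun R : Matrix ι (Fin p) ℂ => (B * R).adjugate.euclideanCLM :=
    hlin.comp (Continuous.matrix_adjugate (continuous_const.matrix_mul continuous_id))
  obtain ⟨K, hK⟩ := hcpt.exists_bound_of_continuousOn hcont.continuousOn
  exact ⟨max K 0, le_max_right _ _, fun R hR => (hK R hR).trans (le_max_left _ _)⟩

/-- The generalized Kreiss condition bounds `B` from below on the stable subspaces: a lower bound
of the determinant is one of the operator, by Cramer's rule. -/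
theorem GeneralizedKreissCondition.exists_norm_le {A Q : Matrix ι ι ℝ} {p : ℕ}
    {B : Matrix (Fin p) ι ℝ} (h : GeneralizedKreissCondition A Q B)
    (hcompl : ∀ (η : ℝ) (ξ : ℂ), 0 ≤ η → 0 < ξ.re →
      IsCompl (stableSpace (symbolMatrix A Q ξ η).euclideanCLM)
        (stableSpace (-(symbolMatrix A Q ξ η).euclideanCLM)))
    (hev : ∀ (η : ℝ) (ξ : ℂ), 0 ≤ η → 0 < ξ.re → ∀ (μ : ℂ) (v : EuclideanSpace ℂ ι),
      (symbolMatrix A Q ξ η).euclideanCLM v = μ • v → v ≠ 0 → μ.re ≠ 0)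
    (hp : ∀ (η : ℝ) (ξ : ℂ), 0 ≤ η → 0 < ξ.re →
      Module.finrank ℂ (stableSpace (symbolMatrix A Q ξ η).euclideanCLM) = p) :
    ∃ c : ℝ, 0 ≤ c ∧ ∀ (η : ℝ) (ξ : ℂ), 0 ≤ η → 0 < ξ.re →
      ∀ v ∈ stableSpace (symbolMatrix A Q ξ η).euclideanCLM, ‖v‖ ≤ c * ‖B.complexCLM v‖ := by
  obtain ⟨d, hd, hdet⟩ := h
  obtain ⟨K, hK0, hK⟩ := exists_norm_adjugate_le (B.map ((↑) : ℝ → ℂ))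
  refine ⟨K / d, by positivity, fun η ξ hη hξ v hv => ?_⟩
  obtain ⟨R, hR, hRR, hproj⟩ := exists_isRightStableMatrix (hcompl η ξ hη hξ) (hev η ξ hη hξ)
    (hp η ξ hη hξ)
  have hdR := hdet η ξ hη hξ R hR hRR
  set BC := B.map ((↑) : ℝ → ℂ)
  set a := Rᴴ.euclideanCLM v with ha
  have hva : R.euclideanCLM a = v := hproj v hv
  have hnorm : ‖v‖ = ‖a‖ := by
    have h1 : ⟪v, v⟫ = ⟪a, a⟫ := by
      nth_rewrite 1 [← hva]
      rw [Matrix.inner_euclideanCLM_left]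
    rw [inner_self_eq_norm_sq_to_K, inner_self_eq_norm_sq_to_K] at h1
    have h2 : ‖v‖ ^ 2 = ‖a‖ ^ 2 := by exact_mod_cast h1
    exact (sq_eq_sq₀ (norm_nonneg _) (norm_nonneg _)).1 h2
  have hentry : ∀ i j, ‖R i j‖ ≤ 1 := by
    intro i j
    have h1 : (Rᴴ * R) j j = 1 := by rw [hRR]; simp
    have h2 : ∑ i, ‖R i j‖ ^ 2 = 1 := by
      have h3 : (Rᴴ * R) j j = ((∑ i, ‖R i j‖ ^ 2 : ℝ) : ℂ) := by
        simp only [Matrix.mul_apply, Matrix.conjTranspose_apply, Complex.ofReal_sum]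
        refine Finset.sum_congr rfl fun k _ => ?_
        have h4 := Complex.conj_mul' (R k j)
        rw [Complex.ofReal_pow, ← h4]
        rfl
      rw [h3] at h1
      exact_mod_cast h1
    have h3 : ‖R i j‖ ^ 2 ≤ 1 := by
      rw [← h2]
      exact Finset.single_le_sum (f := fun i => ‖R i j‖ ^ 2) (fun i _ => by positivity)
        (Finset.mem_univ i)
    nlinarith [norm_nonneg (R i j)]
  have hadj : (BC * R).det • a = (BC * R).adjugate.euclideanCLM (B.complexCLM v) := by
    have h1 : B.complexCLM v = (BC * R).euclideanCLM a := by
      rw [Matrix.euclideanCLM_mul, hva]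
      rfl
    rw [h1, ← Matrix.euclideanCLM_mul, Matrix.adjugate_mul]
    apply WithLp.ofLp_injective
    simp [Matrix.ofLp_euclideanCLM, Matrix.smul_mulVec]
  have h1 : d * ‖a‖ ≤ K * ‖B.complexCLM v‖ := by
    calc d * ‖a‖ ≤ ‖(BC * R).det‖ * ‖a‖ := by gcongr
      _ = ‖(BC * R).adjugate.euclideanCLM (B.complexCLM v)‖ := by rw [← norm_smul, hadj]
      _ ≤ ‖(BC * R).adjugate.euclideanCLM‖ * ‖B.complexCLM v‖ := ContinuousLinearMap.le_opNorm _ _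
      _ ≤ _ := by gcongr; exact hK R hentry
  rw [hnorm, div_mul_eq_mul_div, le_div_iff₀ hd]
  linarith

end Kreiss

/-! ### The boundary lift, uniformly in the parameters -/

section BoundaryLift

local notation "⟪" x ", " y "⟫" => inner ℂ x y

variable {E : Type*} [NormedAddCommGroup E] [InnerProductSpace ℂ E]

theorem re_inner_sub_smul_self (H : E →L[ℂ] E) (ξ : ℂ) (v : E) :
    (⟪v, H v - ξ • v⟫).re = (⟪v, H v⟫).re - ξ.re * ‖v‖ ^ 2 := by
  rw [inner_sub_right, inner_smul_right, inner_self_eq_norm_sq_to_K, Complex.sub_re]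
  congr 1
  have : ((‖v‖ : ℂ) ^ 2) = ((‖v‖ ^ 2 : ℝ) : ℂ) := by push_cast; rfl
  change (ξ * (‖v‖ : ℂ) ^ 2).re = _
  rw [this, Complex.re_mul_ofReal]

omit [InnerProductSpace ℂ E] in
theorem neg_of_le_neg_mul_norm_sq {g x : ℝ} {v : E} (hg : 0 < g) (hv : v ≠ 0)
    (hx : x ≤ -g * ‖v‖ ^ 2) : x < 0 :=
  hx.trans_lt (by
    have := norm_pos_iff.2 hv
    simp only [neg_mul, Left.neg_neg_iff]
    positivity)

/-- A vector that almost annihilates the decaying solutions of the adjoint system is almost the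
stable lift of its boundary value. -/
theorem norm_sub_lift_le [FiniteDimensional ℂ E] {F : Type*} [NormedAddCommGroup F]
    [InnerProductSpace ℂ F] {A Ai D D' : E →L[ℂ] E} {B : E →L[ℂ] F} {p q : ℕ} {C δ : ℝ}
    (hsig : HasSignature A p q) (hA : ∀ v w, ⟪A v, w⟫ = ⟪v, A w⟫) (hAi : ∀ v, A (Ai v) = v)
    (hAi' : ∀ v, Ai (A v) = v) (hD : ∀ v, v ≠ 0 → (⟪v, D v⟫).re < 0)
    (hD' : ∀ v w, ⟪D' v, w⟫ = ⟪v, D w⟫) (hδ : 0 ≤ δ) (hC : 0 ≤ C) (L : F →ₗ[ℂ] E)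
    (hL : ∀ β, ‖L β‖ ≤ C * ‖β‖) (hLB : ∀ u ∈ stableSpace (Ai.comp D), L (B u) = u) {v : E}
    (h : ∀ Z Z' : ℝ → E, (∀ x, HasDerivAt Z (Z' x) x) → ExpDecay Z →
      (∀ x, A (Z' x) = -D' (Z x)) → ‖⟪A (Z 0), v⟫‖ ≤ δ * ‖Z 0‖) :
    ‖v - L (B v)‖ ≤ (1 + C * ‖B‖) * ‖Ai‖ * δ := by
  have hAinj : Function.Injective A := Function.LeftInverse.injective hAi'
  -- the part `w` of `v` orthogonal to the stable subspace is `A z` for an adjoint solution `Z`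
  set S := stableSpace (Ai.comp D)
  set u := (S.starProjection v : E) with hu
  set w := v - u with hw
  have hwS : w ∈ Sᗮ := S.sub_starProjection_mem_orthogonal v
  have huS : u ∈ S := S.starProjection_apply_mem v
  have horth := orthogonal_stableSpace (D := D) (M := Ai.comp D) (M' := -Ai.comp D') hsig hA hAinj
    (fun v => by simp [hAi])
    (fun v w => by
      rw [neg_apply, map_neg, ContinuousLinearMap.comp_apply, hAi, inner_neg_left, hD']) hD
  obtain ⟨z, ⟨Z, hZ, hZ0⟩, hzw⟩ : ∃ z ∈ stableSpace (-Ai.comp D'), A z = w := by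
    rw [horth] at hwS
    exact hwS
  have hvw : ⟪w, v⟫ = ⟪w, w⟫ := by
    have : ⟪w, u⟫ = 0 := S.inner_left_of_mem_orthogonal huS hwS
    rw [hw, inner_sub_right (𝕜 := ℂ) (v - u), ← hw, this, sub_zero]
  have hpair := h Z _ hZ.hasDerivAt hZ.decay fun x => by
    rw [neg_apply, map_neg, ContinuousLinearMap.comp_apply, hAi]
  rw [hZ0, hzw, hvw, inner_self_eq_norm_sq_to_K, norm_pow, RCLike.norm_ofReal, abs_norm] at hpair
  have hzn : ‖z‖ ≤ ‖Ai‖ * ‖w‖ := by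
    rw [← hzw, ← hAi' z, hAi]
    exact Ai.le_opNorm _
  have hwδ : ‖w‖ ≤ ‖Ai‖ * δ := by
    rcases eq_or_ne w 0 with h0 | h0
    · rw [h0, norm_zero]; positivity
    · have h1 := norm_pos_iff.2 h0
      have h3 : ‖w‖ * ‖w‖ ≤ ‖w‖ * (‖Ai‖ * δ) := by nlinarith
      exact le_of_mul_le_mul_left h3 h1
  have hvdec : v - L (B v) = w - L (B w) := by
    have h1 : v = w + u := by rw [hw]; abel
    have h2 : L (B v) = L (B w) + u := by
      conv_lhs => rw [h1, map_add, map_add, hLB u huS]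
    rw [h2]
    nth_rewrite 1 [h1]
    abel
  rw [hvdec]
  calc ‖w - L (B w)‖ ≤ ‖w‖ + ‖L (B w)‖ := norm_sub_le _ _
    _ ≤ ‖w‖ + C * (‖B‖ * ‖w‖) := by
        gcongr
        exact (hL _).trans (by gcongr; exact B.le_opNorm w)
    _ = (1 + C * ‖B‖) * ‖w‖ := by ring
    _ ≤ (1 + C * ‖B‖) * (‖Ai‖ * δ) := by gcongr
    _ = _ := by ring

/-- Uniformly in `η ≥ 0`, and in `ξ` in a half-plane, a lower bound of `B` on the stable subspaces
of `A⁻¹ (η Q - ξ)` persists under a bounded perturbation `K` of `η Q`. -/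
theorem exists_norm_le_perturbed [FiniteDimensional ℂ E] {F : Type*} [NormedAddCommGroup F]
    [InnerProductSpace ℂ F] {A Ai Q K : E →L[ℂ] E} {B : E →L[ℂ] F} {p q : ℕ} {c₁ : ℝ}
    (hsig : HasSignature A p q) (hA : ∀ v w, ⟪A v, w⟫ = ⟪v, A w⟫) (hAi : ∀ v, A (Ai v) = v)
    (hAi' : ∀ v, Ai (A v) = v) (hQ : ∀ v w, ⟪Q v, w⟫ = ⟪v, Q w⟫)
    (hQneg : ∀ v, (⟪v, Q v⟫).re ≤ 0) (hc₁ : 0 ≤ c₁)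
    (hB : ∀ (η : ℝ) (ξ : ℂ), 0 ≤ η → 0 < ξ.re →
      ∀ v ∈ stableSpace (Ai.comp ((η : ℂ) • Q - ξ • 1)), ‖v‖ ≤ c₁ * ‖B v‖) :
    ∃ γ₀ c : ℝ, 0 < γ₀ ∧ 0 < c ∧ ∀ (η : ℝ) (ξ : ℂ), 0 ≤ η → γ₀ < ξ.re →
      (∀ v, (⟪v, ((η : ℂ) • Q + K) v - ξ • v⟫).re ≤ -c * ‖v‖ ^ 2) ∧
      ∀ v ∈ stableSpace (Ai.comp ((η : ℂ) • Q + K - ξ • 1)), ‖v‖ ≤ 2 * c₁ * ‖B v‖ := by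
  set κ := ‖K‖ with hκ
  -- dissipation `g` that makes the perturbation small in `norm_le_of_mem_stableSpace_perturbed`
  set g := (1 + c₁ * ‖B‖) ^ 2 * (κ * ‖A‖ * (1 + ‖Ai‖ ^ 2)) + 1 with hg
  have hg0 : 0 < g := by positivity
  have hηQ : ∀ η : ℝ, 0 ≤ η → ∀ v, (⟪v, ((η : ℂ) • Q) v⟫).re ≤ 0 := fun η hη v => by
    rw [smul_apply, inner_smul_right, Complex.re_ofReal_mul]
    exact mul_nonpos_of_nonneg_of_nonpos hη (hQneg v)
  refine ⟨κ + g, g, by positivity, hg0, fun η ξ hη hξ => ?_⟩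
  have hξg : g ≤ ξ.re := by have := norm_nonneg K; linarith
  have hD : ∀ v, (⟪v, ((η : ℂ) • Q + K) v - ξ • v⟫).re ≤ -g * ‖v‖ ^ 2 := fun v => by
    rw [re_inner_sub_smul_self, add_apply, inner_add_right, Complex.add_re]
    have h1 := hηQ η hη v
    have h2 := (abs_le.1 (abs_re_inner_apply_le K v)).2
    nlinarith [sq_nonneg ‖v‖]
  refine ⟨hD, fun v hv => ?_⟩
  refine norm_le_of_mem_stableSpace_perturbed (A := A) (D := (η : ℂ) • Q - ξ • 1) (K := K)
    (M₀ := Ai.comp ((η : ℂ) • Q - ξ • 1)) (M := Ai.comp ((η : ℂ) • Q + K - ξ • 1))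
    (M' := -Ai.comp ((η : ℂ) • Q - (starRingEnd ℂ ξ) • 1)) (κ := κ) (γ := g) (α := ‖Ai‖)
    hsig hA (fun w => ?_) (fun w => ?_) (fun w => ?_) (fun u w => ?_) hg0 le_rfl (fun w => ?_)
    (fun w => ?_) hc₁ (hB η ξ hη (hg0.trans_le hξg)) ?_ hv
  · conv_lhs => rw [← hAi' w]
    exact Ai.le_opNorm _
  · rw [ContinuousLinearMap.comp_apply, hAi]
  · rw [ContinuousLinearMap.comp_apply, hAi]
    simp only [sub_apply, add_apply]
    abel
  · rw [neg_apply, map_neg, ContinuousLinearMap.comp_apply, hAi, inner_neg_left]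
    simp only [sub_apply, smul_apply, one_apply_eq_self, inner_sub_left, inner_sub_right,
      inner_smul_left, inner_smul_right, Complex.conj_conj, Complex.conj_ofReal, hQ]
  · have h1 := re_inner_sub_smul_self ((η : ℂ) • Q) ξ w
    have h2 := hηQ η hη w
    have h3 : ((η : ℂ) • Q - ξ • 1) w = ((η : ℂ) • Q) w - ξ • w := by simp
    rw [h3, h1]
    nlinarith [sq_nonneg ‖w‖]
  · have h1 := hD w
    have h3 : ((η : ℂ) • Q - ξ • 1) w + K w = ((η : ℂ) • Q + K) w - ξ • w := by
      simp only [sub_apply, add_apply, smul_apply, one_apply_eq_self]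
      abel
    rwa [h3]
  · have h1 : κ * ‖A‖ / (4 * g) * (1 + ‖Ai‖ ^ 2) = κ * ‖A‖ * (1 + ‖Ai‖ ^ 2) / (4 * g) := by ring
    rw [h1, mul_div_assoc', div_le_div_iff₀ (by positivity) (by positivity)]
    linarith

variable {ι : Type*} [Fintype ι] [DecidableEq ι]

open Matrix

theorem Matrix.re_inner_complexCLM_nonpos {X : Matrix ι ι ℝ} (hX : ∀ x : ι → ℝ, x ⬝ᵥ X *ᵥ x ≤ 0)
    (v : EuclideanSpace ℂ ι) : (⟪v, X.complexCLM v⟫).re ≤ 0 := by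
  have h : (⟪v, X.complexCLM v⟫).re = (fun i => (v i).re) ⬝ᵥ X *ᵥ (fun i => (v i).re)
      + (fun i => (v i).im) ⬝ᵥ X *ᵥ (fun i => (v i).im) := by
    simp only [PiLp.inner_apply, Matrix.complexCLM, Matrix.ofLp_euclideanCLM, Matrix.mulVec,
      dotProduct, Matrix.map_apply, Complex.re_sum, ← Finset.sum_add_distrib]
    refine Finset.sum_congr rfl fun i _ => ?_
    simp only [RCLike.inner_apply, Complex.mul_re, Complex.re_sum, Complex.im_sum, Complex.mul_im,
      Complex.conj_re, Complex.conj_im, Complex.ofReal_re, Complex.ofReal_im]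
    simp only [Finset.sum_mul, Finset.mul_sum, ← Finset.sum_sub_distrib, ← Finset.sum_add_distrib]
    exact Finset.sum_congr rfl fun j _ => by ring
  rw [h]
  exact add_nonpos (hX _) (hX _)

theorem Matrix.complexCLM_smul_add (η : ℝ) (Q K : Matrix ι ι ℝ) :
    (η • Q + K).complexCLM = (η : ℂ) • Q.complexCLM + K.complexCLM := by
  refine ContinuousLinearMap.ext fun v => WithLp.ofLp_injective _ ?_
  have : (η • Q + K).map ((↑) : ℝ → ℂ)
      = (η : ℂ) • Q.map ((↑) : ℝ → ℂ) + K.map ((↑) : ℝ → ℂ) := by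
    ext i j; simp
  simp [Matrix.complexCLM, Matrix.ofLp_euclideanCLM, this, Matrix.add_mulVec, Matrix.smul_mulVec]

theorem euclideanCLM_symbolMatrix (A Q : Matrix ι ι ℝ) (ξ : ℂ) (η : ℝ) :
    (symbolMatrix A Q ξ η).euclideanCLM = ((A.map ((↑) : ℝ → ℂ))⁻¹).euclideanCLM.comp
      ((η : ℂ) • Q.complexCLM - ξ • 1) := by
  refine ContinuousLinearMap.ext fun v => ?_
  rw [symbolMatrix, Matrix.euclideanCLM_mul, ContinuousLinearMap.comp_apply]
  congr 1
  apply WithLp.ofLp_injective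
  simp [Matrix.ofLp_euclideanCLM, Matrix.sub_mulVec, Matrix.smul_mulVec, Matrix.complexCLM]

/-- The boundary operator of the Laplace-transformed problem. Uniformly in `η ≥ 0`, and in `ξ` in
a half-plane, boundary values are lifted to the stable subspace of `A⁻¹ (η Q + K - ξ)` by a bounded
family of maps that depends holomorphically on `ξ`; and a vector that almost annihilates
the decaying solutions of the adjoint system is almost the lift of its boundary value. -/
theorem exists_uniform_boundary_lift {A Q K : Matrix ι ι ℝ} {p : ℕ} {B : Matrix (Fin p) ι ℝ}
    (hA : A.IsSymm) (hdet : A.det ≠ 0) (hQs : Q.IsSymm) (hQ : ∀ x : ι → ℝ, x ⬝ᵥ Q *ᵥ x ≤ 0)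
    (hK : K.IsSymm) (hp : p = numPosEigenvalues A) (hB : GeneralizedKreissCondition A Q B) :
    ∃ γ₀ c C C' : ℝ, 0 < γ₀ ∧ 0 < c ∧ 0 ≤ C ∧ 0 ≤ C' ∧ ∀ η : ℝ, 0 ≤ η →
      (∀ ξ : ℂ, γ₀ < ξ.re → ∀ v : EuclideanSpace ℂ ι,
        (⟪v, (η • Q + K).complexCLM v - ξ • v⟫).re ≤ -c * ‖v‖ ^ 2) ∧
      ∃ r : Fin p → ℂ → EuclideanSpace ℂ ι,
        (∀ j w, DifferentiableOn ℂ (fun ξ => ⟪w, r j ξ⟫) {ξ | γ₀ < ξ.re}) ∧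
        (∀ ξ : ℂ, γ₀ < ξ.re → ∀ β : EuclideanSpace ℂ (Fin p),
          ‖∑ j, β j • r j ξ‖ ≤ C * ‖β‖) ∧
        (∀ ξ : ℂ, γ₀ < ξ.re → ∀ (v : EuclideanSpace ℂ ι) (δ : ℝ), 0 ≤ δ →
          (∀ Z Z' : ℝ → EuclideanSpace ℂ ι, (∀ x, HasDerivAt Z (Z' x) x) → ExpDecay Z →
            (∀ x, A.complexCLM (Z' x) =
              -((η • Q + K).complexCLM (Z x) - (starRingEnd ℂ ξ) • Z x)) →
            ‖⟪A.complexCLM (Z 0), v⟫‖ ≤ δ * ‖Z 0‖) →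
          ‖v - ∑ j, (B.complexCLM v) j • r j ξ‖ ≤ C' * δ) := by
  have hAi := Matrix.complexCLM_inv_apply hdet
  have hAi' := Matrix.inv_complexCLM_apply hdet
  have hsig : HasSignature A.complexCLM p (Fintype.card ι - p) := by
    rw [hp]; exact hasSignature_complexCLM hA hdet
  have hsym := @euclideanCLM_symbolMatrix ι _ _ A Q
  have hBs : ∀ {c₁ : ℝ}, (∀ (η : ℝ) (ξ : ℂ), 0 ≤ η → 0 < ξ.re →
      ∀ v ∈ stableSpace (symbolMatrix A Q ξ η).euclideanCLM, ‖v‖ ≤ c₁ * ‖B.complexCLM v‖) →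
      ∀ (η : ℝ) (ξ : ℂ), 0 ≤ η → 0 < ξ.re → ∀ v ∈ stableSpace
        (((A.map ((↑) : ℝ → ℂ))⁻¹).euclideanCLM.comp ((η : ℂ) • Q.complexCLM - ξ • 1)),
        ‖v‖ ≤ c₁ * ‖B.complexCLM v‖ := fun h η ξ hη hξ v hv => by
    rw [← hsym] at hv
    exact h η ξ hη hξ v hv
  have hAs : ∀ v w, ⟪A.complexCLM v, w⟫ = ⟪v, A.complexCLM w⟫ := hA.inner_complexCLM
  have hQs' : ∀ v w, ⟪Q.complexCLM v, w⟫ = ⟪v, Q.complexCLM w⟫ := hQs.inner_complexCLM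
  have hQneg := Matrix.re_inner_complexCLM_nonpos hQ
  have hHs : ∀ η : ℝ, ∀ v w, ⟪(η • Q + K).complexCLM v, w⟫ = ⟪v, (η • Q + K).complexCLM w⟫ :=
    fun η => ((hQs.smul η).add hK).inner_complexCLM
  have hHsplit := fun η : ℝ => Matrix.complexCLM_smul_add η Q K
  have hKreiss : ∃ c₁ : ℝ, 0 ≤ c₁ ∧ ∀ (η : ℝ) (ξ : ℂ), 0 ≤ η → 0 < ξ.re →
      ∀ v ∈ stableSpace (symbolMatrix A Q ξ η).euclideanCLM, ‖v‖ ≤ c₁ * ‖B.complexCLM v‖ := by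
    have hM₀ : ∀ (η : ℝ) (ξ : ℂ) v, A.complexCLM ((symbolMatrix A Q ξ η).euclideanCLM v) =
        ((η : ℂ) • Q.complexCLM - ξ • 1) v := fun η ξ v => by
      rw [hsym, ContinuousLinearMap.comp_apply, hAi]
    have hD₀ : ∀ (η : ℝ) (ξ : ℂ), 0 ≤ η → 0 < ξ.re → ∀ v, v ≠ 0 →
        (⟪v, ((η : ℂ) • Q.complexCLM - ξ • 1) v⟫).re < 0 := fun η ξ hη hξ v hv => by
      have h1 := re_inner_sub_smul_self ((η : ℂ) • Q.complexCLM) ξ v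
      have h3 : ((η : ℂ) • Q.complexCLM - ξ • 1) v = ((η : ℂ) • Q.complexCLM) v - ξ • v := by simp
      have h2 : (⟪v, ((η : ℂ) • Q.complexCLM) v⟫).re ≤ 0 := by
        rw [_root_.smul_apply, inner_smul_right, Complex.re_ofReal_mul]
        exact mul_nonpos_of_nonneg_of_nonpos hη (hQneg v)
      refine neg_of_le_neg_mul_norm_sq hξ hv ?_
      rw [h3, h1]
      linarith
    have hfr := fun (η : ℝ) (ξ : ℂ) (hη : 0 ≤ η) (hξ : 0 < ξ.re) => finrank_stableSpace_eq
      hsig hAs (hM₀ η ξ) (hD₀ η ξ hη hξ)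
    refine hB.exists_norm_le (fun η ξ hη hξ => (hfr η ξ hη hξ).2.2)
      (fun η ξ hη hξ μ v hv h0 hμ => ?_) (fun η ξ hη hξ => (hfr η ξ hη hξ).1)
    have h1 := hD₀ η ξ hη hξ v h0
    have h2 : (⟪v, A.complexCLM v⟫).im = 0 := by
      rw [← Complex.conj_eq_iff_im, inner_conj_symm, hAs]
    rw [← hM₀, hv, map_smul, inner_smul_right, Complex.mul_re, hμ, h2] at h1
    simp at h1
  obtain ⟨c₁, hc₁, hKr⟩ := hKreiss
  replace hKr := hBs hKr
  -- nothing but the relations collected so far is needed of the matrices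
  generalize A.complexCLM = AC at *
  generalize ((A.map ((↑) : ℝ → ℂ))⁻¹).euclideanCLM = Ai at *
  generalize Q.complexCLM = QC at *
  generalize K.complexCLM = KC at *
  generalize B.complexCLM = BC at *
  obtain ⟨γ₀, c, hγ₀, hc, hlow⟩ := exists_norm_le_perturbed (K := KC) hsig hAs hAi hAi' hQs' hQneg
    hc₁ hKr
  refine ⟨γ₀, c, 2 * c₁, (1 + 2 * c₁ * ‖BC‖) * ‖Ai‖, hγ₀, hc, by positivity, by positivity,
    fun η hη => ?_⟩
  have hH := hHs η
  rw [hHsplit η] at hH ⊢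
  replace hlow := fun ξ => hlow η ξ hη
  generalize (η : ℂ) • QC + KC = H at *
  refine ⟨fun ξ hξ => (hlow ξ hξ).1, ?_⟩
  have hlift := fun β : EuclideanSpace ℂ (Fin p) => exists_differentiableOn_stable_lift hsig
    (finrank_euclideanSpace_fin (𝕜 := ℂ)) hAs hAi hAi' hH
    (M := fun ξ => Ai.comp (H - ξ • 1))
    (fun ξ v => by rw [ContinuousLinearMap.comp_apply, hAi]; simp) hc
    (fun ξ hξ => (hlow ξ hξ).1) (fun ξ hξ => (hlow ξ hξ).2) β
  choose r hr hrd using fun j : Fin p => hlift (EuclideanSpace.single j 1)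
  have hBsum : ∀ ξ : ℂ, γ₀ < ξ.re → ∀ β : EuclideanSpace ℂ (Fin p),
      (∑ j, β j • r j ξ) ∈ stableSpace (Ai.comp (H - ξ • 1)) ∧ BC (∑ j, β j • r j ξ) = β := by
    intro ξ hξ β
    refine ⟨Submodule.sum_mem _ fun j _ => Submodule.smul_mem _ _ (hr j ξ hξ).1, ?_⟩
    rw [map_sum]
    ext i
    simp [(hr _ ξ hξ).2, Pi.single_apply]
  have hrbound : ∀ ξ : ℂ, γ₀ < ξ.re → ∀ β : EuclideanSpace ℂ (Fin p),
      ‖∑ j, β j • r j ξ‖ ≤ 2 * c₁ * ‖β‖ := by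
    intro ξ hξ β
    have h1 := (hlow ξ hξ).2 _ (hBsum ξ hξ β).1
    rwa [(hBsum ξ hξ β).2] at h1
  refine ⟨r, hrd, hrbound, fun ξ hξ v δ hδ h => ?_⟩
  let L : EuclideanSpace ℂ (Fin p) →ₗ[ℂ] EuclideanSpace ℂ ι :=
    { toFun := fun β => ∑ j, β j • r j ξ
      map_add' := fun a b => by simp [add_smul, Finset.sum_add_distrib]
      map_smul' := fun a b => by simp [smul_smul, Finset.smul_sum] }
  refine norm_sub_lift_le (D := H - ξ • 1) (D' := H - (starRingEnd ℂ ξ) • 1) hsig hAs hAi hAi'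
    (fun w hw => neg_of_le_neg_mul_norm_sq hc hw (by simpa using (hlow ξ hξ).1 w))
    (fun v w => ?_) hδ (by positivity) L (hrbound ξ hξ) (fun u hu => ?_) fun Z Z' hZ hZd hZZ => ?_
  · simp only [_root_.sub_apply, _root_.smul_apply, one_apply_eq_self, inner_sub_left,
      inner_sub_right, inner_smul_left, inner_smul_right, Complex.conj_conj, hH]
  · -- the lift inverts `B` on the stable subspace, since `B` is injective there
    have h1 := (hlow ξ hξ).2 _ (Submodule.sub_mem _ (hBsum ξ hξ (BC u)).1 hu)
    rw [map_sub, (hBsum ξ hξ (BC u)).2, sub_self, norm_zero, mul_zero] at h1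
    exact sub_eq_zero.1 (norm_le_zero_iff.1 h1)
  · exact h Z Z' hZ hZd fun x => by rw [hZZ]; simp

end BoundaryLift

/-! ### The Laplace transform -/

section PaleyWiener

open scoped FourierTransform SchwartzMap ENNReal

/-- Plancherel's theorem for an integrable and square integrable function, whose Fourier transform
is given by the integral. -/
theorem memLp_fourier_and_eLpNorm_eq {f : ℝ → ℂ} (h1 : Integrable f) (h2 : MemLp f 2) :
    MemLp (𝓕 f) 2 ∧ eLpNorm (𝓕 f) 2 volume = eLpNorm f 2 volume := by
  set F : Lp ℂ 2 (volume : Measure ℝ) := 𝓕 h2.toLp with hF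
  have hcont : Continuous (𝓕 f) :=
    VectorFourier.fourierIntegral_continuous Real.continuous_fourierChar
      (by exact continuous_inner) h1
  have hae : 𝓕 f =ᵐ[volume] F := by
    have hloc : LocallyIntegrable (fun x => 𝓕 f x - F x) :=
      hcont.locallyIntegrable.sub ((Lp.memLp F).locallyIntegrable one_le_two)
    have hz := ae_eq_zero_of_integral_contDiff_smul_eq_zero hloc fun g hg hgc => ?_
    · filter_upwards [hz] with x hx using sub_eq_zero.1 hx
    have hg₁ : HasCompactSupport (Complex.ofRealCLM ∘ g) := hgc.comp_left rfl
    have hg₂ : ContDiff ℝ ∞ (Complex.ofRealCLM ∘ g) := Complex.ofRealCLM.contDiff.comp hg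
    set G : 𝓢(ℝ, ℂ) := hg₁.toSchwartzMap hg₂ with hG
    have hGa : ∀ x, G x = (g x : ℂ) := fun x => rfl
    have e1 : ∫ x, G x • F x = ∫ x, (𝓕 G) x • f x := by
      rw [← Lp.toTemperedDistribution_apply, hF, ← Lp.fourier_toTemperedDistribution_eq]
      rw [TemperedDistribution.fourier_apply, Lp.toTemperedDistribution_apply]
      exact integral_congr_ae (by filter_upwards [h2.coeFn_toLp] with x hx; rw [hx])
    have e2 : ∫ x, G x • 𝓕 f x = ∫ x, (𝓕 G) x • f x := by
      have h3 := VectorFourier.integral_fourierIntegral_smul_eq_flip (L := innerₗ ℝ)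
        (μ := volume) (ν := volume) Real.continuous_fourierChar (by exact continuous_inner)
        h1 G.integrable
      have h4 : (innerₗ ℝ).flip = innerₗ ℝ := flip_innerₗ ℝ
      rw [h4] at h3
      calc ∫ x, G x • 𝓕 f x = ∫ x, 𝓕 f x • G x := by simp_rw [smul_eq_mul, mul_comm]
        _ = ∫ x, f x • 𝓕 (G : ℝ → ℂ) x := h3
        _ = _ := by simp_rw [smul_eq_mul, mul_comm, SchwartzMap.fourier_coe]
    have i1 : Integrable fun x => G x • F x :=
      (G.memLp 2 volume).integrable_mul (Lp.memLp F)
    have i2 : Integrable fun x => G x • 𝓕 f x := by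
      obtain ⟨C, hC⟩ : ∃ C, ∀ x, ‖𝓕 f x‖ ≤ C :=
        ⟨_, fun x => VectorFourier.norm_fourierIntegral_le_integral_norm _ _ _ _ _⟩
      exact G.integrable.mul_bdd (c := C) hcont.aestronglyMeasurable (ae_of_all _ hC)
    calc ∫ x, g x • (𝓕 f x - F x) = ∫ x, (G x • 𝓕 f x - G x • F x) := by
          congr 1
          funext x
          rw [hGa, ← smul_sub, Complex.real_smul, smul_eq_mul]
      _ = 0 := by rw [integral_sub i2 i1, e1, e2, sub_self]
  refine ⟨(memLp_congr_ae hae).2 (Lp.memLp F), ?_⟩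
  rw [eLpNorm_congr_ae hae]
  have h3 : ‖F‖ = ‖h2.toLp‖ := Lp.norm_fourier_eq _
  rw [Lp.norm_def, Lp.norm_def, ENNReal.toReal_eq_toReal_iff' (Lp.memLp F).2.ne
    (Lp.memLp _).2.ne, eLpNorm_congr_ae h2.coeFn_toLp] at h3
  exact h3

theorem toReal_eLpNorm_two_sq {α E : Type*} [MeasurableSpace α] {μ : Measure α}
    [NormedAddCommGroup E] {u : α → E} (hu : MemLp u 2 μ) :
    (eLpNorm u 2 μ).toReal ^ 2 = ∫ x, ‖u x‖ ^ 2 ∂μ := by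
  rw [hu.eLpNorm_eq_integral_rpow_norm (by norm_num) (by norm_num), ENNReal.toReal_ofReal
    (by positivity)]
  have : 0 ≤ ∫ x, ‖u x‖ ^ 2 ∂μ := integral_nonneg fun x => by positivity
  rw [← Real.rpow_natCast, ← Real.rpow_mul (by simpa using this)]
  norm_num

/-- The Cauchy–Schwarz inequality. -/
theorem integral_mul_le_sqrt_mul_sqrt {α : Type*} [MeasurableSpace α] {μ : Measure α}
    {f g : α → ℝ} (hf : MemLp f 2 μ) (hg : MemLp g 2 μ) :
    ∫ x, f x * g x ∂μ ≤ Real.sqrt (∫ x, f x ^ 2 ∂μ) * Real.sqrt (∫ x, g x ^ 2 ∂μ) := by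
  have h := integral_mul_norm_le_Lp_mul_Lq (μ := μ) (f := f) (g := g) (p := 2) (q := 2)
    Real.HolderConjugate.two_two (by simpa using hf) (by simpa using hg)
  calc ∫ x, f x * g x ∂μ ≤ ∫ x, ‖f x‖ * ‖g x‖ ∂μ := by
        refine integral_mono (hf.integrable_mul hg) (hf.norm.integrable_mul hg.norm) fun x => ?_
        rw [← norm_mul]
        exact le_abs_self _
    _ ≤ _ := by
        simpa [Real.sqrt_eq_rpow] using h

/-- The two-sided Laplace transform `∫ e^{-ξ t} f(t) dt`. -/
noncomputable def laplace (f : ℝ → ℂ) (ξ : ℂ) : ℂ := ∫ t : ℝ, Complex.exp (-ξ * t) * f t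

theorem integrable_exp_mul {f : ℝ → ℂ} {a b : ℝ} (hf : Integrable f)
    (hs : ∀ t, t ∉ Icc a b → f t = 0) (ξ : ℂ) :
    Integrable fun t : ℝ => Complex.exp (-ξ * t) * f t := by
  have h1 : IntegrableOn (fun t : ℝ => Complex.exp (-ξ * t) * f t) (Icc a b) :=
    hf.integrableOn.continuousOn_mul (by fun_prop) isCompact_Icc
  rw [← integrableOn_iff_integrable_of_support_subset (s := Icc a b)]
  · exact h1
  · intro t ht
    by_contra h
    exact ht (by simp [hs t h])

theorem differentiable_laplace {f : ℝ → ℂ} {a b : ℝ} (hf : Integrable f)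
    (hs : ∀ t, t ∉ Icc a b → f t = 0) : Differentiable ℂ (laplace f) := by
  intro ξ₀
  set R := max |a| |b| with hR
  refine (hasDerivAt_integral_of_dominated_loc_of_deriv_le
    (F := fun (ξ : ℂ) (t : ℝ) => Complex.exp (-ξ * t) * f t)
    (F' := fun (ξ : ℂ) (t : ℝ) => Complex.exp (-ξ * t) * (-1 * t) * f t)
    (bound := fun t => Real.exp ((‖ξ₀‖ + 1) * R) * R * ‖f t‖) (s := Metric.ball ξ₀ 1)
    (Metric.ball_mem_nhds _ one_pos) ?_ (integrable_exp_mul hf hs ξ₀) ?_ ?_ ?_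
    ?_).2.differentiableAt
  · exact Eventually.of_forall fun ξ => (integrable_exp_mul hf hs ξ).aestronglyMeasurable
  · have hc : Continuous fun t : ℝ => Complex.exp (-ξ₀ * t) * (-1 * t) := by fun_prop
    exact hc.aestronglyMeasurable.mul hf.aestronglyMeasurable
  · refine ae_of_all _ fun t ξ hξ => ?_
    by_cases ht : t ∈ Icc a b
    · have ht' : |t| ≤ R := abs_le_max_abs_abs ht.1 ht.2
      rw [norm_mul, norm_mul]
      gcongr
      · rw [Complex.norm_exp]
        refine Real.exp_le_exp.2 ((Complex.re_le_norm _).trans ?_)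
        rw [norm_mul, norm_neg, Complex.norm_real, Real.norm_eq_abs]
        have h1 : ‖ξ‖ ≤ ‖ξ₀‖ + 1 := by
          have h2 : ‖ξ - ξ₀‖ < 1 := by rwa [← dist_eq_norm]
          calc ‖ξ‖ = ‖ξ₀ + (ξ - ξ₀)‖ := by congr 1; ring
            _ ≤ ‖ξ₀‖ + ‖ξ - ξ₀‖ := norm_add_le _ _
            _ ≤ _ := by linarith
        gcongr
      · simpa using ht'
    · simp [hs t ht]
  · exact hf.norm.const_mul _
  · refine ae_of_all _ fun t ξ _ => ?_
    have h1 : HasDerivAt (fun ξ : ℂ => -ξ * (t : ℂ)) (-1 * (t : ℂ)) ξ :=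
      (hasDerivAt_neg ξ).mul_const _
    exact h1.cexp.mul_const _

/-- On a vertical line, the Laplace transform is the Fourier transform of `e^{-γ t} f(t)`. -/
theorem laplace_eq_fourier (f : ℝ → ℂ) (γ w : ℝ) :
    laplace f (γ + 2 * Real.pi * w * Complex.I) =
      𝓕 (fun t : ℝ => Complex.exp (-γ * t) * f t) w := by
  rw [Real.fourier_real_eq_integral_exp_smul, laplace]
  congr 1
  funext t
  rw [smul_eq_mul, ← mul_assoc, ← Complex.exp_add]
  congr 2
  push_cast
  ring

/-- The test function `φ` is the inverse Laplace transform of `ξ ↦ laplace φ (-ξ)`, so the pairing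
with `φ` can be computed on any vertical line. -/
theorem integral_mul_eq_integral_laplace {φ : ℝ → ℂ} (hφ : ContDiff ℝ ∞ φ)
    (hc : HasCompactSupport φ) {g : ℝ → ℂ} {a b : ℝ} (hg : Integrable g)
    (hs : ∀ t, t ∉ Icc a b → g t = 0) (γ : ℝ) :
    ∫ t, φ t * g t = ∫ w : ℝ, laplace φ (-(γ + 2 * Real.pi * w * Complex.I)) *
      laplace g (γ + 2 * Real.pi * w * Complex.I) := by
  have hf₂ : ContDiff ℝ ∞ fun t : ℝ => Complex.exp (γ * t) * φ t := by
    refine ContDiff.mul (ContDiff.cexp ?_) hφ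
    exact contDiff_const.mul Complex.ofRealCLM.contDiff
  have hf₁ : HasCompactSupport fun t : ℝ => Complex.exp (γ * t) * φ t := hc.mul_left
  set F : 𝓢(ℝ, ℂ) := hf₁.toSchwartzMap hf₂ with hF
  have hFa : ∀ t, F t = Complex.exp (γ * t) * φ t := fun t => rfl
  have hG := integrable_exp_mul hg hs γ
  have h3 := VectorFourier.integral_fourierIntegral_smul_eq_flip (L := innerₗ ℝ)
    (μ := volume) (ν := volume) Real.continuous_fourierChar (by exact continuous_inner)
    hG (𝓕⁻ F).integrable
  rw [flip_innerₗ ℝ] at h3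
  have h4 : ∀ w : ℝ, (𝓕⁻ F) w = laplace φ (-(γ + 2 * Real.pi * w * Complex.I)) := fun w => by
    rw [SchwartzMap.fourierInv_coe, Real.fourierInv_eq_fourier_neg,
      Real.fourier_real_eq_integral_exp_smul, laplace]
    congr 1
    funext t
    rw [hFa, smul_eq_mul, ← mul_assoc, ← Complex.exp_add]
    congr 2
    push_cast
    ring
  have h5 : ∀ t, VectorFourier.fourierIntegral 𝐞 volume (innerₗ ℝ) (𝓕⁻ F : 𝓢(ℝ, ℂ)) t = F t :=
    fun t => by
      change (𝓕 (𝓕⁻ F : 𝓢(ℝ, ℂ)) : 𝓢(ℝ, ℂ)) t = F t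
      rw [FourierTransform.fourier_fourierInv_eq]
  have h6 : ∀ w : ℝ, VectorFourier.fourierIntegral 𝐞 volume (innerₗ ℝ)
      (fun t : ℝ => Complex.exp (-γ * t) * g t) w = laplace g (γ + 2 * Real.pi * w * Complex.I) :=
    fun w => (laplace_eq_fourier g γ w).symm
  simp_rw [h4, h5, h6] at h3
  calc ∫ t, φ t * g t = ∫ t : ℝ, (Complex.exp (-γ * t) * g t) • F t := by
        congr 1
        funext t
        have : Complex.exp (-γ * t) * Complex.exp (γ * t) = 1 := by
          rw [← Complex.exp_add]; simp
        rw [hFa, smul_eq_mul]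
        linear_combination (-(φ t * g t)) * this
    _ = _ := by
        rw [← h3]
        simp_rw [smul_eq_mul, mul_comm]

end PaleyWiener

/-! ### Contour shifts and Plancherel's theorem for the Laplace transform -/

section ContourShift

open scoped FourierTransform SchwartzMap ENNReal

theorem laplace_neg_deriv {φ : ℝ → ℂ} (hφ : ContDiff ℝ 1 φ) (hc : HasCompactSupport φ) (ξ : ℂ) :
    laplace (deriv φ) (-ξ) = -(ξ * laplace φ (-ξ)) := by
  have hd : ∀ t : ℝ, HasDerivAt (fun t : ℝ => Complex.exp (- -ξ * t))
      (ξ * Complex.exp (- -ξ * t)) t := fun t => by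
      have h1 : HasDerivAt (fun t : ℝ => - -ξ * (t : ℂ)) ξ t := by
        simpa using (Complex.ofRealCLM.hasDerivAt (x := t)).const_mul (- -ξ)
      simpa [mul_comm] using h1.cexp
  have hφ' : Continuous (deriv φ) := hφ.continuous_deriv le_rfl
  have hint : ∀ {u v : ℝ → ℂ}, Continuous u → Continuous v → HasCompactSupport v →
      Integrable (u * v) := fun hu hv hvc =>
    (hu.mul hv).integrable_of_hasCompactSupport hvc.mul_left
  have he : Continuous fun t : ℝ => Complex.exp (- -ξ * t) := by fun_prop
  have he' : Continuous fun t : ℝ => ξ * Complex.exp (- -ξ * t) := by fun_prop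
  have := integral_mul_deriv_eq_deriv_mul_of_integrable (fun t _ => hd t)
    (fun t _ => (hφ.differentiable one_ne_zero t).hasDerivAt) (hint he hφ' hc.deriv)
    (hint he' hφ.continuous hc) (hint he hφ.continuous hc)
  rw [laplace, this, laplace, ← integral_const_mul]
  congr 2
  funext t
  ring

/-- The Laplace transform of a test function supported in `[0, b]` decays quadratically, with a
constant growing like `e^{b Re ξ}`. -/
theorem exists_norm_laplace_neg_le {φ : ℝ → ℂ} (hφ : ContDiff ℝ ∞ φ) (hc : HasCompactSupport φ)
    {b : ℝ} (hs : ∀ t, t ∉ Icc 0 b → φ t = 0) :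
    ∃ K : ℝ, 0 ≤ K ∧ ∀ ξ : ℂ, 0 < ξ.re →
      ‖laplace φ (-ξ)‖ ≤ K * Real.exp (b * ξ.re) / ‖ξ‖ ^ 2 := by
  have hφ1 : ContDiff ℝ 1 (deriv φ) :=
    (contDiff_infty_iff_deriv.1 hφ).2.of_le (by exact_mod_cast le_top)
  have hcd : HasCompactSupport (deriv (deriv φ)) := hc.deriv.deriv
  have hcont : Continuous (deriv (deriv φ)) := hφ1.continuous_deriv le_rfl
  have hsupp : ∀ t, t ∉ Icc 0 b → deriv (deriv φ) t = 0 := by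
    intro t ht
    have h1 : tsupport φ ⊆ Icc 0 b :=
      closure_minimal (fun x hx => by by_contra h; exact hx (hs x h)) isClosed_Icc
    have h2 := (tsupport_deriv_subset (f := deriv φ)).trans
      ((tsupport_deriv_subset (f := φ)).trans h1)
    exact image_eq_zero_of_notMem_tsupport fun h => ht (h2 h)
  have hint : Integrable (deriv (deriv φ)) := hcont.integrable_of_hasCompactSupport hcd
  refine ⟨∫ t, ‖deriv (deriv φ) t‖, integral_nonneg fun _ => norm_nonneg _, fun ξ hξ => ?_⟩
  have hξ0 : ξ ≠ 0 := fun h => by simp [h] at hξ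
  have h1 : ξ ^ 2 * laplace φ (-ξ) = laplace (deriv (deriv φ)) (-ξ) := by
    rw [laplace_neg_deriv hφ1 hc.deriv,
      laplace_neg_deriv (hφ.of_le (by exact_mod_cast le_top)) hc]
    ring
  rw [le_div_iff₀ (by positivity), mul_comm, ← norm_pow, ← norm_mul, h1, mul_comm (∫ t, _),
    ← integral_const_mul]
  refine norm_integral_le_of_norm_le (hint.norm.const_mul _) (ae_of_all _ fun t => ?_)
  by_cases ht : t ∈ Icc 0 b
  · rw [norm_mul, Complex.norm_exp]
    gcongr
    have h2 : (- -ξ * (t : ℂ)).re = t * ξ.re := by simp [mul_comm]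
    rw [h2]
    have := ht.2
    gcongr
  · rw [hsupp t ht]; simp

/-- Shift of a vertical contour for an integrand with quadratic decay. -/
theorem integral_vertical_eq {f : ℂ → ℂ} {γ₁ γ₂ M : ℝ} (h0 : 0 < γ₁) (h12 : γ₁ ≤ γ₂)
    (hf : DifferentiableOn ℂ f {ξ | γ₁ ≤ ξ.re})
    (hM : ∀ ξ : ℂ, γ₁ ≤ ξ.re → ξ.re ≤ γ₂ → ‖f ξ‖ ≤ M / ‖ξ‖ ^ 2) :
    ∫ y : ℝ, f (γ₁ + y * Complex.I) = ∫ y : ℝ, f (γ₂ + y * Complex.I) := by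
  have hsub : ∀ R : ℝ, DifferentiableOn ℂ f (uIcc γ₁ γ₂ ×ℂ uIcc (-R) R) := fun R =>
    hf.mono fun ξ hξ => by
      have := (Complex.mem_reProdIm.1 hξ).1
      rw [uIcc_of_le h12] at this
      exact this.1
  have hline : ∀ γ : ℝ, γ₁ ≤ γ → Continuous fun y : ℝ => f (γ + y * Complex.I) := by
    intro γ hγ
    refine hf.continuousOn.comp_continuous (by fun_prop) fun y => ?_
    simpa using hγ
  have hM0 : 0 ≤ M := by
    have h1 := (norm_nonneg _).trans (hM γ₁ (by simp) (by simpa using h12))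
    by_contra hneg
    have h2 : M / ‖(γ₁ : ℂ)‖ ^ 2 < 0 := div_neg_of_neg_of_pos (not_le.1 hneg) (by
      have : ‖(γ₁ : ℂ)‖ = γ₁ := by simp [abs_of_pos h0]
      rw [this]; positivity)
    linarith
  have hnormsq : ∀ γ y : ℝ, ‖(γ : ℂ) + y * Complex.I‖ ^ 2 = γ ^ 2 + y ^ 2 := by
    intro γ y
    rw [← Complex.normSq_eq_norm_sq, Complex.normSq_add_mul_I]
  have hint : ∀ γ : ℝ, γ₁ ≤ γ → γ ≤ γ₂ → Integrable fun y : ℝ => f (γ + y * Complex.I) := by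
    intro γ hγ hγ'
    have hγ0 : 0 < γ := h0.trans_le hγ
    have h1 : Integrable fun y : ℝ => M / min 1 (γ ^ 2) * (1 + y ^ 2)⁻¹ :=
      integrable_inv_one_add_sq.const_mul _
    refine h1.mono' (hline γ hγ).aestronglyMeasurable (ae_of_all _ fun y => ?_)
    refine (hM _ (by simpa using hγ) (by simpa using hγ')).trans ?_
    rw [hnormsq, ← div_eq_mul_inv, div_div]
    have hmin : 0 < min 1 (γ ^ 2) := lt_min one_pos (by positivity)
    refine div_le_div_of_nonneg_left hM0 (by positivity) ?_
    have h2 : min 1 (γ ^ 2) ≤ 1 := min_le_left _ _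
    have h3 : min 1 (γ ^ 2) ≤ γ ^ 2 := min_le_right _ _
    nlinarith [sq_nonneg y]
  have hrect : ∀ R : ℝ, Complex.I • (∫ y in (-R)..R, f (γ₂ + y * Complex.I))
      - Complex.I • (∫ y in (-R)..R, f (γ₁ + y * Complex.I)) =
      (∫ x in γ₁..γ₂, f (x + R * Complex.I)) - ∫ x in γ₁..γ₂, f (x + (-R : ℝ) * Complex.I) := by
    intro R
    have h := Complex.integral_boundary_rect_eq_zero_of_differentiableOn f
      (γ₁ + (-R : ℝ) * Complex.I) (γ₂ + R * Complex.I) (by simpa using hsub R)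
    simp only [Complex.add_re, Complex.ofReal_re, Complex.mul_re, Complex.I_re, mul_zero,
      Complex.ofReal_im, Complex.I_im, mul_one, sub_self, add_zero, Complex.add_im, Complex.mul_im,
      zero_add] at h
    linear_combination h
  have hhor : ∀ s : ℝ → ℝ, (∀ R, |s R| = |R|) →
      Tendsto (fun R : ℝ => ∫ x in γ₁..γ₂, f (x + s R * Complex.I)) atTop (𝓝 0) := by
    intro s hs
    have hlim : Tendsto (fun R : ℝ => M / R ^ 2 * |γ₂ - γ₁|) atTop (𝓝 0) := by
      have : Tendsto (fun R : ℝ => M / R ^ 2) atTop (𝓝 0) :=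
        tendsto_const_nhds.div_atTop (tendsto_pow_atTop two_ne_zero)
      simpa using this.mul_const |γ₂ - γ₁|
    refine squeeze_zero_norm' ?_ hlim
    filter_upwards [eventually_gt_atTop 0] with R hR
    refine intervalIntegral.norm_integral_le_of_norm_le_const fun x hx => ?_
    rw [uIoc_of_le h12] at hx
    refine (hM _ (by simpa using hx.1.le) (by simpa using hx.2)).trans ?_
    rw [hnormsq, ← sq_abs (s R), hs, sq_abs]
    gcongr
    nlinarith [sq_nonneg x]
  have hlim1 := (intervalIntegral_tendsto_integral (hint γ₁ le_rfl h12) tendsto_neg_atTop_atBot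
    tendsto_id).const_smul Complex.I
  have hlim2 := (intervalIntegral_tendsto_integral (hint γ₂ h12 le_rfl) tendsto_neg_atTop_atBot
    tendsto_id).const_smul Complex.I
  have hlim3 := (hhor (fun R => R) fun R => rfl).sub (hhor (fun R => -R) fun R => abs_neg R)
  have := tendsto_nhds_unique (hlim2.sub hlim1) (by
    simpa only [id, hrect] using hlim3)
  rw [sub_self, sub_eq_zero] at this
  exact ((smul_right_injective ℂ Complex.I_ne_zero) this).symm

/-- Plancherel's theorem on a vertical line. -/
theorem integral_sq_norm_laplace {f : ℝ → ℂ} {a b : ℝ} (hf : Integrable f) (hf2 : MemLp f 2)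
    (hs : ∀ t, t ∉ Icc a b → f t = 0) (γ : ℝ) :
    MemLp (fun w : ℝ => laplace f (γ + 2 * Real.pi * w * Complex.I)) 2 ∧
    ∫ w : ℝ, ‖laplace f (γ + 2 * Real.pi * w * Complex.I)‖ ^ 2 =
      ∫ t : ℝ, Real.exp (-2 * γ * t) * ‖f t‖ ^ 2 := by
  have h1 : Integrable fun t : ℝ => Complex.exp (-γ * t) * f t := integrable_exp_mul hf hs γ
  have hb : MemLp (fun t : ℝ => Complex.exp (-γ * t) * f t) 2 := by
    refine hf2.of_le_mul (c := Real.exp (|γ| * max |a| |b|)) h1.aestronglyMeasurable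
      (ae_of_all _ fun t => ?_)
    by_cases ht : t ∈ Icc a b
    · rw [norm_mul]
      gcongr
      rw [Complex.norm_exp]
      refine Real.exp_le_exp.2 ((Complex.re_le_norm _).trans ?_)
      rw [norm_mul, norm_neg, Complex.norm_real, Complex.norm_real]
      gcongr
      · exact le_rfl
      · exact abs_le_max_abs_abs ht.1 ht.2
    · simp [hs t ht]
  obtain ⟨h2, h3⟩ := memLp_fourier_and_eLpNorm_eq h1 hb
  simp_rw [laplace_eq_fourier]
  refine ⟨h2, ?_⟩
  rw [← toReal_eLpNorm_two_sq h2, h3, toReal_eLpNorm_two_sq hb]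
  congr 1
  funext t
  rw [norm_mul, mul_pow, Complex.norm_exp, ← Real.exp_nat_mul]
  congr 2
  simp
  ring

end ContourShift

/-! ### Causality -/

section Causality

theorem exp_sub_mul_tendsto {a b : ℝ} (h : a < b) (K : ℝ) :
    Tendsto (fun γ : ℝ => K * Real.exp (-(b - a) * γ)) atTop (𝓝 0) := by
  have : Tendsto (fun γ : ℝ => Real.exp (-(b - a) * γ)) atTop (𝓝 0) :=
    Real.tendsto_exp_atBot.comp (tendsto_id.const_mul_atTop_of_neg (by linarith))
  simpa using this.const_mul K

theorem integrable_inv_sq_line {γ : ℝ} (hγ : 0 < γ) :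
    Integrable fun w : ℝ => (‖(γ : ℂ) + 2 * Real.pi * w * Complex.I‖ ^ 2)⁻¹ := by
  have hn : ∀ w : ℝ, ‖(γ : ℂ) + 2 * Real.pi * w * Complex.I‖ ^ 2 = γ ^ 2 + (2 * Real.pi * w) ^ 2 :=
    fun w => by
      have := Complex.normSq_add_mul_I γ (2 * Real.pi * w)
      rw [← this, Complex.normSq_eq_norm_sq]
      push_cast
      rfl
  have h1 : Integrable fun w : ℝ => (min 1 (γ ^ 2))⁻¹ * (1 + w ^ 2)⁻¹ :=
    integrable_inv_one_add_sq.const_mul _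
  have hmin : 0 < min 1 (γ ^ 2) := lt_min one_pos (by positivity)
  refine h1.mono' ?_ (ae_of_all _ fun w => ?_)
  · have hc : Continuous fun w : ℝ => γ ^ 2 + (2 * Real.pi * w) ^ 2 := by fun_prop
    simp_rw [hn]
    exact (hc.inv₀ fun w => by positivity).aestronglyMeasurable
  · rw [hn, Real.norm_of_nonneg (by positivity), ← mul_inv]
    refine inv_anti₀ (by positivity) ?_
    have h2 : min 1 (γ ^ 2) ≤ 1 := min_le_left _ _
    have h3 : min 1 (γ ^ 2) ≤ γ ^ 2 := min_le_right _ _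
    have h4 : (1 : ℝ) ≤ (2 * Real.pi) ^ 2 := by nlinarith [Real.pi_gt_three]
    nlinarith [sq_nonneg w, mul_nonneg (sub_nonneg.2 h4) (sq_nonneg w)]

/-- Causality. Suppose that the transform of `g` is obtained from those of the `b j` by holomorphic
multipliers `ρ j`, bounded in a half-plane, up to an error that is `O(e^{-T' Re ξ})`. Then on
`[0, T')` the function `g` is controlled by `b`: pairing with a test function supported
there, the multiplier part does not change when the contour is moved to the right, while the
error part vanishes in the limit. -/
theorem norm_integral_mul_le_of_laplace {p : ℕ} {γ₀ γ₁ C K T T' T'' : ℝ} {g : ℝ → ℂ}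
    {b : Fin p → ℝ → ℂ} {ρ : Fin p → ℂ → ℂ} (hγ₀ : 0 < γ₀) (hγ₁ : γ₀ < γ₁) (hC : 0 ≤ C)
    (hT : T'' < T') (hT0 : 0 ≤ T'')
    (hg : Integrable g) (hgs : ∀ t, t ∉ Icc 0 T → g t = 0)
    (hb : ∀ j, MemLp (b j) 2) (hbs : ∀ j t, t ∉ Icc 0 T → b j t = 0)
    (hρ : ∀ j, DifferentiableOn ℂ (ρ j) {ξ | γ₀ < ξ.re})
    (hρC : ∀ ξ : ℂ, γ₀ < ξ.re → ∀ β : EuclideanSpace ℂ (Fin p), ‖∑ j, β j * ρ j ξ‖ ≤ C * ‖β‖)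
    (herr : ∀ ξ : ℂ, γ₁ ≤ ξ.re →
      ‖laplace g ξ - ∑ j, laplace (b j) ξ * ρ j ξ‖ ≤ K * Real.exp (-T' * ξ.re))
    {φ : ℝ → ℂ} (hφ : ContDiff ℝ ∞ φ) (hc : HasCompactSupport φ)
    (hφs : ∀ t, t ∉ Icc 0 T'' → φ t = 0) :
    ‖∫ t, φ t * g t‖ ≤ C * Real.exp (γ₁ * T'') * Real.sqrt (∫ t, ‖φ t‖ ^ 2) *
      Real.sqrt (∑ j, ∫ t, ‖b j t‖ ^ 2) := by
  have hγ₁0 : 0 < γ₁ := hγ₀.trans hγ₁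
  have hbi : ∀ j, Integrable (b j) := fun j => by
    rw [← integrableOn_iff_integrable_of_support_subset (s := Icc 0 T)]
    · exact ((hb j).restrict _).integrable one_le_two
    · intro t ht
      by_contra h
      exact ht (hbs j t h)
  have hφi : Integrable φ := hφ.continuous.integrable_of_hasCompactSupport hc
  obtain ⟨Kφ, hKφ0, hKφ⟩ := exists_norm_laplace_neg_le hφ hc hφs
  set Φ : ℂ → ℂ := fun ξ => laplace φ (-ξ) with hΦ
  have hΦd : Differentiable ℂ Φ := (differentiable_laplace hφi hφs).comp differentiable_neg
  set G : ℂ → ℂ := fun ξ => ∑ j, laplace (b j) ξ * ρ j ξ with hG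
  have hGd : DifferentiableOn ℂ G {ξ | γ₀ < ξ.re} :=
    DifferentiableOn.fun_sum fun j _ =>
      (differentiable_laplace (hbi j) (hbs j)).differentiableOn.mul (hρ j)
  set ℓ : ℝ → ℝ → ℂ := fun γ w => γ + 2 * Real.pi * w * Complex.I with hℓ
  have hℓre : ∀ γ w, (ℓ γ w).re = γ := fun γ w => by simp [hℓ]
  have hℓc : ∀ γ, Continuous (ℓ γ) := fun γ => by simp only [hℓ]; fun_prop
  have hΦb : ∀ γ w, 0 < γ → ‖Φ (ℓ γ w)‖ ≤ Kφ * Real.exp (T'' * γ) * (‖ℓ γ w‖ ^ 2)⁻¹ :=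
    fun γ w hγ => by
      have h1 := hKφ (ℓ γ w) (by rw [hℓre]; exact hγ)
      rwa [hℓre, div_eq_mul_inv] at h1
  have hGc : ∀ γ, γ₁ ≤ γ → Continuous fun w => G (ℓ γ w) := fun γ hγ =>
    hGd.continuousOn.comp_continuous (hℓc γ) fun w => by
      change γ₀ < (ℓ γ w).re
      rw [hℓre]; linarith
  -- bound of the multiplier part on a strip
  have hlapb : ∀ γ₂, ∃ M : ℝ, 0 ≤ M ∧ ∀ ξ : ℂ, γ₁ ≤ ξ.re → ξ.re ≤ γ₂ → ‖G ξ‖ ≤ M := by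
    intro γ₂
    set N : ℝ := Real.sqrt (∑ j, (∫ t, ‖b j t‖) ^ 2) with hN
    refine ⟨C * N, by positivity, fun ξ hξ _ => ?_⟩
    have h1 : ∀ j, ‖laplace (b j) ξ‖ ≤ ∫ t, ‖b j t‖ := fun j => by
      refine norm_integral_le_of_norm_le (hbi j).norm (ae_of_all _ fun t => ?_)
      by_cases ht : t ∈ Icc 0 T
      · rw [norm_mul, Complex.norm_exp]
        refine mul_le_of_le_one_left (norm_nonneg _) (Real.exp_le_one_iff.2 ?_)
        have : (-ξ * (t : ℂ)).re = -(ξ.re * t) := by simp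
        rw [this]
        have := ht.1
        have : 0 ≤ ξ.re * t := mul_nonneg (by linarith) this
        linarith
      · simp [hbs j t ht]
    have h2 := hρC ξ (hγ₁.trans_le hξ) (WithLp.toLp 2 fun j => laplace (b j) ξ)
    refine h2.trans ?_
    gcongr
    rw [EuclideanSpace.norm_eq]
    refine Real.sqrt_le_sqrt (Finset.sum_le_sum fun j _ => ?_)
    have := h1 j
    simp only
    gcongr
  -- the multiplier part is independent of the contour
  have hshift : ∀ γ, γ₁ ≤ γ →
      ∫ w, Φ (ℓ γ₁ w) * G (ℓ γ₁ w) = ∫ w, Φ (ℓ γ w) * G (ℓ γ w) := by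
    intro γ hγ
    obtain ⟨M, hM0, hM⟩ := hlapb γ
    have h1 := integral_vertical_eq (f := fun ξ => Φ ξ * G ξ)
      (M := Kφ * Real.exp (T'' * γ) * M) hγ₁0 hγ
      (hΦd.differentiableOn.mul (hGd.mono fun ξ hξ => hγ₁.trans_le hξ)) (fun ξ h1 h2 => ?_)
    · have hscale : ∀ γ : ℝ, ∫ w, Φ (ℓ γ w) * G (ℓ γ w) =
          (2 * Real.pi)⁻¹ • ∫ y : ℝ, Φ (γ + y * Complex.I) * G (γ + y * Complex.I) := by
        intro γ
        have h3 := Measure.integral_comp_mul_left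
          (fun y : ℝ => Φ (γ + y * Complex.I) * G (γ + y * Complex.I)) (2 * Real.pi)
        rw [abs_of_pos (by positivity)] at h3
        rw [← h3]
        simp only [hℓ]
        push_cast
        rfl
      rw [hscale, hscale, h1]
    · have h3 := hKφ ξ (hγ₁0.trans_le h1)
      rw [norm_mul]
      calc ‖Φ ξ‖ * ‖G ξ‖ ≤ (Kφ * Real.exp (T'' * ξ.re) / ‖ξ‖ ^ 2) * M := by
            gcongr
            exact hM ξ h1 h2
        _ ≤ (Kφ * Real.exp (T'' * γ) / ‖ξ‖ ^ 2) * M := by gcongr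
        _ = _ := by ring
  -- the error part vanishes in the limit
  have hΦint : ∀ γ, γ₁ ≤ γ → Integrable fun w => Φ (ℓ γ w) := fun γ hγ =>
    ((integrable_inv_sq_line (hγ₁0.trans_le hγ)).const_mul (Kφ * Real.exp (T'' * γ))).mono'
      (hΦd.continuous.comp (hℓc γ)).aestronglyMeasurable
      (ae_of_all _ fun w => hΦb γ w (hγ₁0.trans_le hγ))
  have hclose : ∀ γ, γ₁ ≤ γ → ‖(∫ t, φ t * g t) - ∫ w, Φ (ℓ γ₁ w) * G (ℓ γ₁ w)‖ ≤
      (|K| * Kφ * ∫ w, (‖ℓ γ₁ w‖ ^ 2)⁻¹) * Real.exp (-(T' - T'') * γ) := by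
    intro γ hγ
    have hγ0 : 0 < γ := hγ₁0.trans_le hγ
    obtain ⟨M, hM0, hM⟩ := hlapb γ
    have hbd : ∀ w, ‖G (ℓ γ w)‖ ≤ M := fun w =>
      hM _ (by rw [hℓre]; exact hγ) (by rw [hℓre])
    have i1 : Integrable fun w => Φ (ℓ γ w) * G (ℓ γ w) :=
      (hΦint γ hγ).mul_bdd (c := M) (hGc γ hγ).aestronglyMeasurable (ae_of_all _ hbd)
    have hlg : Continuous fun w => laplace g (ℓ γ w) :=
      (differentiable_laplace hg hgs).continuous.comp (hℓc γ)
    have hE : ∀ w, ‖laplace g (ℓ γ w) - G (ℓ γ w)‖ ≤ |K| * Real.exp (-T' * γ) := fun w => by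
      have h1 := herr (ℓ γ w) (by rw [hℓre]; exact hγ)
      rw [hℓre] at h1
      exact h1.trans (by gcongr; exact le_abs_self K)
    have i2 : Integrable fun w => Φ (ℓ γ w) * (laplace g (ℓ γ w) - G (ℓ γ w)) :=
      (hΦint γ hγ).mul_bdd (c := |K| * Real.exp (-T' * γ))
        (hlg.sub (hGc γ hγ)).aestronglyMeasurable (ae_of_all _ hE)
    have hsplit : (∫ t, φ t * g t) - ∫ w, Φ (ℓ γ w) * G (ℓ γ w) =
        ∫ w, Φ (ℓ γ w) * (laplace g (ℓ γ w) - G (ℓ γ w)) := by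
      have h1 := integral_mul_eq_integral_laplace hφ hc hg hgs γ
      have h2 : (fun w => Φ (ℓ γ w) * laplace g (ℓ γ w)) = fun w =>
          Φ (ℓ γ w) * (laplace g (ℓ γ w) - G (ℓ γ w)) + Φ (ℓ γ w) * G (ℓ γ w) := by
        funext w; ring
      rw [h1]
      change (∫ w, Φ (ℓ γ w) * laplace g (ℓ γ w)) - _ = _
      rw [h2, integral_add i2 i1]
      ring
    rw [hshift γ hγ, hsplit]
    have i3 := (integrable_inv_sq_line hγ₁0).const_mul
      (|K| * Kφ * Real.exp (-(T' - T'') * γ))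
    refine (norm_integral_le_of_norm_le i3 (ae_of_all _ fun w => ?_)).trans_eq ?_
    · rw [norm_mul]
      have hmono : (‖ℓ γ w‖ ^ 2)⁻¹ ≤ (‖ℓ γ₁ w‖ ^ 2)⁻¹ := by
        have hn : ∀ γ, ‖ℓ γ w‖ ^ 2 = γ ^ 2 + (2 * Real.pi * w) ^ 2 := fun γ => by
          have := Complex.normSq_add_mul_I γ (2 * Real.pi * w)
          rw [← this, Complex.normSq_eq_norm_sq]
          simp only [hℓ]
          push_cast
          rfl
        rw [hn, hn]
        gcongr
      calc ‖Φ (ℓ γ w)‖ * ‖laplace g (ℓ γ w) - G (ℓ γ w)‖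
          ≤ (Kφ * Real.exp (T'' * γ) * (‖ℓ γ₁ w‖ ^ 2)⁻¹) * (|K| * Real.exp (-T' * γ)) := by
            refine mul_le_mul ((hΦb γ w hγ0).trans (by gcongr)) (hE w) (norm_nonneg _)
              (by positivity)
        _ = |K| * Kφ * (Real.exp (T'' * γ) * Real.exp (-T' * γ)) * (‖ℓ γ₁ w‖ ^ 2)⁻¹ := by ring
        _ = _ := by
            rw [← Real.exp_add]
            congr 3
            ring_nf
    · rw [integral_const_mul]
      ring
  have hEq : ∫ t, φ t * g t = ∫ w, Φ (ℓ γ₁ w) * G (ℓ γ₁ w) := by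
    have h1 := ge_of_tendsto (exp_sub_mul_tendsto hT (|K| * Kφ * ∫ w, (‖ℓ γ₁ w‖ ^ 2)⁻¹))
      ((eventually_ge_atTop γ₁).mono hclose)
    rw [← sub_eq_zero]
    exact norm_le_zero_iff.1 h1
  -- Plancherel on the line `Re ξ = γ₁`
  have hβ := fun j => integral_sq_norm_laplace (hbi j) (hb j) (hbs j) γ₁
  have hφ2 : MemLp φ 2 := hφ.continuous.memLp_of_hasCompactSupport hc
  have hΦ2 : MemLp (fun w => Φ (ℓ γ₁ w)) 2 ∧
      ∫ w, ‖Φ (ℓ γ₁ w)‖ ^ 2 = ∫ t : ℝ, Real.exp (2 * γ₁ * t) * ‖φ t‖ ^ 2 := by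
    obtain ⟨h1, h2⟩ := integral_sq_norm_laplace hφi hφ2 hφs (-γ₁)
    have h3 : ∀ w : ℝ, Φ (ℓ γ₁ w) =
        laplace φ (((-γ₁ : ℝ) : ℂ) + 2 * Real.pi * (-w : ℝ) * Complex.I) := fun w => by
      simp only [hΦ, hℓ]
      congr 1
      push_cast
      ring
    constructor
    · simp_rw [h3]
      exact h1.comp_measurePreserving (Measure.measurePreserving_neg volume)
    · simp_rw [h3]
      rw [integral_neg_eq_self (fun w : ℝ => ‖laplace φ (((-γ₁ : ℝ) : ℂ) +
        2 * Real.pi * w * Complex.I)‖ ^ 2) volume, h2]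
      simp
  set β : ℝ → ℝ := fun w => Real.sqrt (∑ j, ‖laplace (b j) (ℓ γ₁ w)‖ ^ 2) with hβdef
  have hβ2i : Integrable fun w => ∑ j, ‖laplace (b j) (ℓ γ₁ w)‖ ^ 2 :=
    integrable_finsetSum _ fun j _ => (hβ j).1.integrable_norm_pow two_ne_zero
  have hβc : Continuous β := by
    refine Real.continuous_sqrt.comp (continuous_finsetSum _ fun j _ => ?_)
    exact (((differentiable_laplace (hbi j) (hbs j)).continuous.comp (hℓc γ₁)).norm.pow 2)
  have hβsq : ∀ w, β w ^ 2 = ∑ j, ‖laplace (b j) (ℓ γ₁ w)‖ ^ 2 := fun w =>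
    Real.sq_sqrt (Finset.sum_nonneg fun j _ => by positivity)
  have hβ2 : MemLp β 2 := by
    rw [memLp_two_iff_integrable_sq hβc.aestronglyMeasurable]
    simp_rw [hβsq]
    exact hβ2i
  have hGβ : ∀ w, ‖G (ℓ γ₁ w)‖ ≤ C * β w := fun w => by
    have h2 := hρC (ℓ γ₁ w) (by rw [hℓre]; exact hγ₁)
      (WithLp.toLp 2 fun j => laplace (b j) (ℓ γ₁ w))
    rwa [EuclideanSpace.norm_eq] at h2
  rw [hEq]
  calc ‖∫ w, Φ (ℓ γ₁ w) * G (ℓ γ₁ w)‖ ≤ ∫ w, C * (‖Φ (ℓ γ₁ w)‖ * β w) := by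
        refine norm_integral_le_of_norm_le ((hΦ2.1.norm.integrable_mul hβ2).const_mul C)
          (ae_of_all _ fun w => ?_)
        rw [norm_mul]
        calc _ ≤ ‖Φ (ℓ γ₁ w)‖ * (C * β w) := by gcongr; exact hGβ w
          _ = _ := by ring
    _ = C * ∫ w, ‖Φ (ℓ γ₁ w)‖ * β w := integral_const_mul _ _
    _ ≤ C * (Real.sqrt (∫ w, ‖Φ (ℓ γ₁ w)‖ ^ 2) * Real.sqrt (∫ w, β w ^ 2)) := by
        gcongr
        exact integral_mul_le_sqrt_mul_sqrt hΦ2.1.norm hβ2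
    _ ≤ C * ((Real.exp (γ₁ * T'') * Real.sqrt (∫ t, ‖φ t‖ ^ 2)) *
          Real.sqrt (∑ j, ∫ t, ‖b j t‖ ^ 2)) := by
        gcongr
        · rw [hΦ2.2, ← Real.sqrt_sq (Real.exp_nonneg (γ₁ * T'')), ← Real.sqrt_mul (by positivity),
            ← integral_const_mul]
          refine Real.sqrt_le_sqrt (integral_mono_of_nonneg (ae_of_all _ fun t => by positivity)
            ((hφ2.integrable_norm_pow two_ne_zero).const_mul _) (ae_of_all _ fun t => ?_))
          by_cases ht : t ∈ Icc 0 T''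
          · simp only
            rw [← Real.exp_nat_mul]
            refine mul_le_mul_of_nonneg_right (Real.exp_le_exp.2 ?_) (by positivity)
            have := ht.2
            push_cast
            nlinarith
          · simp [hφs t ht]
        · simp_rw [hβsq]
          rw [integral_finsetSum _ fun j _ => (hβ j).1.integrable_norm_pow two_ne_zero]
          refine Finset.sum_le_sum fun j _ => ?_
          rw [(hβ j).2]
          refine integral_mono_of_nonneg (ae_of_all _ fun t => by positivity)
            ((hb j).integrable_norm_pow two_ne_zero) (ae_of_all _ fun t => ?_)
          by_cases ht : t ∈ Icc 0 T
          · refine mul_le_of_le_one_left (by positivity) (Real.exp_le_one_iff.2 ?_)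
            have := mul_nonneg hγ₁0.le ht.1
            linarith
          · simp [hbs j t ht]
    _ = _ := by ring

end Causality

/-! ### Weak derivatives on the half-line -/

section HalfLine

/-- `f'` is the weak derivative of `f` on the half-line `(0, ∞)`, and `a` is the boundary value of
`f` at `0`. The test functions need not vanish at `0`, so that the boundary value is part of the
notion. -/
def HasWeakDerivIoi {F : Type*} [NormedAddCommGroup F] [NormedSpace ℝ F] (f f' : ℝ → F)
    (a : F) : Prop :=
  ∀ ψ : ℝ → ℝ, ContDiff ℝ ∞ ψ → HasCompactSupport ψ →
    (∫ x in Ioi (0 : ℝ), deriv ψ x • f x) + (∫ x in Ioi (0 : ℝ), ψ x • f' x) + ψ 0 • a = 0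

theorem MeasureTheory.MemLp.intervalIntegrable_of_Ioi {F : Type*} [NormedAddCommGroup F]
    {f : ℝ → F} (hf : MemLp f 2 (volume.restrict (Ioi 0))) {X : ℝ} (hX : 0 ≤ X) :
    IntervalIntegrable f volume 0 X := by
  rw [intervalIntegrable_iff_integrableOn_Ioc_of_le hX]
  have h : MemLp f 2 (volume.restrict (Ioc 0 X)) :=
    hf.mono_measure (Measure.restrict_mono_set volume Ioc_subset_Ioi_self)
  exact h.integrable one_le_two

/-- Integration by parts for two indefinite integrals. -/
theorem integral_mul_add_mul_primitive {f g : ℝ → ℝ} {X : ℝ} (a b : ℝ)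
    (hf : IntervalIntegrable f volume 0 X) (hg : IntervalIntegrable g volume 0 X) :
    ∫ x in (0)..X, (f x * (b + ∫ t in (0)..x, g t) + (a + ∫ t in (0)..x, f t) * g x) =
      (a + ∫ t in (0)..X, f t) * (b + ∫ t in (0)..X, g t) - a * b := by
  have hac : ∀ {f : ℝ → ℝ} (a : ℝ), IntervalIntegrable f volume 0 X →
      AbsolutelyContinuousOnInterval (fun x => a + ∫ t in (0)..x, f t) 0 X := fun {f} a hf => by
    have h1 : AbsolutelyContinuousOnInterval (fun _ : ℝ => a) 0 X :=
      (contDiff_const.contDiffOn).absolutelyContinuousOnInterval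
    exact h1.fun_add (hf.absolutelyContinuousOnInterval_intervalIntegral left_mem_uIcc)
  have h := (hac a hf).integral_deriv_mul_eq_sub (hac b hg)
  simp only [intervalIntegral.integral_same, add_zero] at h
  rw [← h]
  refine intervalIntegral.integral_congr_ae ?_
  filter_upwards [hf.ae_hasDerivAt_integral, hg.ae_hasDerivAt_integral] with x h1 h2 hx
  have h3 := ((h1 (uIoc_subset_uIcc hx) 0 left_mem_uIcc).const_add a).deriv
  have h4 := ((h2 (uIoc_subset_uIcc hx) 0 left_mem_uIcc).const_add b).deriv
  rw [h3, h4]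

theorem continuousOn_primitive_Ici {f : ℝ → ℝ} (hf : MemLp f 2 (volume.restrict (Ioi 0))) :
    ContinuousOn (fun x => ∫ t in (0)..x, f t) (Ici 0) := by
  intro x hx
  have hx0 : (0 : ℝ) ≤ x := hx
  have h1 := intervalIntegral.continuousOn_primitive_interval
    (μ := volume) (f := f) (a := 0) (b := x + 1) (by
      rw [uIcc_of_le (by linarith)]
      exact intervalIntegrable_iff_integrableOn_Icc_of_le (by linarith) |>.1
        (hf.intervalIntegrable_of_Ioi (by linarith)))
  rw [uIcc_of_le (by linarith)] at h1
  refine (h1 x ⟨hx, by linarith⟩).mono_of_mem_nhdsWithin ?_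
  rw [mem_nhdsWithin]
  exact ⟨Iio (x + 1), isOpen_Iio, by simp, fun y hy => ⟨hy.2, (mem_Iio.1 hy.1).le⟩⟩

/-- A square integrable function with a square integrable weak derivative is an indefinite integral
of the latter. -/
theorem HasWeakDerivIoi.ae_eq {f f' : ℝ → ℝ} {a : ℝ} (h : HasWeakDerivIoi f f' a)
    (hf : MemLp f 2 (volume.restrict (Ioi 0))) (hf' : MemLp f' 2 (volume.restrict (Ioi 0))) :
    f =ᵐ[volume.restrict (Ioi 0)] fun x => a + ∫ t in (0)..x, f' t := by
  set F : ℝ → ℝ := fun x => a + ∫ t in (0)..x, f' t with hF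
  have hFc : ContinuousOn F (Ici 0) := continuousOn_const.add (continuousOn_primitive_Ici hf')
  -- the primitive itself satisfies the weak formulation
  have hFw : ∀ ψ : ℝ → ℝ, ContDiff ℝ ∞ ψ → HasCompactSupport ψ →
      IntegrableOn (fun x => deriv ψ x * F x) (Ioi 0) ∧
      (∫ x in Ioi (0 : ℝ), deriv ψ x * F x) + (∫ x in Ioi (0 : ℝ), ψ x * f' x) + ψ 0 * a = 0 := by
    intro ψ hψ hc
    obtain ⟨X, hX0, hX⟩ : ∃ X : ℝ, 0 ≤ X ∧ ∀ x, X ≤ x → ψ x = 0 ∧ deriv ψ x = 0 := by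
      obtain ⟨R, hR⟩ := (hc.isCompact.isBounded).subset_closedBall 0
      refine ⟨max 0 (R + 1), le_max_left _ _, fun x hx => ?_⟩
      have hx' : x ∉ tsupport ψ := fun hxs => by
        have h1 := hR hxs
        rw [mem_closedBall_zero_iff, Real.norm_eq_abs] at h1
        have := le_abs_self x
        have := le_max_right 0 (R + 1)
        linarith
      exact ⟨image_eq_zero_of_notMem_tsupport hx',
        image_eq_zero_of_notMem_tsupport fun h => hx' (tsupport_deriv_subset h)⟩
    have hdc : Continuous (deriv ψ) := hψ.continuous_deriv (by simp)
    have hi : IntervalIntegrable (deriv ψ) volume 0 X := hdc.intervalIntegrable _ _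
    have hcut : ∀ g : ℝ → ℝ, (∀ x, X < x → g x = 0) →
        ∫ x in Ioi (0 : ℝ), g x = ∫ x in (0)..X, g x := by
      intro g hg
      rw [intervalIntegral.integral_of_le hX0]
      refine (setIntegral_eq_of_subset_of_forall_sdiff_eq_zero measurableSet_Ioi
        Ioc_subset_Ioi_self fun x hx => hg x ?_)
      by_contra hcon
      exact hx.2 ⟨hx.1, not_lt.1 hcon⟩
    have hFX : ContinuousOn F (Icc 0 X) := hFc.mono Icc_subset_Ici_self
    refine ⟨?_, ?_⟩
    · have h1 : IntegrableOn (fun x => deriv ψ x * F x) (Icc 0 X) :=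
        (hdc.continuousOn.mul hFX).integrableOn_Icc
      refine (h1.of_forall_sdiff_eq_zero measurableSet_Ioi fun x hx => ?_)
      rw [(hX x ?_).2, zero_mul]
      by_contra hcon
      exact hx.2 ⟨(mem_Ioi.1 hx.1).le, (not_le.1 hcon).le⟩
    · rw [hcut _ fun x hx => by rw [(hX x hx.le).2, zero_mul],
        hcut _ fun x hx => by rw [(hX x hx.le).1, zero_mul]]
      have hψ0 : ∀ x, ψ 0 + ∫ t in (0)..x, deriv ψ t = ψ x := fun x => by
        rw [intervalIntegral.integral_deriv_eq_sub
          (fun x _ => (hψ.differentiable (by simp)).differentiableAt)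
          (hdc.intervalIntegrable _ _)]
        ring
      have h2 := integral_mul_add_mul_primitive (ψ 0) a hi (hf'.intervalIntegrable_of_Ioi hX0)
      simp only [hψ0] at h2
      rw [intervalIntegral.integral_add, (hX X le_rfl).1] at h2
      · linarith
      · exact (hdc.continuousOn.mul (by rw [uIcc_of_le hX0]; exact hFX)).intervalIntegrable
      · exact (hf'.intervalIntegrable_of_Ioi hX0).continuousOn_mul hψ.continuous.continuousOn
  have hloc : LocallyIntegrable ((Ioi (0 : ℝ)).indicator fun x => f x - F x) := by
    rw [locallyIntegrable_iff]
    intro k hk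
    obtain ⟨R, hR⟩ := hk.isBounded.subset_closedBall 0
    rw [IntegrableOn, integrable_indicator_iff measurableSet_Ioi, IntegrableOn,
      Measure.restrict_restrict measurableSet_Ioi]
    have h1 : IntegrableOn (fun x => f x - F x) (Ioc 0 |R|) := by
      refine Integrable.sub ?_ ?_
      · exact (intervalIntegrable_iff_integrableOn_Ioc_of_le (abs_nonneg R)).1
          (hf.intervalIntegrable_of_Ioi (abs_nonneg R))
      · exact ((hFc.mono Icc_subset_Ici_self).integrableOn_Icc (b := |R|)).mono_set
          Ioc_subset_Icc_self
    refine h1.mono_set fun x hx => ⟨hx.1, ?_⟩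
    have := hR hx.2
    rw [mem_closedBall_zero_iff, Real.norm_eq_abs] at this
    exact (le_abs_self x).trans (this.trans (le_abs_self R))
  have hz := ae_eq_zero_of_integral_contDiff_smul_eq_zero hloc fun φ hφ hφc => ?_
  · rw [EventuallyEq, ae_restrict_iff' measurableSet_Ioi]
    filter_upwards [hz] with x hx hx0
    rw [indicator_of_mem hx0] at hx
    linarith
  -- every test function agrees on the half-line with the derivative of a test function
  obtain ⟨R, hR⟩ := (hφc.isCompact.isBounded).subset_closedBall 0
  have hφR : ∀ x, |R| < x → φ x = 0 := fun x hx =>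
    image_eq_zero_of_notMem_tsupport fun hxs => by
      have := hR hxs
      rw [mem_closedBall_zero_iff, Real.norm_eq_abs] at this
      have h1 := le_abs_self x
      have h2 := le_abs_self R
      linarith
  set Φ : ℝ → ℝ := fun x => ∫ t in (|R|)..x, φ t with hΦ
  have hΦd : ∀ x, HasDerivAt Φ (φ x) x := fun x =>
    intervalIntegral.integral_hasDerivAt_right (hφ.continuous.intervalIntegrable _ _)
      hφ.continuous.stronglyMeasurable.stronglyMeasurableAtFilter hφ.continuous.continuousAt
  have hΦs : ContDiff ℝ ∞ Φ := by
    rw [contDiff_infty_iff_deriv]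
    refine ⟨fun x => (hΦd x).differentiableAt, ?_⟩
    rwa [show deriv Φ = φ from funext fun x => (hΦd x).deriv]
  have hΦR : ∀ x, |R| < x → Φ x = 0 := fun x hx => by
    refine intervalIntegral.integral_zero_ae (ae_of_all _ fun t ht => hφR t ?_)
    rw [uIoc_of_le hx.le] at ht
    exact ht.1
  set ψ : ℝ → ℝ := fun x => Real.smoothTransition (x + 1) * Φ x with hψ
  have hψs : ContDiff ℝ ∞ ψ := by
    have := Real.smoothTransition.contDiff (n := ⊤)
    exact (this.comp (contDiff_id.add contDiff_const)).mul hΦs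
  have hψc : HasCompactSupport ψ := by
    refine HasCompactSupport.intro (isCompact_Icc (a := -1) (b := |R|)) fun x hx => ?_
    rcases lt_or_ge x (-1) with h1 | h1
    · simp only [hψ]
      rw [Real.smoothTransition.zero_of_nonpos (by linarith), zero_mul]
    · simp only [hψ]
      rw [hΦR x (not_le.1 fun h2 => hx ⟨h1, h2⟩), mul_zero]
  have hψd : ∀ x, 0 < x → deriv ψ x = φ x := by
    intro x hx
    have : ψ =ᶠ[𝓝 x] Φ := by
      filter_upwards [Ioi_mem_nhds hx] with y hy
      simp only [hψ]
      rw [Real.smoothTransition.one_of_one_le (by linarith [mem_Ioi.1 hy]), one_mul]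
    rw [this.deriv_eq, (hΦd x).deriv]
  have e1 := h ψ hψs hψc
  obtain ⟨i2, e2⟩ := hFw ψ hψs hψc
  simp only [smul_eq_mul] at e1
  have i1 : IntegrableOn (fun x => deriv ψ x * f x) (Ioi 0) := by
    have : MemLp (deriv ψ) 2 (volume.restrict (Ioi 0)) :=
      ((hψs.continuous_deriv (by simp)).memLp_of_hasCompactSupport hψc.deriv).restrict _
    exact MemLp.integrable_mul this hf
  have e3 : (∫ x in Ioi (0 : ℝ), deriv ψ x * f x) - ∫ x in Ioi (0 : ℝ), deriv ψ x * F x = 0 := by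
    linarith
  rw [← integral_sub i1 i2] at e3
  calc ∫ x, φ x • (Ioi (0 : ℝ)).indicator (fun x => f x - F x) x
      = ∫ x in Ioi (0 : ℝ), φ x * (f x - F x) := by
        rw [← integral_indicator measurableSet_Ioi]
        refine integral_congr_ae (ae_of_all _ fun x => ?_)
        by_cases hx : x ∈ Ioi (0 : ℝ) <;> simp [hx]
    _ = ∫ x in Ioi (0 : ℝ), (deriv ψ x * f x - deriv ψ x * F x) :=
        setIntegral_congr_fun measurableSet_Ioi fun x hx => by
          rw [hψd x hx]
          ring
    _ = 0 := e3

/-- Integration by parts on the half-line for functions of class `H¹`; there is no contribution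
from infinity. -/
theorem HasWeakDerivIoi.integral_mul_add_mul {f f' g g' : ℝ → ℝ} {a b : ℝ}
    (hf : HasWeakDerivIoi f f' a) (hg : HasWeakDerivIoi g g' b)
    (f2 : MemLp f 2 (volume.restrict (Ioi 0))) (f2' : MemLp f' 2 (volume.restrict (Ioi 0)))
    (g2 : MemLp g 2 (volume.restrict (Ioi 0))) (g2' : MemLp g' 2 (volume.restrict (Ioi 0))) :
    ∫ x in Ioi (0 : ℝ), (f' x * g x + f x * g' x) = -(a * b) := by
  have hfe := hf.ae_eq f2 f2'
  have hge := hg.ae_eq g2 g2'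
  set F : ℝ → ℝ := fun x => a + ∫ t in (0)..x, f' t with hF
  set G : ℝ → ℝ := fun x => b + ∫ t in (0)..x, g' t with hG
  have hi : IntegrableOn (fun x => f' x * G x + F x * g' x) (Ioi 0) :=
    (MemLp.integrable_mul f2' (g2.ae_eq hge)).add (MemLp.integrable_mul (f2.ae_eq hfe) g2')
  have hlim : Tendsto (fun X => F X * G X) atTop
      (𝓝 (a * b + ∫ x in Ioi (0 : ℝ), (f' x * G x + F x * g' x))) := by
    have h1 := (intervalIntegral_tendsto_integral_Ioi 0 hi tendsto_id).const_add (a * b)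
    refine h1.congr' ?_
    filter_upwards [eventually_ge_atTop 0] with X hX
    have := integral_mul_add_mul_primitive a b (f2'.intervalIntegrable_of_Ioi hX)
      (g2'.intervalIntegrable_of_Ioi hX)
    simp only [id]
    linarith
  have hFG : IntegrableOn (fun x => F x * G x) (Ioi 0) :=
    MemLp.integrable_mul (f2.ae_eq hfe) (g2.ae_eq hge)
  -- the product has a limit at infinity and is integrable, hence the limit is `0`
  have h0 := IntegrableAtFilter.eq_zero_of_tendsto (μ := volume) (l := atTop)
    ⟨Ioi 0, Ioi_mem_atTop 0, hFG⟩ (fun s hs => ?_) hlim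
  · rw [integral_congr_ae (g := fun x => f' x * G x + F x * g' x)]
    · linarith
    · filter_upwards [hfe, hge] with x h1 h2
      rw [h1, h2]
  · obtain ⟨c, hc⟩ := mem_atTop_sets.1 hs
    refine top_unique ?_
    rw [← Real.volume_Ici (a := c)]
    exact measure_mono hc

end HalfLine

/-! ### Vector valued weak derivatives -/

section WeakDerivative

theorem HasWeakDerivIoi.clm {F G : Type*} [NormedAddCommGroup F] [NormedSpace ℝ F]
    [NormedAddCommGroup G] [NormedSpace ℝ G] [CompleteSpace F] [CompleteSpace G] {f f' : ℝ → F}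
    {a : F} (h : HasWeakDerivIoi f f' a) (L : F →L[ℝ] G)
    (f2 : MemLp f 2 (volume.restrict (Ioi 0))) (f2' : MemLp f' 2 (volume.restrict (Ioi 0))) :
    HasWeakDerivIoi (fun x => L (f x)) (fun x => L (f' x)) (L a) := by
  intro ψ hψ hc
  have h1 : MemLp (deriv ψ) 2 (volume.restrict (Ioi 0)) :=
    ((hψ.continuous_deriv (by simp)).memLp_of_hasCompactSupport hc.deriv).restrict _
  have h2 : MemLp ψ 2 (volume.restrict (Ioi 0)) :=
    (hψ.continuous.memLp_of_hasCompactSupport hc).restrict _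
  have i1 : Integrable (fun x => deriv ψ x • f x) (volume.restrict (Ioi 0)) :=
    memLp_one_iff_integrable.1 (f2.smul h1)
  have i2 : Integrable (fun x => ψ x • f' x) (volume.restrict (Ioi 0)) :=
    memLp_one_iff_integrable.1 (f2'.smul h2)
  have h3 := congrArg L (h ψ hψ hc)
  rw [map_add, map_add, ← L.integral_comp_comm i1, ← L.integral_comp_comm i2, map_zero] at h3
  simpa only [map_smul] using h3

variable {E : Type*} [NormedAddCommGroup E] [InnerProductSpace ℂ E] [FiniteDimensional ℂ E]

local notation "⟪" x ", " y "⟫" => inner ℂ x y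

/-- Integration by parts on the half-line for vector valued functions of class `H¹`. -/
theorem HasWeakDerivIoi.integral_re_inner_add {f f' g g' : ℝ → E} {a b : E}
    (hf : HasWeakDerivIoi f f' a) (hg : HasWeakDerivIoi g g' b)
    (f2 : MemLp f 2 (volume.restrict (Ioi 0))) (f2' : MemLp f' 2 (volume.restrict (Ioi 0)))
    (g2 : MemLp g 2 (volume.restrict (Ioi 0))) (g2' : MemLp g' 2 (volume.restrict (Ioi 0))) :
    ∫ x in Ioi (0 : ℝ), ((⟪f' x, g x⟫).re + (⟪f x, g' x⟫).re) = -(⟪a, b⟫).re := by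
  have : CompleteSpace E := FiniteDimensional.complete ℂ E
  set e := stdOrthonormalBasis ℂ E
  -- the real and imaginary parts of the coordinates
  let ρ : Fin (Module.finrank ℂ E) → E →L[ℝ] ℝ := fun i =>
    Complex.reCLM.comp ((innerSL ℂ (e i)).restrictScalars ℝ)
  let σ : Fin (Module.finrank ℂ E) → E →L[ℝ] ℝ := fun i =>
    Complex.imCLM.comp ((innerSL ℂ (e i)).restrictScalars ℝ)
  have key : ∀ v w : E, (⟪v, w⟫).re = ∑ i, (ρ i v * ρ i w + σ i v * σ i w) := fun v w => by
    rw [← e.sum_inner_mul_inner v w, Complex.re_sum]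
    refine Finset.sum_congr rfl fun i _ => ?_
    rw [← inner_conj_symm v (e i), Complex.mul_re, Complex.conj_re, Complex.conj_im]
    simp [ρ, σ]
  have hL : ∀ L : E →L[ℝ] ℝ, Integrable (fun x => L (f' x) * L (g x) + L (f x) * L (g' x))
      (volume.restrict (Ioi 0)) ∧
      ∫ x in Ioi (0 : ℝ), (L (f' x) * L (g x) + L (f x) * L (g' x)) = -(L a * L b) := fun L =>
    ⟨(MemLp.integrable_mul (f2'.continuousLinearMap_comp L) (g2.continuousLinearMap_comp L)).add
      (MemLp.integrable_mul (f2.continuousLinearMap_comp L) (g2'.continuousLinearMap_comp L)),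
     (hf.clm L f2 f2').integral_mul_add_mul (hg.clm L g2 g2') (f2.continuousLinearMap_comp L)
      (f2'.continuousLinearMap_comp L) (g2.continuousLinearMap_comp L)
      (g2'.continuousLinearMap_comp L)⟩
  calc ∫ x in Ioi (0 : ℝ), ((⟪f' x, g x⟫).re + (⟪f x, g' x⟫).re)
      = ∫ x in Ioi (0 : ℝ), ∑ i, ((ρ i (f' x) * ρ i (g x) + ρ i (f x) * ρ i (g' x)) +
          (σ i (f' x) * σ i (g x) + σ i (f x) * σ i (g' x))) := by
        refine integral_congr_ae (ae_of_all _ fun x => ?_)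
        simp only
        rw [key, key, ← Finset.sum_add_distrib]
        exact Finset.sum_congr rfl fun i _ => by ring
    _ = ∑ i, (-(ρ i a * ρ i b) + -(σ i a * σ i b)) := by
        rw [integral_finsetSum _ fun i _ => by exact (hL (ρ i)).1.add (hL (σ i)).1]
        refine Finset.sum_congr rfl fun i _ => ?_
        rw [integral_add (hL (ρ i)).1 (hL (σ i)).1, (hL (ρ i)).2, (hL (σ i)).2]
    _ = -(⟪a, b⟫).re := by
        rw [key, ← Finset.sum_neg_distrib]
        exact Finset.sum_congr rfl fun i _ => by ring

theorem ExpDecay.memLp_two {Z : ℝ → E} (hZ : ExpDecay Z) (hc : Continuous Z) :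
    MemLp Z 2 (volume.restrict (Ioi 0)) := by
  obtain ⟨C, c, hc0, h⟩ := hZ
  have h1 : MemLp (fun x : ℝ => Real.exp (-c * x)) 2 (volume.restrict (Ioi 0)) := by
    rw [memLp_two_iff_integrable_sq (by fun_prop)]
    have : IntegrableOn (fun x : ℝ => Real.exp (-(2 * c) * x)) (Ioi 0) :=
      integrableOn_exp_mul_Ioi (by linarith) 0
    refine this.congr (ae_of_all _ fun x => ?_)
    simp only
    rw [← Real.exp_nat_mul]
    congr 1
    push_cast
    ring
  refine (h1.const_mul C).mono hc.aestronglyMeasurable ?_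
  rw [ae_restrict_iff' measurableSet_Ioi]
  exact ae_of_all _ fun x hx => (h x (mem_Ioi.1 hx).le).trans (le_abs_self _)

theorem hasWeakDerivIoi_of_hasDerivAt {Z Z' : ℝ → E} (h : ∀ x, HasDerivAt Z (Z' x) x)
    (hc : Continuous Z') : HasWeakDerivIoi Z Z' (Z 0) := by
  have : CompleteSpace E := FiniteDimensional.complete ℂ E
  have hZc : Continuous Z := continuous_iff_continuousAt.2 fun x => (h x).continuousAt
  intro ψ hψ hψc
  have hd : Continuous (deriv ψ) := hψ.continuous_deriv (by simp)
  have i1 : Integrable (fun x => deriv ψ x • Z x) :=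
    (hd.smul hZc).integrable_of_hasCompactSupport hψc.deriv.smul_right
  have i2 : Integrable (fun x => ψ x • Z' x) :=
    (hψ.continuous.smul hc).integrable_of_hasCompactSupport hψc.smul_right
  have h1 : ∀ x, HasDerivAt (fun x => ψ x • Z x) (ψ x • Z' x + deriv ψ x • Z x) x := fun x =>
    ((hψ.differentiable (by simp)).differentiableAt.hasDerivAt (x := x)).fun_smul (h x)
  have h2 : Tendsto (fun x => ψ x • Z x) atTop (𝓝 0) :=
    (hψc.smul_right (f' := Z)).is_zero_at_infty.mono_left atTop_le_cocompact
  have h3 := integral_Ioi_of_hasDerivAt_of_tendsto (a := 0)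
    (h1 0).continuousAt.continuousWithinAt (fun x _ => h1 x)
    (i2.integrableOn.add i1.integrableOn) h2
  rw [integral_add i2.integrableOn i1.integrableOn] at h3
  rw [add_comm (∫ x in Ioi 0, deriv ψ x • Z x), h3]
  simp

end WeakDerivative

/-! ### Averages in time of weak solutions -/

section TimeAverage

/-- The space `L²(ℝ⁺; E)`. -/
abbrev L2Ioi (E : Type*) [NormedAddCommGroup E] : Type _ :=
  Lp E 2 (volume.restrict (Ioi (0 : ℝ)))

variable {E : Type*} [NormedAddCommGroup E] [InnerProductSpace ℂ E] [CompleteSpace E]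

local notation "⟪" x ", " y "⟫" => inner ℂ x y

/-- If the weak formulation of `∂ₜ u + A ∂ₓ u = H u` with boundary values `g` holds for products
`θ(t) ψ(x) e`, then the average of `u` over time with a weight `θ` that vanishes near `T` has
the boundary value obtained by averaging `g`, and its derivative in `x` is given by the equation. -/
theorem hasWeakDerivIoi_average {A H : E →L[ℂ] E} (hA : ∀ v w, ⟪A v, w⟫ = ⟪v, A w⟫)
    (hH : ∀ v w, ⟪H v, w⟫ = ⟪v, H w⟫) {T : ℝ} {u : ℝ → L2Ioi E} (hu : ContinuousOn u (Icc 0 T))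
    {g : ℝ → E} (hg : IntegrableOn g (Ioo 0 T)) {S : Set E}
    (hS : ∀ v, (∀ e ∈ S, ⟪e, v⟫ = 0) → v = 0)
    (hw : ∀ θ ψ : ℝ → ℝ, ContDiff ℝ ∞ θ → HasCompactSupport θ → tsupport θ ⊆ Iio T →
      ContDiff ℝ ∞ ψ → HasCompactSupport ψ → ∀ e ∈ S,
      (∫ t in Ioo 0 T, ∫ x in Ioi (0 : ℝ), (((deriv θ t : ℝ) : ℂ) * ((ψ x : ℂ) * ⟪e, u t x⟫) +
        (θ t : ℂ) * (((deriv ψ x : ℝ) : ℂ) * ⟪e, A (u t x)⟫ + (ψ x : ℂ) * ⟪e, H (u t x)⟫))) +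
        ∫ t in Ioo 0 T, (θ t : ℂ) * ((ψ 0 : ℂ) * ⟪e, A (g t)⟫) = 0)
    {θ : ℝ → ℂ} (hθ : ContDiff ℝ ∞ θ) (hθc : HasCompactSupport θ) (hθs : tsupport θ ⊆ Iio T) :
    HasWeakDerivIoi (fun x => A ((∫ t in Ioo 0 T, θ t • u t : L2Ioi E) x))
      (fun x => (∫ t in Ioo 0 T, deriv θ t • u t : L2Ioi E) x +
        H ((∫ t in Ioo 0 T, θ t • u t : L2Ioi E) x))
      (A (∫ t in Ioo 0 T, θ t • g t)) := by
  have hui : ∀ {χ : ℝ → ℂ}, Continuous χ → Integrable (fun t => χ t • u t)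
      (volume.restrict (Ioo 0 T)) := fun hχ =>
    ((hχ.continuousOn.smul hu).integrableOn_Icc).mono_set Ioo_subset_Icc_self
  have hgi : ∀ {χ : ℝ → ℂ}, Continuous χ → HasCompactSupport χ →
      Integrable (fun t => χ t • g t) (volume.restrict (Ioo 0 T)) := fun {χ} hχ hc => by
    obtain ⟨C, hC⟩ := hχ.bounded_above_of_compact_support hc
    exact hg.bdd_smul C hχ.aestronglyMeasurable (ae_of_all _ hC)
  have hθd : Continuous (deriv θ) := hθ.continuous_deriv (by simp)
  set V := ∫ t in Ioo 0 T, θ t • u t with hV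
  set G := ∫ t in Ioo 0 T, deriv θ t • u t with hG
  set γ := ∫ t in Ioo 0 T, θ t • g t with hγ
  intro ψ hψ hψc
  have hψ2 : MemLp ψ 2 (volume.restrict (Ioi (0 : ℝ))) :=
    (hψ.continuous.memLp_of_hasCompactSupport hψc).restrict _
  have hψd2 : MemLp (deriv ψ) 2 (volume.restrict (Ioi (0 : ℝ))) :=
    ((hψ.continuous_deriv (by simp)).memLp_of_hasCompactSupport hψc.deriv).restrict _
  refine hS _ fun e he => ?_
  have m0 : ∀ {χ : ℝ → ℝ} (w : E), MemLp χ 2 (volume.restrict (Ioi (0 : ℝ))) →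
      MemLp (fun x => χ x • w) 2 (volume.restrict (Ioi (0 : ℝ))) := fun {χ} w hχ => by
    refine MemLp.of_le_mul (c := ‖w‖) hχ (hχ.1.smul_const w) (ae_of_all _ fun x => ?_)
    rw [norm_smul, mul_comm]
  have m1 : MemLp (fun x => deriv ψ x • A e + ψ x • H e) 2 (volume.restrict (Ioi (0 : ℝ))) :=
    (m0 _ hψd2).add (m0 _ hψ2)
  set Ψ := (m0 e hψ2).toLp with hΨ
  set Ψ₁ := m1.toLp with hΨ₁
  have eΨ : ∀ v : L2Ioi E, ⟪Ψ, v⟫ = ∫ x in Ioi (0 : ℝ), (ψ x : ℂ) * ⟪e, v x⟫ := fun v => by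
    rw [L2.inner_def]
    refine integral_congr_ae ?_
    filter_upwards [(m0 e hψ2).coeFn_toLp] with x hx
    rw [hx, ← Complex.coe_smul, inner_smul_left, Complex.conj_ofReal]
  have eΨ₁ : ∀ v : L2Ioi E, ⟪Ψ₁, v⟫ = ∫ x in Ioi (0 : ℝ),
      (((deriv ψ x : ℝ) : ℂ) * ⟪e, A (v x)⟫ + (ψ x : ℂ) * ⟪e, H (v x)⟫) := fun v => by
    rw [L2.inner_def]
    refine integral_congr_ae ?_
    filter_upwards [m1.coeFn_toLp] with x hx
    rw [hx, ← Complex.coe_smul, ← Complex.coe_smul, inner_add_left, inner_smul_left,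
      inner_smul_left, Complex.conj_ofReal, Complex.conj_ofReal, hA, hH]
  have i0 : ∀ {χ : ℝ → ℝ} (L : E →L[ℂ] E) (v : L2Ioi E),
      MemLp χ 2 (volume.restrict (Ioi (0 : ℝ))) →
      IntegrableOn (fun x => χ x • L (v x)) (Ioi (0 : ℝ)) := fun L v hχ =>
    memLp_one_iff_integrable.1
      (MemLp.smul (𝕜 := ℝ) (E := E) ((Lp.memLp v).continuousLinearMap_comp L) hχ)
  have i0' : ∀ {χ : ℝ → ℝ} (L : E →L[ℂ] E) (v : L2Ioi E),
      MemLp χ 2 (volume.restrict (Ioi (0 : ℝ))) →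
      IntegrableOn (fun x => (χ x : ℂ) * ⟪e, L (v x)⟫) (Ioi (0 : ℝ)) := fun {χ} L v hχ => by
    refine ((i0 L v hχ).const_inner (𝕜 := ℂ) e).congr (ae_of_all _ fun x => ?_)
    simp only
    rw [← Complex.coe_smul, inner_smul_right]
  -- the separated identity for real weights, then for complex ones
  have hreal : ∀ τ : ℝ → ℝ, ContDiff ℝ ∞ τ → HasCompactSupport τ → tsupport τ ⊆ Iio T →
      (∫ t in Ioo 0 T, (((deriv τ t : ℝ) : ℂ) * ⟪Ψ, u t⟫ + (τ t : ℂ) * ⟪Ψ₁, u t⟫)) +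
        ∫ t in Ioo 0 T, (τ t : ℂ) * ((ψ 0 : ℂ) * ⟪e, A (g t)⟫) = 0 := by
    intro τ hτ hτc hτs
    rw [← hw τ ψ hτ hτc hτs hψ hψc e he]
    congr 1
    refine integral_congr_ae (ae_of_all _ fun t => ?_)
    simp only
    rw [integral_add, integral_const_mul, integral_const_mul, eΨ, eΨ₁]
    · exact (i0' (ContinuousLinearMap.id ℂ E) (u t) hψ2).const_mul _
    · exact ((i0' A (u t) hψd2).add (i0' H (u t) hψ2)).const_mul _
  have j1 : ∀ (Φ : L2Ioi E) {χ : ℝ → ℂ}, Continuous χ →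
      Integrable (fun t => χ t * ⟪Φ, u t⟫) (volume.restrict (Ioo 0 T)) := fun Φ {χ} hχ => by
    simpa only [inner_smul_right] using (hui hχ).const_inner (𝕜 := ℂ) Φ
  have j2 : ∀ {χ : ℝ → ℂ}, Continuous χ → HasCompactSupport χ →
      Integrable (fun t => χ t * ((ψ 0 : ℂ) * ⟪e, A (g t)⟫)) (volume.restrict (Ioo 0 T)) :=
    fun {χ} hχ hc => by
      have := ((A.integrable_comp (hgi hχ hc)).const_inner (𝕜 := ℂ) e).const_mul (ψ 0 : ℂ)
      simp only [map_smul, inner_smul_right] at this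
      exact this.congr (ae_of_all _ fun t => by ring)
  have hcomplex : (∫ t in Ioo 0 T, deriv θ t * ⟪Ψ, u t⟫) + (∫ t in Ioo 0 T, θ t * ⟪Ψ₁, u t⟫) +
        ∫ t in Ioo 0 T, θ t * ((ψ 0 : ℂ) * ⟪e, A (g t)⟫) = 0 := by
    have hpart : ∀ L : ℂ →L[ℝ] ℝ,
        (∫ t in Ioo 0 T, (L (deriv θ t) : ℂ) * ⟪Ψ, u t⟫) +
        (∫ t in Ioo 0 T, (L (θ t) : ℂ) * ⟪Ψ₁, u t⟫) +
        (∫ t in Ioo 0 T, (L (θ t) : ℂ) * ((ψ 0 : ℂ) * ⟪e, A (g t)⟫)) = 0 := by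
      intro L
      have hd : ∀ t, deriv (fun s => L (θ s)) t = L (deriv θ t) := fun t =>
        (L.hasFDerivAt.comp_hasDerivAt t
          (hθ.differentiable (by simp)).differentiableAt.hasDerivAt).deriv
      have hLs : tsupport (fun s => L (θ s)) ⊆ tsupport θ :=
        closure_mono fun t ht h0 => ht (by simp [h0])
      have h1 := hreal (fun s => L (θ s)) (L.contDiff.comp hθ) (hθc.comp_left (map_zero L))
        (hLs.trans hθs)
      simp only [hd] at h1
      rwa [integral_add] at h1
      · exact j1 Ψ (Complex.continuous_ofReal.comp (L.continuous.comp hθd))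
      · exact j1 Ψ₁ (Complex.continuous_ofReal.comp (L.continuous.comp hθ.continuous))
    have hsplit : ∀ (f χ : ℝ → ℂ), (∀ L : ℂ →L[ℝ] ℝ, Integrable (fun t => (L (χ t) : ℂ) * f t)
        (volume.restrict (Ioo 0 T))) → ∫ t in Ioo 0 T, χ t * f t =
        (∫ t in Ioo 0 T, (Complex.reCLM (χ t) : ℂ) * f t) +
          Complex.I * ∫ t in Ioo 0 T, (Complex.imCLM (χ t) : ℂ) * f t := by
      intro f χ hi
      rw [← integral_const_mul, ← integral_add (hi _) ((hi _).const_mul _)]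
      refine integral_congr_ae (ae_of_all _ fun t => ?_)
      simp only [Complex.reCLM_apply, Complex.imCLM_apply]
      nth_rw 1 [← Complex.re_add_im (χ t)]
      ring
    have c1 : ∀ L : ℂ →L[ℝ] ℝ, Continuous fun t => ((L (θ t) : ℝ) : ℂ) := fun L =>
      Complex.continuous_ofReal.comp (L.continuous.comp hθ.continuous)
    rw [hsplit (fun t => ⟪Ψ, u t⟫) (deriv θ) fun L =>
        j1 Ψ (Complex.continuous_ofReal.comp (L.continuous.comp hθd)),
      hsplit (fun t => ⟪Ψ₁, u t⟫) θ fun L => j1 Ψ₁ (c1 L),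
      hsplit (fun t => (ψ 0 : ℂ) * ⟪e, A (g t)⟫) θ fun L =>
        j2 (c1 L) (hθc.comp_left (g := fun z => ((L z : ℝ) : ℂ)) (by simp))]
    linear_combination hpart Complex.reCLM + Complex.I * hpart Complex.imCLM
  have e1 : ∫ t in Ioo 0 T, deriv θ t * ⟪Ψ, u t⟫ = ⟪Ψ, G⟫ := by
    rw [hG, ← integral_inner (hui hθd)]
    simp only [inner_smul_right]
  have e2 : ∫ t in Ioo 0 T, θ t * ⟪Ψ₁, u t⟫ = ⟪Ψ₁, V⟫ := by
    rw [hV, ← integral_inner (hui hθ.continuous)]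
    simp only [inner_smul_right]
  have e3 : ∫ t in Ioo 0 T, θ t * ((ψ 0 : ℂ) * ⟪e, A (g t)⟫) = (ψ 0 : ℂ) * ⟪e, A γ⟫ := by
    rw [hγ, ← A.integral_comp_comm (hgi hθ.continuous hθc),
      ← integral_inner (A.integrable_comp (hgi hθ.continuous hθc)), ← integral_const_mul]
    refine integral_congr_ae (ae_of_all _ fun t => ?_)
    simp only [map_smul, inner_smul_right]
    ring
  rw [e1, e2, e3, eΨ, eΨ₁, integral_add (i0' A V hψd2) (i0' H V hψ2)] at hcomplex
  have e4 : ∀ {χ : ℝ → ℝ} (L : E →L[ℂ] E) (v : L2Ioi E),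
      MemLp χ 2 (volume.restrict (Ioi (0 : ℝ))) → ⟪e, ∫ x in Ioi (0 : ℝ), χ x • L (v x)⟫ =
      ∫ x in Ioi (0 : ℝ), (χ x : ℂ) * ⟪e, L (v x)⟫ := fun {χ} L v hχ => by
    rw [← integral_inner (i0 L v hχ)]
    refine integral_congr_ae (ae_of_all _ fun x => ?_)
    simp only
    rw [← Complex.coe_smul, inner_smul_right]
  have i1 : IntegrableOn (fun x => ψ x • G x) (Ioi (0 : ℝ)) :=
    i0 (ContinuousLinearMap.id ℂ E) G hψ2
  simp only [smul_add]
  rw [integral_add i1 (i0 H V hψ2), inner_add_right,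
    inner_add_right, inner_add_right, e4 A V hψd2, e4 H V hψ2, ← Complex.coe_smul, inner_smul_right]
  have e5 := e4 (ContinuousLinearMap.id ℂ E) G hψ2
  simp only [ContinuousLinearMap.id_apply] at e5
  rw [e5]
  linear_combination hcomplex

end TimeAverage

/-! ### Complexification of a weak solution -/

section WeakForm

variable {ι : Type*}

/-- The inclusion of `ℝ^ι` in `ℂ^ι`. -/
noncomputable def complexify (v : EuclideanSpace ℝ ι) : EuclideanSpace ℂ ι :=
  WithLp.toLp 2 fun i => (v i : ℂ)

theorem complexify_apply (v : EuclideanSpace ℝ ι) (i : ι) : complexify v i = (v i : ℂ) := rfl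

theorem complexify_zero : complexify (0 : EuclideanSpace ℝ ι) = 0 := by
  ext i
  simp [complexify_apply]

variable [Fintype ι]

theorem norm_complexify (v : EuclideanSpace ℝ ι) : ‖complexify v‖ = ‖v‖ := by
  simp [EuclideanSpace.norm_eq, complexify_apply]

theorem isometry_complexify : Isometry (complexify (ι := ι)) :=
  Isometry.of_dist_eq fun v w => by
    have h : complexify v - complexify w = complexify (v - w) := by
      ext i
      simp [complexify_apply]
    rw [dist_eq_norm, dist_eq_norm, h, norm_complexify]

/-- The inclusion of `L²(ℝ⁺; ℝ^ι)` in `L²(ℝ⁺; ℂ^ι)`. -/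
noncomputable def complexifyL2 (v : HalfLineL2 ι) : L2Ioi (EuclideanSpace ℂ ι) :=
  isometry_complexify.lipschitz.compLp complexify_zero v

theorem complexifyL2_ae_eq (v : HalfLineL2 ι) :
    complexifyL2 v =ᵐ[volume.restrict (Ioi (0 : ℝ))] fun x => complexify (v x) :=
  isometry_complexify.lipschitz.coeFn_compLp complexify_zero v

theorem continuous_complexifyL2 : Continuous (complexifyL2 (ι := ι)) :=
  isometry_complexify.lipschitz.continuous_compLp complexify_zero

theorem norm_complexifyL2 (v : HalfLineL2 ι) : ‖complexifyL2 v‖ = ‖v‖ := by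
  rw [Lp.norm_def, Lp.norm_def]
  congr 1
  refine eLpNorm_congr_norm_ae ?_
  filter_upwards [complexifyL2_ae_eq v] with x hx
  rw [hx, norm_complexify]

theorem inner_complexify (v w : EuclideanSpace ℝ ι) :
    inner ℂ (complexify v) (complexify w) = ((inner ℝ v w : ℝ) : ℂ) := by
  simp [PiLp.inner_apply, complexify_apply]

theorem complexCLM_complexify [DecidableEq ι] {κ : Type*} [Fintype κ] (X : Matrix κ ι ℝ)
    (v : EuclideanSpace ℝ ι) :
    X.complexCLM (complexify v) = complexify (X.toEuclideanLin v) := by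
  ext i
  rw [complexify_apply, Matrix.complexCLM, Matrix.ofLp_euclideanCLM]
  simp [Matrix.mulVec, dotProduct, complexify_apply, Matrix.toLpLin_apply]

variable [DecidableEq ι]

/-- The weak formulation tested with a product `θ(t) ψ(x) e`. -/
theorem IsRelaxationSolution.weak_prod {p : ℕ} {A Q Qbar : Matrix ι ι ℝ}
    {B : Matrix (Fin p) ι ℝ} {ε T : ℝ} {b : ℝ → EuclideanSpace ℝ (Fin p)}
    {U : ℝ → HalfLineL2 ι} {g : ℝ → EuclideanSpace ℝ ι}
    (h : IsRelaxationSolution A Q Qbar B ε T b 0 U g) {θ ψ : ℝ → ℝ}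
    (hθ : ContDiff ℝ ∞ θ) (hθc : HasCompactSupport θ) (hθs : tsupport θ ⊆ Iio T)
    (hψ : ContDiff ℝ ∞ ψ) (hψc : HasCompactSupport ψ) (e : EuclideanSpace ℝ ι) :
    (∫ t in Ioo 0 T, ∫ x in Ioi (0 : ℝ),
      (deriv θ t * (ψ x * inner ℝ e (U t x)) +
        θ t * (deriv ψ x * inner ℝ e (A.toEuclideanLin (U t x)) +
          ψ x * inner ℝ e ((ε⁻¹ • Q + Qbar).toEuclideanLin (U t x))))) +
      ∫ t in Ioo 0 T, θ t * (ψ 0 * inner ℝ e (A.toEuclideanLin (g t))) = 0 := by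
  set φ : ℝ × ℝ → EuclideanSpace ℝ ι := fun z => (θ z.1 * ψ z.2) • e with hφ
  have hφs : ContDiff ℝ ∞ φ :=
    ((hθ.comp contDiff_fst).mul (hψ.comp contDiff_snd)).smul contDiff_const
  have hφc : HasCompactSupport φ := by
    refine HasCompactSupport.intro (hθc.isCompact.prod hψc.isCompact) fun z hz => ?_
    by_cases h1 : z.1 ∈ tsupport θ
    · have h2 : z.2 ∉ tsupport ψ := fun h2 => hz ⟨h1, h2⟩
      simp [hφ, image_eq_zero_of_notMem_tsupport h2]
    · simp [hφ, image_eq_zero_of_notMem_tsupport h1]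
  have hφT : tsupport φ ⊆ {z | z.1 < T} := by
    have h1 : tsupport φ ⊆ Prod.fst ⁻¹' tsupport θ := by
      refine closure_minimal (fun z hz => ?_) ((isClosed_tsupport θ).preimage continuous_fst)
      by_contra h1
      exact hz (by simp [hφ, image_eq_zero_of_notMem_tsupport h1])
    exact fun z hz => hθs (h1 hz)
  have hd : ∀ t x, HasFDerivAt φ ((θ t • (deriv ψ x • ContinuousLinearMap.snd ℝ ℝ ℝ) +
      ψ x • (deriv θ t • ContinuousLinearMap.fst ℝ ℝ ℝ)).smulRight e) (t, x) := by
    intro t x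
    have h1 : HasFDerivAt (fun z : ℝ × ℝ => θ z.1) (deriv θ t • ContinuousLinearMap.fst ℝ ℝ ℝ)
        (t, x) :=
      ((hθ.differentiable (by simp)).differentiableAt (x := t)).hasDerivAt.comp_hasFDerivAt
        (t, x) hasFDerivAt_fst
    have h2 : HasFDerivAt (fun z : ℝ × ℝ => ψ z.2) (deriv ψ x • ContinuousLinearMap.snd ℝ ℝ ℝ)
        (t, x) :=
      ((hψ.differentiable (by simp)).differentiableAt (x := x)).hasDerivAt.comp_hasFDerivAt
        (t, x) hasFDerivAt_snd
    exact (h1.mul h2).smul_const e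
  have hw := h.weak φ hφs hφc hφT
  have h0 : ∫ x in Ioi (0 : ℝ), inner ℝ (φ (0, x)) ((0 : HalfLineL2 ι) x) = 0 := by
    rw [integral_congr_ae (g := fun _ => (0 : ℝ)), integral_zero]
    filter_upwards [Lp.coeFn_zero (EuclideanSpace ℝ ι) 2 (volume.restrict (Ioi (0 : ℝ)))]
      with x hx
    rw [hx, Pi.zero_apply, inner_zero_right]
  rw [h0, add_zero] at hw
  refine Eq.trans (congrArg₂ (· + ·) ?_ ?_) hw
  · refine integral_congr_ae (ae_of_all _ fun t => integral_congr_ae (ae_of_all _ fun x => ?_))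
    simp only [(hd t x).fderiv]
    simp [hφ, inner_smul_left]
    ring
  · refine integral_congr_ae (ae_of_all _ fun t => ?_)
    simp [hφ, inner_smul_left]
    ring


end WeakForm

/-! ### Pairing with the adjoint problem -/

section Duality

theorem norm_toLp_two_sq {F : Type*} [NormedAddCommGroup F] {f : ℝ → F}
    (hf : MemLp f 2 (volume.restrict (Ioi (0 : ℝ)))) :
    ‖hf.toLp‖ ^ 2 = ∫ x in Ioi (0 : ℝ), ‖f x‖ ^ 2 := by
  rw [Lp.norm_toLp, toReal_eLpNorm_two_sq hf]

variable {E : Type*} [NormedAddCommGroup E] [InnerProductSpace ℂ E] [FiniteDimensional ℂ E]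

local notation "⟪" x ", " y "⟫" => inner ℂ x y

/-- The energy identity controls the `L²` norm of a decaying solution of the adjoint equation by
its boundary value. -/
theorem integral_sq_norm_adjoint_le {A D : E →L[ℂ] E} (hA : ∀ v w, ⟪A v, w⟫ = ⟪v, A w⟫) {c : ℝ}
    (hD : ∀ v, (⟪v, D v⟫).re ≤ -c * ‖v‖ ^ 2) {Z Z' : ℝ → E}
    (hZ : ∀ x, HasDerivAt Z (Z' x) x) (hZc' : Continuous Z') (hZd : ExpDecay Z)
    (hZd' : ExpDecay Z') (h : ∀ x, A (Z' x) = -D (Z x)) :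
    2 * c * ∫ x in Ioi (0 : ℝ), ‖Z x‖ ^ 2 ≤ ‖A‖ * ‖Z 0‖ ^ 2 := by
  have hZc : Continuous Z := continuous_iff_continuousAt.2 fun x => (hZ x).continuousAt
  have m1 := hZd.memLp_two hZc
  have m2 := hZd'.memLp_two hZc'
  have w1 := hasWeakDerivIoi_of_hasDerivAt hZ hZc'
  have w2 := hasWeakDerivIoi_of_hasDerivAt (Z := fun x => A (Z x)) (Z' := fun x => A (Z' x))
    (fun x => ((A.restrictScalars ℝ).hasFDerivAt.comp_hasDerivAt x (hZ x)))
    (A.continuous.comp hZc')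
  have key := w1.integral_re_inner_add w2 m1 m2 (m1.continuousLinearMap_comp A)
    (m2.continuousLinearMap_comp A)
  have i1 : IntegrableOn (fun x => ‖Z x‖ ^ 2) (Ioi (0 : ℝ)) := m1.integrable_norm_pow two_ne_zero
  have e1 : ∀ x, (⟪Z' x, A (Z x)⟫).re + (⟪Z x, A (Z' x)⟫).re = -(2 * (⟪Z x, D (Z x)⟫).re) := by
    intro x
    rw [← hA, ← inner_conj_symm, Complex.conj_re, h, inner_neg_right, Complex.neg_re]
    ring
  simp only [e1] at key
  have i2 : IntegrableOn (fun x => -(2 * (⟪Z x, D (Z x)⟫).re)) (Ioi (0 : ℝ)) := by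
    have : IntegrableOn (fun x => ⟪Z x, D (Z x)⟫) (Ioi (0 : ℝ)) := by
      refine (i1.const_mul ‖D‖).mono' ?_ (ae_of_all _ fun x => ?_)
      · exact (hZc.inner (D.continuous.comp hZc)).aestronglyMeasurable
      · calc _ ≤ ‖Z x‖ * ‖D (Z x)‖ := norm_inner_le_norm _ _
          _ ≤ ‖Z x‖ * (‖D‖ * ‖Z x‖) := by gcongr; exact D.le_opNorm _
          _ = _ := by ring
    exact (this.re.const_mul 2).neg
  calc 2 * c * ∫ x in Ioi (0 : ℝ), ‖Z x‖ ^ 2 = ∫ x in Ioi (0 : ℝ), 2 * c * ‖Z x‖ ^ 2 :=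
        (integral_const_mul _ _).symm
    _ ≤ ∫ x in Ioi (0 : ℝ), -(2 * (⟪Z x, D (Z x)⟫).re) :=
        integral_mono (i1.const_mul _) i2 fun x => by
          have := hD (Z x)
          simp only
          linarith
    _ = -(⟪Z 0, A (Z 0)⟫).re := key
    _ ≤ ‖⟪Z 0, A (Z 0)⟫‖ := (neg_le_abs _).trans (Complex.abs_re_le_norm _)
    _ ≤ ‖Z 0‖ * (‖A‖ * ‖Z 0‖) :=
        (norm_inner_le_norm _ _).trans (by gcongr; exact A.le_opNorm _)
    _ = _ := by ring

/-- Pairing a solution of the stationary equation, with forcing `F`, with a decaying solution of the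
adjoint equation. -/
theorem norm_inner_boundary_le {A H R : E →L[ℂ] E} (hA : ∀ v w, ⟪A v, w⟫ = ⟪v, A w⟫)
    (hR : ∀ v, R (A v) = v) (hH : ∀ v w, ⟪H v, w⟫ = ⟪v, H w⟫) {c : ℝ} (hc : 0 < c) {ξ : ℂ}
    (hdis : ∀ v, (⟪v, H v - ξ • v⟫).re ≤ -c * ‖v‖ ^ 2) {V F : L2Ioi E} {γ : E}
    (hw : HasWeakDerivIoi (fun x => A (V x)) (fun x => (F - ξ • V : L2Ioi E) x + H (V x)) (A γ))
    {Z Z' : ℝ → E} (hZ : ∀ x, HasDerivAt Z (Z' x) x) (hZd : ExpDecay Z)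
    (hZe : ∀ x, A (Z' x) = -(H (Z x) - (starRingEnd ℂ ξ) • Z x)) :
    ‖⟪A (Z 0), γ⟫‖ ≤ 2 * (Real.sqrt (‖A‖ / (2 * c)) * ‖F‖) * ‖Z 0‖ := by
  set k : ℝ := Real.sqrt (‖A‖ / (2 * c)) with hk
  -- the adjoint solution is square integrable
  have hZc : Continuous Z := continuous_iff_continuousAt.2 fun x => (hZ x).continuousAt
  have hZ' : ∀ x, Z' x = R (-(H (Z x) - (starRingEnd ℂ ξ) • Z x)) := fun x => by
    rw [← hZe, hR]
  have hZc' : Continuous Z' := by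
    rw [funext hZ']
    fun_prop
  set D : E →L[ℂ] E := H - (starRingEnd ℂ ξ) • ContinuousLinearMap.id ℂ E with hD
  have hDv : ∀ v, D v = H v - (starRingEnd ℂ ξ) • v := fun v => rfl
  have hZd' : ExpDecay Z' := hZd.mono (K := ‖R‖ * ‖D‖) fun x => by
    rw [hZ', ← hDv, map_neg, norm_neg]
    calc _ ≤ ‖R‖ * ‖D (Z x)‖ := R.le_opNorm _
      _ ≤ ‖R‖ * (‖D‖ * ‖Z x‖) := by gcongr; exact D.le_opNorm _
      _ = _ := by ring
  have hdis' : ∀ v, (⟪v, D v⟫).re ≤ -c * ‖v‖ ^ 2 := fun v => by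
    have h1 := hdis v
    have h2 : (⟪v, ξ • v⟫).re = (⟪v, (starRingEnd ℂ ξ) • v⟫).re := by
      rw [inner_smul_right, inner_smul_right, inner_self_eq_norm_sq_to_K]
      simp [Complex.mul_re, ← Complex.ofReal_pow]
    rw [hDv, inner_sub_right, Complex.sub_re]
    rw [inner_sub_right, Complex.sub_re] at h1
    linarith
  have hZ2 := integral_sq_norm_adjoint_le hA hdis' hZ hZc' hZd hZd' hZe
  have m1 := hZd.memLp_two hZc
  have m2 := hZd'.memLp_two hZc'
  have hZn : ‖m1.toLp‖ ≤ k * ‖Z 0‖ := by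
    have hk0 : 0 ≤ k * ‖Z 0‖ := by positivity
    rw [← sq_le_sq₀ (norm_nonneg _) hk0, norm_toLp_two_sq, mul_pow, hk,
      Real.sq_sqrt (by positivity), div_mul_eq_mul_div, le_div_iff₀ (by positivity)]
    linarith
  have mV := (Lp.memLp V).continuousLinearMap_comp A
  have mW : MemLp (fun x => (F - ξ • V : L2Ioi E) x + H (V x)) 2 (volume.restrict (Ioi (0 : ℝ))) :=
    MemLp.add (f := fun x => (F - ξ • V : L2Ioi E) x) (g := fun x => H (V x))
      (Lp.memLp (F - ξ • V)) ((Lp.memLp V).continuousLinearMap_comp H)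
  have hre : ∀ a : ℂ, (⟪a • Z 0, A γ⟫).re = -(⟪a • m1.toLp, F⟫).re := by
    intro a
    have wZ := (hasWeakDerivIoi_of_hasDerivAt hZ hZc').clm
      ((a • ContinuousLinearMap.id ℂ E).restrictScalars ℝ) m1 m2
    have key := wZ.integral_re_inner_add hw (m1.const_smul a) (m2.const_smul a) mV mW
    have e1 : (fun x => ⟪(a • m1.toLp : L2Ioi E) x, F x⟫) =ᵐ[volume.restrict (Ioi (0 : ℝ))]
        fun x => ⟪a • Z' x, A (V x)⟫ + ⟪a • Z x, (F - ξ • V : L2Ioi E) x + H (V x)⟫ := by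
      filter_upwards [m1.coeFn_toLp, Lp.coeFn_smul a m1.toLp, Lp.coeFn_sub F (ξ • V),
        Lp.coeFn_smul ξ V] with x h1 h2 h3 h4
      rw [h2, Pi.smul_apply, h1, h3, Pi.sub_apply, h4, Pi.smul_apply]
      have h5 : ⟪a • Z' x, A (V x)⟫ = -⟪a • Z x, H (V x)⟫ + ξ * ⟪a • Z x, V x⟫ := by
        rw [inner_smul_left, inner_smul_left, inner_smul_left, ← hA, hZe, inner_neg_left,
          inner_sub_left, inner_smul_left, hH, Complex.conj_conj]
        ring
      rw [h5, inner_add_right, inner_sub_right, inner_smul_right]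
      ring
    have i1 : Integrable (fun x => ⟪(a • m1.toLp : L2Ioi E) x, F x⟫)
        (volume.restrict (Ioi (0 : ℝ))) := L2.integrable_inner (𝕜 := ℂ) _ _
    have e2 : (⟪a • m1.toLp, F⟫).re = ∫ x in Ioi (0 : ℝ), (⟪a • Z' x, A (V x)⟫).re +
        (⟪a • Z x, (F - ξ • V : L2Ioi E) x + H (V x)⟫).re := by
      rw [L2.inner_def, ← RCLike.re_eq_complex_re, ← integral_re i1]
      refine integral_congr_ae ?_
      filter_upwards [e1] with x hx
      rw [hx, RCLike.re_eq_complex_re, Complex.add_re]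
    rw [e2]
    simp only [ContinuousLinearMap.coe_restrictScalars', _root_.smul_apply,
      ContinuousLinearMap.id_apply] at key
    rw [key, neg_neg]
  have hbound : ∀ a : ℂ, ‖a‖ = 1 → |(⟪a • Z 0, A γ⟫).re| ≤
      k * ‖F‖ * ‖Z 0‖ := by
    intro a ha
    rw [hre, abs_neg]
    calc _ ≤ ‖⟪a • m1.toLp, F⟫‖ := Complex.abs_re_le_norm _
      _ ≤ ‖a • m1.toLp‖ * ‖F‖ := norm_inner_le_norm _ _
      _ = ‖m1.toLp‖ * ‖F‖ := by rw [norm_smul, ha, one_mul]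
      _ ≤ (k * ‖Z 0‖) * ‖F‖ := by gcongr
      _ = _ := by ring
  -- the phases `1` and `i` recover the modulus of the pairing from real parts
  have hI : (⟪Complex.I • Z 0, A γ⟫).re = (⟪Z 0, A γ⟫).im := by
    rw [inner_smul_left]
    simp
  have h1 := hbound 1 (by simp)
  have h2 := hbound Complex.I (by simp)
  rw [hI] at h2
  rw [one_smul] at h1
  rw [hA]
  calc _ ≤ _ := Complex.norm_le_abs_re_add_abs_im _
    _ ≤ _ := by linarith

/-- Pairing with decaying solutions of the adjoint equation. The transform of the trace, cut off
in time, is orthogonal to the boundary values of these solutions, up to an error which is due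
to the cutoff and therefore exponentially small. -/
theorem exists_norm_inner_average_le {A H R : E →L[ℂ] E} (hA : ∀ v w, ⟪A v, w⟫ = ⟪v, A w⟫)
    (hR : ∀ v, R (A v) = v)
    (hH : ∀ v w, ⟪H v, w⟫ = ⟪v, H w⟫) {T T' c : ℝ} (hc : 0 < c) {u : ℝ → L2Ioi E}
    (hu : ContinuousOn u (Icc 0 T)) {g : ℝ → E}
    (hav : ∀ θ : ℝ → ℂ, ContDiff ℝ ∞ θ → HasCompactSupport θ → tsupport θ ⊆ Iio T →
      HasWeakDerivIoi (fun x => A ((∫ t in Ioo 0 T, θ t • u t : L2Ioi E) x))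
      (fun x => (∫ t in Ioo 0 T, deriv θ t • u t : L2Ioi E) x +
        H ((∫ t in Ioo 0 T, θ t • u t : L2Ioi E) x))
      (A (∫ t in Ioo 0 T, θ t • g t)))
    {χ : ℝ → ℝ} (hχ : ContDiff ℝ ∞ χ) (hχc : HasCompactSupport χ) (hχs : tsupport χ ⊆ Iio T)
    (hχ1 : ∀ t ∈ Ioo 0 T', deriv χ t = 0) :
    ∃ K : ℝ, 0 ≤ K ∧ ∀ ξ : ℂ, 0 ≤ ξ.re → (∀ v, (⟪v, H v - ξ • v⟫).re ≤ -c * ‖v‖ ^ 2) →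
      ∀ Z Z' : ℝ → E, (∀ x, HasDerivAt Z (Z' x) x) → ExpDecay Z →
      (∀ x, A (Z' x) = -(H (Z x) - (starRingEnd ℂ ξ) • Z x)) →
      ‖⟪A (Z 0), ∫ t in Ioo 0 T, ((χ t : ℂ) * Complex.exp (-ξ * t)) • g t⟫‖ ≤
        K * Real.exp (-T' * ξ.re) * ‖Z 0‖ := by
  have : CompleteSpace E := FiniteDimensional.complete ℂ E
  have hχd : Continuous (deriv χ) := hχ.continuous_deriv (by simp)
  set k : ℝ := Real.sqrt (‖A‖ / (2 * c)) with hk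
  set N : ℝ := ∫ t in Ioo 0 T, ‖deriv χ t • u t‖ with hN
  have hiN : Integrable (fun t => deriv χ t • u t) (volume.restrict (Ioo 0 T)) :=
    ((hχd.continuousOn.smul hu).integrableOn_Icc).mono_set Ioo_subset_Icc_self
  have hN0 : 0 ≤ N := integral_nonneg fun t => norm_nonneg _
  refine ⟨2 * (k * N), by positivity, fun ξ hξ hdis Z Z' hZ hZd hZe => ?_⟩
  set θ : ℝ → ℂ := fun t => (χ t : ℂ) * Complex.exp (-ξ * t) with hθ
  have hexp : ContDiff ℝ ∞ fun t : ℝ => Complex.exp (-ξ * t) :=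
    (contDiff_const.mul Complex.ofRealCLM.contDiff).cexp
  have hθs : ContDiff ℝ ∞ θ := (Complex.ofRealCLM.contDiff.comp hχ).mul hexp
  have hθt : tsupport θ ⊆ tsupport χ := closure_mono fun t ht h0 => ht (by simp [hθ, h0])
  have hθc : HasCompactSupport θ := hχc.of_isClosed_subset (isClosed_tsupport _) hθt
  have hθd : ∀ t, deriv θ t = (deriv χ t : ℝ) * Complex.exp (-ξ * t) - ξ * θ t := fun t => by
    have h1 : HasDerivAt (fun t : ℝ => (χ t : ℂ)) ((deriv χ t : ℝ) : ℂ) t :=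
      ((hχ.differentiable (by simp)).differentiableAt.hasDerivAt).ofReal_comp
    have h2 : HasDerivAt (fun t : ℝ => Complex.exp (-ξ * t)) (Complex.exp (-ξ * t) * (-ξ)) t := by
      have := ((hasDerivAt_id (t : ℂ)).const_mul (-ξ)).cexp.comp_ofReal
      simpa using this
    rw [show deriv θ t = _ from (h1.fun_mul h2).deriv]
    simp only [hθ]
    ring
  have hexpc : Continuous fun t : ℝ => ((deriv χ t : ℝ) : ℂ) * Complex.exp (-ξ * t) :=
    (Complex.continuous_ofReal.comp hχd).mul hexp.continuous
  have hui : ∀ {χ : ℝ → ℂ}, Continuous χ → Integrable (fun t => χ t • u t)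
      (volume.restrict (Ioo 0 T)) := fun hχ =>
    ((hχ.continuousOn.smul hu).integrableOn_Icc).mono_set Ioo_subset_Icc_self
  set V := ∫ t in Ioo 0 T, θ t • u t with hV
  -- the forcing due to the cutoff; it lives at times after `T'`
  set F := ∫ t in Ioo 0 T, (((deriv χ t : ℝ) : ℂ) * Complex.exp (-ξ * t)) • u t with hF
  set γ := ∫ t in Ioo 0 T, θ t • g t with hγ
  have hG : ∫ t in Ioo 0 T, deriv θ t • u t = F - ξ • V := by
    have i2 : Integrable (fun t => ξ • θ t • u t) (volume.restrict (Ioo 0 T)) :=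
      (hui hθs.continuous).smul ξ
    rw [hF, hV, ← integral_smul, ← integral_sub (hui hexpc) i2]
    refine integral_congr_ae (ae_of_all _ fun t => ?_)
    simp only [hθd, sub_smul, mul_smul]
  have hFn : ‖F‖ ≤ Real.exp (-T' * ξ.re) * N := by
    rw [hN, ← integral_const_mul]
    refine norm_integral_le_of_norm_le (hiN.norm.const_mul _) ?_
    rw [ae_restrict_iff' measurableSet_Ioo]
    refine ae_of_all _ fun t ht => ?_
    rw [norm_smul, norm_smul, norm_mul, Complex.norm_real, Complex.norm_exp]
    rcases lt_or_ge t T' with h1 | h1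
    · rw [hχ1 t ⟨ht.1, h1⟩]
      simp
    · have h2 : Real.exp ((-ξ * t).re) ≤ Real.exp (-T' * ξ.re) := by
        rw [Real.exp_le_exp]
        have : (-ξ * t).re = -(ξ.re * t) := by simp
        rw [this]
        nlinarith
      calc _ = Real.exp ((-ξ * t).re) * (‖deriv χ t‖ * ‖u t‖) := by ring
        _ ≤ _ := by gcongr
  have hw := hav θ hθs hθc (hθt.trans hχs)
  rw [← hV, hG, ← hγ] at hw
  refine (norm_inner_boundary_le hA hR hH hc hdis hw hZ hZd hZe).trans ?_
  calc 2 * (k * ‖F‖) * ‖Z 0‖ ≤ 2 * (k * (Real.exp (-T' * ξ.re) * N)) * ‖Z 0‖ := by gcongr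
    _ = _ := by ring

end Duality

/-! ### Square integrability by duality -/

section TestFunctionDuality

/-- A linear functional that is bounded with respect to the norm of `e x` in a Hilbert space is
represented by a vector. -/
theorem exists_inner_eq_of_norm_le {X F : Type*} [AddCommGroup X] [Module ℂ X]
    [NormedAddCommGroup F] [InnerProductSpace ℂ F] [CompleteSpace F] (e : X →ₗ[ℂ] F)
    (l : X →ₗ[ℂ] ℂ) {M : ℝ} (hM : 0 ≤ M) (h : ∀ x, ‖l x‖ ≤ M * ‖e x‖) :
    ∃ v : F, ‖v‖ ≤ M ∧ ∀ x, inner ℂ v (e x) = l x := by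
  set f := l.compLeftInverse e with hf
  have hfx : ∀ x (hx : e x ∈ LinearMap.range e), f ⟨e x, hx⟩ = l x := fun x hx =>
    LinearMap.compLeftInverse_apply_of_bdd l e ⟨M, h⟩ x _ rfl
  have hfn : ‖f‖ ≤ M := by
    refine f.opNorm_le_bound hM ?_
    intro y
    obtain ⟨x, hx⟩ := LinearMap.mem_range.1 y.2
    rw [show y = ⟨e x, LinearMap.mem_range_self e x⟩ from Subtype.ext hx.symm, hfx]
    exact h x
  obtain ⟨k, hk, hkn⟩ := exists_extension_norm_eq (LinearMap.range e) f
  refine ⟨(InnerProductSpace.toDual ℂ F).symm k, ?_, fun x => ?_⟩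
  · rw [LinearIsometryEquiv.norm_map, hkn]
    exact hfn
  · rw [InnerProductSpace.toDual_symm_apply]
    have := hk ⟨e x, LinearMap.mem_range_self e x⟩
    rw [hfx] at this
    exact this

/-- A locally integrable function, the pairing of which with test functions is bounded in terms of
their `L²` norm, is square integrable. -/
theorem memLp_two_of_norm_integral_mul_le {f : ℝ → ℂ} {a b M : ℝ} (hM : 0 ≤ M)
    (hf : IntegrableOn f (Ioo a b))
    (h : ∀ φ : ℝ → ℂ, ContDiff ℝ ∞ φ → HasCompactSupport φ → tsupport φ ⊆ Ioo a b →
      ‖∫ t in Ioo a b, φ t * f t‖ ≤ M * Real.sqrt (∫ t in Ioo a b, ‖φ t‖ ^ 2)) :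
    MemLp f 2 (volume.restrict (Ioo a b)) ∧ ∫ t in Ioo a b, ‖f t‖ ^ 2 ≤ M ^ 2 := by
  let X : Submodule ℂ (ℝ → ℂ) :=
    { carrier := {φ | ContDiff ℝ ∞ φ ∧ HasCompactSupport φ ∧ tsupport φ ⊆ Ioo a b}
      add_mem' := fun {φ ψ} hφ hψ => ⟨hφ.1.add hψ.1, hφ.2.1.add hψ.2.1,
        (tsupport_add φ ψ).trans (union_subset hφ.2.2 hψ.2.2)⟩
      zero_mem' := ⟨contDiff_const, HasCompactSupport.zero, by simp [tsupport]⟩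
      smul_mem' := fun c φ hφ => by
        have h1 : tsupport (c • φ) ⊆ tsupport φ :=
          closure_mono fun t ht h0 => ht (by simp [h0])
        exact ⟨contDiff_const.smul hφ.1, hφ.2.1.of_isClosed_subset (isClosed_tsupport _) h1,
          h1.trans hφ.2.2⟩ }
  have hX : ∀ φ : X, MemLp φ.1 2 (volume.restrict (Ioo a b)) := fun φ =>
    (φ.2.1.continuous.memLp_of_hasCompactSupport φ.2.2.1).restrict _
  have hXi : ∀ φ : X, IntegrableOn (fun t => φ.1 t * f t) (Ioo a b) := fun φ => by
    obtain ⟨C, hC⟩ := φ.2.1.continuous.bounded_above_of_compact_support φ.2.2.1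
    exact hf.bdd_mul (c := C) φ.2.1.continuous.aestronglyMeasurable (ae_of_all _ hC)
  let e : X →ₗ[ℂ] Lp ℂ 2 (volume.restrict (Ioo a b)) :=
    { toFun := fun φ => (hX φ).toLp
      map_add' := fun φ ψ => rfl
      map_smul' := fun c φ => rfl }
  let l : X →ₗ[ℂ] ℂ :=
    { toFun := fun φ => ∫ t in Ioo a b, φ.1 t * f t
      map_add' := fun φ ψ => by
        rw [← integral_add (hXi φ) (hXi ψ)]
        exact integral_congr_ae (ae_of_all _ fun t => by simp [add_mul])
      map_smul' := fun c φ => by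
        rw [RingHom.id_apply, smul_eq_mul, ← integral_const_mul]
        exact integral_congr_ae (ae_of_all _ fun t => by simp [mul_assoc]) }
  have hen : ∀ φ : X, ‖e φ‖ = Real.sqrt (∫ t in Ioo a b, ‖φ.1 t‖ ^ 2) := fun φ => by
    rw [← toReal_eLpNorm_two_sq (hX φ), Real.sqrt_sq ENNReal.toReal_nonneg]
    exact Lp.norm_toLp _ (hX φ)
  obtain ⟨v, hv, hvl⟩ := exists_inner_eq_of_norm_le e l hM fun φ => by
    rw [hen]
    exact h φ.1 φ.2.1 φ.2.2.1 φ.2.2.2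
  have hvm : MemLp (fun t => (starRingEnd ℂ) (v t)) 2 (volume.restrict (Ioo a b)) :=
    (Lp.memLp v).star
  have hae : ∀ᵐ t, t ∈ Ioo a b → f t - (starRingEnd ℂ) (v t) = 0 := by
    refine isOpen_Ioo.ae_eq_zero_of_integral_contDiff_smul_eq_zero
      (hf.sub (hvm.integrable one_le_two)).locallyIntegrableOn fun φ hφ hφc hφs => ?_
    have hts : tsupport (fun t => (φ t : ℂ)) ⊆ tsupport φ :=
      closure_mono fun t ht h0 => ht (by simp [h0])
    let φ' : X := ⟨fun t => (φ t : ℂ), Complex.ofRealCLM.contDiff.comp hφ,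
      hφc.of_isClosed_subset (isClosed_tsupport _) hts, hts.trans hφs⟩
    have h1 := hvl φ'
    rw [L2.inner_def] at h1
    have h2 : ∫ t in Ioo a b, (φ t : ℂ) * (starRingEnd ℂ) (v t) = l φ' := by
      rw [← h1]
      refine integral_congr_ae ?_
      filter_upwards [(hX φ').coeFn_toLp] with t ht
      have : (e φ') t = (φ t : ℂ) := ht
      rw [this, RCLike.inner_apply]
    have i1 : IntegrableOn (fun t => (φ t : ℂ) * (starRingEnd ℂ) (v t)) (Ioo a b) :=
      MemLp.integrable_mul (hX φ') hvm
    rw [← setIntegral_eq_integral_of_forall_compl_eq_zero (s := Ioo a b)]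
    · have h3 : l φ' - l φ' = 0 := sub_self _
      nth_rw 2 [← h2] at h3
      change (∫ t in Ioo a b, (φ t : ℂ) * f t) - _ = 0 at h3
      rw [← integral_sub (hXi φ') i1] at h3
      rw [← h3]
      refine integral_congr_ae (ae_of_all _ fun t => ?_)
      simp only [Complex.real_smul]
      ring
    · intro t ht
      rw [image_eq_zero_of_notMem_tsupport fun h => ht (hφs h), zero_smul]
  have hfe : (fun t => (starRingEnd ℂ) (v t)) =ᵐ[volume.restrict (Ioo a b)] f := by
    rw [EventuallyEq, ae_restrict_iff' measurableSet_Ioo]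
    filter_upwards [hae] with t ht hts
    exact (sub_eq_zero.1 (ht hts)).symm
  refine ⟨hvm.ae_eq hfe, ?_⟩
  calc ∫ t in Ioo a b, ‖f t‖ ^ 2 = ∫ t in Ioo a b, ‖v t‖ ^ 2 := by
        refine integral_congr_ae ?_
        filter_upwards [hfe] with t ht
        rw [← ht, RCLike.norm_conj]
    _ = ‖v‖ ^ 2 := by rw [← toReal_eLpNorm_two_sq (Lp.memLp v), Lp.norm_def]
    _ ≤ M ^ 2 := by gcongr

end TestFunctionDuality

/-! ### The estimate of the trace -/

section TraceEstimate

variable {E : Type*} [NormedAddCommGroup E] [InnerProductSpace ℂ E] [FiniteDimensional ℂ E]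

local notation "⟪" x ", " y "⟫" => inner ℂ x y

theorem exists_cutoff {a T : ℝ} (ha : 0 < a) (haT : a < T) :
    ∃ χ : ℝ → ℝ, ContDiff ℝ ∞ χ ∧ HasCompactSupport χ ∧ tsupport χ ⊆ Iio T ∧
      (∀ t ∈ Icc 0 a, χ t = 1) ∧ ∀ t, |χ t| ≤ 1 := by
  let χ : ContDiffBump (0 : ℝ) := ⟨a, (a + T) / 2, ha, by linarith⟩
  refine ⟨χ, χ.contDiff, χ.hasCompactSupport, fun t ht => ?_, fun t ht => ?_, fun t => ?_⟩
  · rw [χ.tsupport_eq, mem_closedBall_zero_iff, Real.norm_eq_abs] at ht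
    have h1 : |t| ≤ (a + T) / 2 := ht
    have h2 := le_abs_self t
    rw [mem_Iio]
    linarith
  · refine χ.one_of_mem_closedBall ?_
    rw [mem_closedBall_zero_iff, Real.norm_eq_abs, abs_of_nonneg ht.1]
    exact ht.2
  · rw [abs_of_nonneg χ.nonneg]
    exact χ.le_one

variable {p : ℕ} {A H R : E →L[ℂ] E} {Bm : E →L[ℂ] EuclideanSpace ℂ (Fin p)}
  {T γ₀ c C C' : ℝ} {u : ℝ → L2Ioi E} {g : ℝ → E} {b : ℝ → EuclideanSpace ℂ (Fin p)}
  {r : Fin p → ℂ → E}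

/-- The pairing of the trace with a test function in time. The boundary lift `r` expresses the
transform of the trace by the transform of the boundary data, up to an exponentially small
error, so that causality applies. -/
theorem norm_integral_mul_inner_trace_le (hA : ∀ v w, ⟪A v, w⟫ = ⟪v, A w⟫)
    (hR : ∀ v, R (A v) = v) (hH : ∀ v w, ⟪H v, w⟫ = ⟪v, H w⟫) (hγ₀ : 0 < γ₀)
    (hc : 0 < c) (hC : 0 ≤ C) (hu : ContinuousOn u (Icc 0 T))
    (hg : IntegrableOn g (Ioo 0 T))
    (hav : ∀ θ : ℝ → ℂ, ContDiff ℝ ∞ θ → HasCompactSupport θ → tsupport θ ⊆ Iio T →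
      HasWeakDerivIoi (fun x => A ((∫ t in Ioo 0 T, θ t • u t : L2Ioi E) x))
      (fun x => (∫ t in Ioo 0 T, deriv θ t • u t : L2Ioi E) x +
        H ((∫ t in Ioo 0 T, θ t • u t : L2Ioi E) x))
      (A (∫ t in Ioo 0 T, θ t • g t)))
    (hb : MemLp b 2 (volume.restrict (Ioo 0 T)))
    (hbg : ∀ᵐ t ∂(volume.restrict (Ioo 0 T)), Bm (g t) = b t)
    (hdis : ∀ ξ : ℂ, γ₀ < ξ.re → ∀ v, (⟪v, H v - ξ • v⟫).re ≤ -c * ‖v‖ ^ 2)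
    (hr : ∀ j w, DifferentiableOn ℂ (fun ξ => ⟪w, r j ξ⟫) {ξ | γ₀ < ξ.re})
    (hrC : ∀ ξ : ℂ, γ₀ < ξ.re → ∀ β : EuclideanSpace ℂ (Fin p), ‖∑ j, β j • r j ξ‖ ≤ C * ‖β‖)
    (hrδ : ∀ ξ : ℂ, γ₀ < ξ.re → ∀ v δ, 0 ≤ δ →
      (∀ Z Z' : ℝ → E, (∀ x, HasDerivAt Z (Z' x) x) → ExpDecay Z →
        (∀ x, A (Z' x) = -(H (Z x) - (starRingEnd ℂ ξ) • Z x)) →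
        ‖⟪A (Z 0), v⟫‖ ≤ δ * ‖Z 0‖) → ‖v - ∑ j, (Bm v) j • r j ξ‖ ≤ C' * δ)
    (w : E) {φ : ℝ → ℂ} (hφ : ContDiff ℝ ∞ φ) (hφc : HasCompactSupport φ)
    (hφs : tsupport φ ⊆ Ioo 0 T) :
    ‖∫ t in Ioo 0 T, φ t * ⟪w, g t⟫‖ ≤ ‖w‖ * C * Real.exp ((γ₀ + 1) * T) *
      Real.sqrt (∫ t in Ioo 0 T, ‖b t‖ ^ 2) * Real.sqrt (∫ t in Ioo 0 T, ‖φ t‖ ^ 2) := by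
  have : CompleteSpace E := FiniteDimensional.complete ℂ E
  rcases (tsupport φ).eq_empty_or_nonempty with he | hne
  · have h0 : ∀ t, φ t = 0 := fun t => image_eq_zero_of_notMem_tsupport (by simp [he])
    simp [h0]
  -- the last time `T''` in the support of `φ`, and an intermediate time `T'`
  obtain ⟨T'', hT''s, hT''⟩ := hφc.isCompact.exists_isGreatest hne
  obtain ⟨hT''0, hT''T⟩ := hφs hT''s
  obtain ⟨T', h1T', hT'T⟩ := exists_between hT''T
  have hφz : ∀ t, t ∉ Icc 0 T'' → φ t = 0 := fun t ht =>
    image_eq_zero_of_notMem_tsupport fun hts => ht ⟨(hφs hts).1.le, hT'' hts⟩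
  obtain ⟨χ, hχ, hχc, hχs, hχ1, hχb⟩ := exists_cutoff (hT''0.trans h1T') hT'T
  have hχd : ∀ t ∈ Ioo 0 T', deriv χ t = 0 := fun t ht => by
    have : χ =ᶠ[𝓝 t] fun _ => (1 : ℝ) := by
      filter_upwards [Ioo_mem_nhds ht.1 ht.2] with s hs using hχ1 s ⟨hs.1.le, hs.2.le⟩
    rw [this.deriv_eq, deriv_const]
  obtain ⟨K, hK, hKδ⟩ := exists_norm_inner_average_le hA hR hH hc hu hav hχ hχc hχs hχd
  -- the cut off trace and data, extended by zero
  set γ : ℂ → E := fun ξ => ∫ t in Ioo 0 T, ((χ t : ℂ) * Complex.exp (-ξ * t)) • g t with hγ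
  set G : ℝ → ℂ := (Ioo 0 T).indicator fun t => (χ t : ℂ) * ⟪w, g t⟫ with hG
  set b' : Fin p → ℝ → ℂ := fun j => (Ioo 0 T).indicator fun t => (χ t : ℂ) * b t j with hb'
  have hχm : Continuous fun t => (χ t : ℂ) := Complex.continuous_ofReal.comp hχ.continuous
  have hχn : ∀ t, ‖(χ t : ℂ)‖ ≤ 1 := fun t => by
    rw [Complex.norm_real, Real.norm_eq_abs]
    exact hχb t
  have hγi : ∀ ξ : ℂ, Integrable (fun t : ℝ => ((χ t : ℂ) * Complex.exp (-ξ * t)) • g t)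
      (volume.restrict (Ioo 0 T)) := fun ξ => by
    have hcont : Continuous fun t : ℝ => (χ t : ℂ) * Complex.exp (-ξ * t) := by fun_prop
    have hcs : HasCompactSupport fun t : ℝ => (χ t : ℂ) * Complex.exp (-ξ * t) :=
      (hχc.comp_left (g := fun s : ℝ => (s : ℂ)) (by simp)).mul_right
    obtain ⟨D, hD⟩ := hcont.bounded_above_of_compact_support hcs
    exact hg.bdd_smul D hcont.aestronglyMeasurable (ae_of_all _ hD)
  have hLG : ∀ ξ, laplace G ξ = ⟪w, γ ξ⟫ := fun ξ => by
    rw [hγ, ← integral_inner (hγi ξ), laplace, ← integral_indicator measurableSet_Ioo]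
    refine integral_congr_ae (ae_of_all _ fun t => ?_)
    by_cases ht : t ∈ Ioo 0 T
    · simp only [hG, indicator_of_mem ht, inner_smul_right]
      ring
    · simp only [hG, indicator_of_notMem ht, mul_zero]
  have hLb : ∀ j ξ, laplace (b' j) ξ = (Bm (γ ξ)) j := fun j ξ => by
    rw [hγ, ← Bm.integral_comp_comm (hγi ξ), laplace]
    have h1 := (EuclideanSpace.proj j : EuclideanSpace ℂ (Fin p) →L[ℂ] ℂ).integral_comp_comm
      (Bm.integrable_comp (hγi ξ))
    simp only [EuclideanSpace.coe_proj] at h1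
    rw [← h1, ← setIntegral_eq_integral_of_forall_compl_eq_zero (s := Ioo 0 T)
      (fun t ht => by simp only [hb', indicator_of_notMem ht, mul_zero])]
    refine integral_congr_ae ?_
    filter_upwards [hbg, ae_restrict_mem measurableSet_Ioo] with t h2 ht
    simp only [hb', indicator_of_mem ht, map_smul, h2, PiLp.smul_apply, smul_eq_mul]
    ring
  have hGi : Integrable G := by
    rw [hG, integrable_indicator_iff measurableSet_Ioo]
    exact (hg.const_inner (𝕜 := ℂ) w).bdd_mul hχm.aestronglyMeasurable (ae_of_all _ hχn)
  have hbj : ∀ j, MemLp (fun t => b t j) 2 (volume.restrict (Ioo 0 T)) := fun j =>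
    hb.continuousLinearMap_comp (EuclideanSpace.proj j : EuclideanSpace ℂ (Fin p) →L[ℂ] ℂ)
  have hb'm : ∀ j, MemLp (b' j) 2 := fun j => by
    rw [hb', memLp_indicator_iff_restrict measurableSet_Ioo]
    refine (hbj j).of_le (hχm.aestronglyMeasurable.mul (hbj j).1) (ae_of_all _ fun t => ?_)
    rw [norm_mul]
    exact mul_le_of_le_one_left (norm_nonneg _) (hχn t)
  have key := norm_integral_mul_le_of_laplace (γ₁ := γ₀ + 1) (C := ‖w‖ * C)
    (K := ‖w‖ * (C' * K)) (T := T) (g := G) (b := b') (ρ := fun j ξ => ⟪w, r j ξ⟫) hγ₀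
    (by linarith) (by positivity) h1T' hT''0.le hGi
    (fun t ht => indicator_of_notMem (fun h => ht (Ioo_subset_Icc_self h)) _) hb'm
    (fun j t ht => indicator_of_notMem (fun h => ht (Ioo_subset_Icc_self h)) _)
    (fun j => hr j w) (fun ξ hξ β => by
      have : ∑ j, β j * ⟪w, r j ξ⟫ = ⟪w, ∑ j, β j • r j ξ⟫ := by
        simp only [inner_sum, inner_smul_right]
      rw [this, mul_assoc]
      exact (norm_inner_le_norm _ _).trans (by gcongr; exact hrC ξ hξ β))
    (fun ξ hξ => by
      have h1 : laplace G ξ - ∑ j, laplace (b' j) ξ * ⟪w, r j ξ⟫ =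
          ⟪w, γ ξ - ∑ j, (Bm (γ ξ)) j • r j ξ⟫ := by
        simp only [inner_sub_right, inner_sum, inner_smul_right, hLG, hLb]
      have hξ' : γ₀ < ξ.re := by linarith
      have h2 := hrδ ξ hξ' (γ ξ) (K * Real.exp (-T' * ξ.re)) (by positivity)
        (hKδ ξ (hγ₀.trans hξ').le (hdis ξ hξ'))
      rw [h1]
      calc _ ≤ ‖w‖ * ‖γ ξ - ∑ j, (Bm (γ ξ)) j • r j ξ‖ := norm_inner_le_norm _ _
        _ ≤ ‖w‖ * (C' * (K * Real.exp (-T' * ξ.re))) := by gcongr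
        _ = _ := by ring) hφ hφc hφz
  have e1 : ∫ t in Ioo 0 T, φ t * ⟪w, g t⟫ = ∫ t, φ t * G t := by
    rw [← integral_indicator measurableSet_Ioo]
    refine integral_congr_ae (ae_of_all _ fun t => ?_)
    by_cases ht : t ∈ Ioo 0 T
    · simp only [hG, indicator_of_mem ht]
      by_cases h2 : t ∈ Icc 0 T''
      · rw [hχ1 t ⟨h2.1, h2.2.trans h1T'.le⟩]
        simp
      · rw [hφz t h2, zero_mul, zero_mul]
    · simp only [hG, indicator_of_notMem ht, mul_zero]
  have e2 : ∫ t, ‖φ t‖ ^ 2 = ∫ t in Ioo 0 T, ‖φ t‖ ^ 2 :=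
    (setIntegral_eq_integral_of_forall_compl_eq_zero fun t ht => by
      rw [image_eq_zero_of_notMem_tsupport fun h => ht (hφs h)]
      simp).symm
  have e3 : ∑ j, ∫ t, ‖b' j t‖ ^ 2 ≤ ∫ t in Ioo 0 T, ‖b t‖ ^ 2 := by
    have h1 : ∀ t, ‖b t‖ ^ 2 = ∑ j, ‖b t j‖ ^ 2 := fun t => EuclideanSpace.norm_sq_eq _
    simp only [h1]
    rw [integral_finsetSum _ fun j _ => (hbj j).integrable_norm_pow two_ne_zero]
    refine Finset.sum_le_sum fun j _ => ?_
    rw [← integral_indicator measurableSet_Ioo]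
    refine integral_mono_of_nonneg (ae_of_all _ fun t => by positivity) ?_
      (ae_of_all _ fun t => ?_)
    · rw [integrable_indicator_iff measurableSet_Ioo]
      exact (hbj j).integrable_norm_pow two_ne_zero
    · by_cases ht : t ∈ Ioo 0 T
      · simp only [hb', indicator_of_mem ht, norm_mul]
        gcongr
        exact mul_le_of_le_one_left (norm_nonneg _) (hχn t)
      · simp [hb', indicator_of_notMem ht]
  rw [e1, ← e2]
  calc _ ≤ _ := key
    _ ≤ ‖w‖ * C * Real.exp ((γ₀ + 1) * T) * Real.sqrt (∫ t, ‖φ t‖ ^ 2) *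
        Real.sqrt (∫ t in Ioo 0 T, ‖b t‖ ^ 2) := by
      have h1 : Real.exp ((γ₀ + 1) * T'') ≤ Real.exp ((γ₀ + 1) * T) := by gcongr
      have h2 := Real.sqrt_le_sqrt e3
      gcongr
    _ = _ := by ring

/-- A vector valued function, the pairing of which with test functions is bounded in terms of their
`L²` norm, is square integrable. -/
theorem memLp_two_of_norm_integral_mul_inner_le {f : ℝ → E} {a b M : ℝ} (hM : 0 ≤ M)
    (hf : IntegrableOn f (Ioo a b))
    (h : ∀ (w : E) (φ : ℝ → ℂ), ContDiff ℝ ∞ φ → HasCompactSupport φ → tsupport φ ⊆ Ioo a b →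
      ‖∫ t in Ioo a b, φ t * ⟪w, f t⟫‖ ≤
        ‖w‖ * M * Real.sqrt (∫ t in Ioo a b, ‖φ t‖ ^ 2)) :
    MemLp f 2 (volume.restrict (Ioo a b)) ∧
      ∫ t in Ioo a b, ‖f t‖ ^ 2 ≤ Module.finrank ℂ E * M ^ 2 := by
  set e := stdOrthonormalBasis ℂ E
  have hi : ∀ i, MemLp (fun t => ⟪e i, f t⟫) 2 (volume.restrict (Ioo a b)) ∧
      ∫ t in Ioo a b, ‖⟪e i, f t⟫‖ ^ 2 ≤ M ^ 2 := fun i =>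
    memLp_two_of_norm_integral_mul_le hM (hf.const_inner (𝕜 := ℂ) (e i)) fun φ h1 h2 h3 => by
      have := h (e i) φ h1 h2 h3
      rwa [e.orthonormal.norm_eq_one i, one_mul] at this
  have hsum : ∀ t, ‖f t‖ ^ 2 = ∑ i, ‖⟪e i, f t⟫‖ ^ 2 := fun t => (e.sum_sq_norm_inner_right _).symm
  have hint : ∀ i, IntegrableOn (fun t => ‖⟪e i, f t⟫‖ ^ 2) (Ioo a b) := fun i =>
    (hi i).1.integrable_norm_pow two_ne_zero
  refine ⟨?_, ?_⟩
  · rw [memLp_two_iff_integrable_sq_norm hf.1]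
    simp only [hsum]
    exact integrable_finsetSum _ fun i _ => hint i
  · simp only [hsum]
    rw [integral_finsetSum _ fun i _ => hint i]
    calc _ ≤ ∑ i : Fin (Module.finrank ℂ E), M ^ 2 := Finset.sum_le_sum fun i _ => (hi i).2
      _ = _ := by simp

end TraceEstimate

/-! ### The energy identity -/

section EnergyEstimate

open scoped Convolution

variable {E : Type*} [NormedAddCommGroup E] [InnerProductSpace ℂ E] [FiniteDimensional ℂ E]

local notation "⟪" x ", " y "⟫" => inner ℂ x y

/-- The energy identity in `x`: the time derivative `-G` of `V` does work against the source term
and the flux through the boundary. -/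
theorem neg_re_inner_le_of_hasWeakDerivIoi {A H R : E →L[ℂ] E}
    (hA : ∀ v w, ⟪A v, w⟫ = ⟪v, A w⟫) (hR : ∀ v, R (A v) = v) (hR' : ∀ v, A (R v) = v) {κ : ℝ}
    (hκ : ∀ v, (⟪v, H v⟫).re ≤ κ * ‖v‖ ^ 2) {V G : L2Ioi E} {γ : E}
    (hw : HasWeakDerivIoi (fun x => A (V x)) (fun x => G x + H (V x)) (A γ)) :
    -(2 * (⟪V, G⟫).re) ≤ 2 * κ * ‖V‖ ^ 2 + ‖A‖ * ‖γ‖ ^ 2 := by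
  have : CompleteSpace E := FiniteDimensional.complete ℂ E
  have mA : MemLp (fun x => A (V x)) 2 (volume.restrict (Ioi (0 : ℝ))) :=
    (Lp.memLp V).continuousLinearMap_comp A
  have mW : MemLp (fun x => G x + H (V x)) 2 (volume.restrict (Ioi (0 : ℝ))) :=
    MemLp.add (f := fun x => G x) (g := fun x => H (V x)) (Lp.memLp G)
      ((Lp.memLp V).continuousLinearMap_comp H)
  have hw' := hw.clm (R.restrictScalars ℝ) mA mW
  have key := hw.integral_re_inner_add hw' mA mW (mA.continuousLinearMap_comp R)
    (mW.continuousLinearMap_comp R)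
  simp only [ContinuousLinearMap.coe_restrictScalars', hR] at key
  have e1 : ∀ x, (⟪G x + H (V x), V x⟫).re + (⟪A (V x), R (G x + H (V x))⟫).re =
      2 * (⟪V x, G x⟫).re + 2 * (⟪V x, H (V x)⟫).re := fun x => by
    rw [hA, hR', ← inner_conj_symm, Complex.conj_re, inner_add_right, Complex.add_re]
    ring
  simp only [e1] at key
  have iG : IntegrableOn (fun x => (⟪V x, G x⟫).re) (Ioi (0 : ℝ)) :=
    (L2.integrable_inner (𝕜 := ℂ) V G).re
  have iV : IntegrableOn (fun x => ‖V x‖ ^ 2) (Ioi (0 : ℝ)) :=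
    (Lp.memLp V).integrable_norm_pow two_ne_zero
  have iH : IntegrableOn (fun x => (⟪V x, H (V x)⟫).re) (Ioi (0 : ℝ)) := by
    refine (iV.const_mul ‖H‖).mono' ?_ (ae_of_all _ fun x => ?_)
    · exact Complex.continuous_re.comp_aestronglyMeasurable
        ((Lp.memLp V).1.inner (H.continuous.comp_aestronglyMeasurable (Lp.memLp V).1))
    · calc _ ≤ ‖⟪V x, H (V x)⟫‖ := Complex.abs_re_le_norm _
        _ ≤ ‖V x‖ * ‖H (V x)‖ := norm_inner_le_norm _ _
        _ ≤ ‖V x‖ * (‖H‖ * ‖V x‖) := by gcongr; exact H.le_opNorm _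
        _ = _ := by ring
  rw [integral_add (iG.const_mul 2) (iH.const_mul 2), integral_const_mul,
    integral_const_mul] at key
  have e2 : (⟪V, G⟫).re = ∫ x in Ioi (0 : ℝ), (⟪V x, G x⟫).re := by
    rw [L2.inner_def, ← RCLike.re_eq_complex_re, ← integral_re (L2.integrable_inner (𝕜 := ℂ) V G)]
  have e3 : ‖V‖ ^ 2 = ∫ x in Ioi (0 : ℝ), ‖V x‖ ^ 2 := by
    rw [← toReal_eLpNorm_two_sq (Lp.memLp V), Lp.norm_def]
  have e4 : ∫ x in Ioi (0 : ℝ), (⟪V x, H (V x)⟫).re ≤ κ * ‖V‖ ^ 2 := by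
    rw [e3, ← integral_const_mul]
    exact integral_mono iH (iV.const_mul κ) fun x => hκ _
  have e5 : (⟪A γ, γ⟫).re ≤ ‖A‖ * ‖γ‖ ^ 2 := by
    calc _ ≤ ‖⟪A γ, γ⟫‖ := (le_abs_self _).trans (Complex.abs_re_le_norm _)
      _ ≤ ‖A γ‖ * ‖γ‖ := norm_inner_le_norm _ _
      _ ≤ (‖A‖ * ‖γ‖) * ‖γ‖ := by gcongr; exact A.le_opNorm _
      _ = _ := by ring
  rw [← e2] at key
  linarith

/-- Averaging does not increase the `L²` norm. -/
theorem integral_sq_norm_convolution_le {F : Type*} [NormedAddCommGroup F] [NormedSpace ℝ F]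
    [CompleteSpace F] {ρ : ℝ → ℝ} (hρ : Continuous ρ) (hρc : HasCompactSupport ρ)
    (hρ0 : ∀ t, 0 ≤ ρ t) (hρ1 : ∫ t, ρ t = 1) {f : ℝ → F} (hf : MemLp f 2) :
    Integrable (fun s => ‖(ρ ⋆[ContinuousLinearMap.lsmul ℝ ℝ] f) s‖ ^ 2) ∧
      ∫ s, ‖(ρ ⋆[ContinuousLinearMap.lsmul ℝ ℝ] f) s‖ ^ 2 ≤ ∫ t, ‖f t‖ ^ 2 := by
  have hf2 : Integrable fun t => ‖f t‖ ^ 2 := hf.integrable_norm_pow two_ne_zero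
  have hρi : Integrable ρ := hρ.integrable_of_hasCompactSupport hρc
  have hpt : ∀ s, ‖(ρ ⋆[ContinuousLinearMap.lsmul ℝ ℝ] f) s‖ ^ 2 ≤
      (ρ ⋆[ContinuousLinearMap.lsmul ℝ ℝ] fun t => ‖f t‖ ^ 2) s := by
    intro s
    rw [convolution_lsmul_swap, convolution_lsmul_swap]
    set k : ℝ → ℝ := fun t => Real.sqrt (ρ (s - t)) with hk
    have hkc : Continuous k := by fun_prop
    have hkk : ∀ t, k t * k t = ρ (s - t) := fun t => Real.mul_self_sqrt (hρ0 _)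
    have hks : HasCompactSupport k := by
      have h1 : HasCompactSupport fun t => ρ (s - t) :=
        hρc.comp_homeomorph (Homeomorph.subLeft s)
      exact h1.comp_left Real.sqrt_zero
    have hk2 : MemLp k 2 := hkc.memLp_of_hasCompactSupport hks
    have hkf : MemLp (fun t => k t * ‖f t‖) 2 := by
      obtain ⟨C, hC⟩ := hkc.bounded_above_of_compact_support hks
      refine hf.of_le_mul (c := C) (hkc.aestronglyMeasurable.mul hf.1.norm)
        (ae_of_all _ fun t => ?_)
      rw [norm_mul, norm_norm]
      gcongr
      exact hC t
    have h1 : ‖∫ t, ρ (s - t) • f t‖ ≤ ∫ t, k t * (k t * ‖f t‖) := by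
      refine (norm_integral_le_integral_norm _).trans_eq (integral_congr_ae (ae_of_all _ fun t => ?_))
      simp only
      rw [norm_smul, Real.norm_of_nonneg (hρ0 _), ← mul_assoc, hkk]
    have h2 := h1.trans (integral_mul_le_sqrt_mul_sqrt hk2 hkf)
    have h3 : ∫ t, k t ^ 2 = 1 := by
      rw [← hρ1, ← integral_sub_left_eq_self ρ volume s]
      refine integral_congr_ae (ae_of_all _ fun t => ?_)
      simp only [sq, hkk]
    have h4 : ∫ t, (k t * ‖f t‖) ^ 2 = ∫ t, ρ (s - t) • ‖f t‖ ^ 2 := by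
      refine integral_congr_ae (ae_of_all _ fun t => ?_)
      simp only [smul_eq_mul, ← hkk]
      ring
    rw [h3, h4, Real.sqrt_one, one_mul] at h2
    calc _ ≤ Real.sqrt (∫ t, ρ (s - t) • ‖f t‖ ^ 2) ^ 2 := by gcongr
      _ = _ := Real.sq_sqrt (integral_nonneg fun t => mul_nonneg (hρ0 _) (by positivity))
  have hci := hρi.integrable_convolution (ContinuousLinearMap.lsmul ℝ ℝ) hf2
  have hmeas : AEStronglyMeasurable (ρ ⋆[ContinuousLinearMap.lsmul ℝ ℝ] f) volume :=
    (hρc.continuous_convolution_left _ hρ (hf.locallyIntegrable one_le_two)).aestronglyMeasurable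
  have hint : Integrable (fun s => ‖(ρ ⋆[ContinuousLinearMap.lsmul ℝ ℝ] f) s‖ ^ 2) :=
    hci.mono' (hmeas.norm.pow 2) (ae_of_all _ fun s => by
      rw [Real.norm_of_nonneg (by positivity)]
      exact hpt s)
  refine ⟨hint, ?_⟩
  calc _ ≤ ∫ s, (ρ ⋆[ContinuousLinearMap.lsmul ℝ ℝ] fun t => ‖f t‖ ^ 2) s :=
        integral_mono hint hci hpt
    _ = ∫ t, ‖f t‖ ^ 2 := by
        rw [integral_convolution (ContinuousLinearMap.lsmul ℝ ℝ) hρi hf2, hρ1]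
        simp

end EnergyEstimate

/-! ### The energy estimate -/

section Gronwall

open scoped Convolution

variable {E : Type*} [NormedAddCommGroup E] [InnerProductSpace ℂ E] [FiniteDimensional ℂ E]

local notation "⟪" x ", " y "⟫" => inner ℂ x y

/-- Gronwall's inequality for a differentiable curve in a Hilbert space that starts at `0`. -/
theorem sq_norm_le_of_re_inner_le {F : Type*} [NormedAddCommGroup F] [InnerProductSpace ℂ F]
    {w w' : ℝ → F} {k : ℝ → ℝ} {s τ κ : ℝ} (hκ : 0 ≤ κ) (hsτ : s ≤ τ)
    (hw : ∀ t, HasDerivAt w (w' t) t) (hk : Continuous k) (hk0 : ∀ t, 0 ≤ k t) (h0 : w s = 0)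
    (h : ∀ t ∈ Icc s τ, 2 * (⟪w t, w' t⟫).re ≤ 2 * κ * ‖w t‖ ^ 2 + k t) :
    ‖w τ‖ ^ 2 ≤ Real.exp (2 * κ * (τ - s)) * ∫ t in s..τ, k t := by
  set f : ℝ → ℝ := fun t => Real.exp (-(2 * κ * (t - s))) * ‖w t‖ ^ 2 - ∫ r in s..t, k r with hf
  set f' : ℝ → ℝ := fun t => (Real.exp (-(2 * κ * (t - s))) * (-(2 * κ)) * ‖w t‖ ^ 2 +
    Real.exp (-(2 * κ * (t - s))) * (2 * (⟪w t, w' t⟫).re)) - k t with hf'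
  have hsq : ∀ t, HasDerivAt (fun t => ‖w t‖ ^ 2) (2 * (⟪w t, w' t⟫).re) t := fun t => by
    have h1 : HasDerivAt (fun t => (⟪w t, w t⟫).re) ((⟪w t, w' t⟫ + ⟪w' t, w t⟫).re) t :=
      Complex.reCLM.hasFDerivAt.comp_hasDerivAt t ((hw t).inner ℂ (hw t))
    have h2 : ∀ v : F, (⟪v, v⟫).re = ‖v‖ ^ 2 := fun v => by
      rw [inner_self_eq_norm_sq_to_K]
      norm_cast
    simp only [h2] at h1
    convert h1 using 1
    rw [Complex.add_re, ← inner_conj_symm (w' t) (w t), Complex.conj_re]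
    ring
  have hd : ∀ t, HasDerivAt f (f' t) t := fun t => by
    have h1 : HasDerivAt (fun t : ℝ => -(2 * κ * (t - s))) (-(2 * κ)) t := by
      simpa using (((hasDerivAt_id t).sub_const s).const_mul (2 * κ)).fun_neg
    exact (h1.exp.fun_mul (hsq t)).fun_sub
      (intervalIntegral.integral_hasDerivAt_right (hk.intervalIntegrable _ _)
      hk.stronglyMeasurable.stronglyMeasurableAtFilter hk.continuousAt)
  have hanti : AntitoneOn f (Icc s τ) := by
    refine antitoneOn_of_deriv_nonpos (convex_Icc s τ)
      (fun t _ => (hd t).continuousAt.continuousWithinAt)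
      (fun t _ => (hd t).differentiableAt.differentiableWithinAt) fun t ht => ?_
    rw [interior_Icc] at ht
    have ht' := Ioo_subset_Icc_self ht
    rw [(hd t).deriv, hf']
    have h1 := h t ht'
    have h2 : Real.exp (-(2 * κ * (t - s))) ≤ 1 := by
      rw [Real.exp_le_one_iff]
      have := mul_nonneg hκ (sub_nonneg.2 ht'.1)
      linarith
    have h3 := mul_le_of_le_one_left (hk0 t) h2
    have h4 := mul_le_mul_of_nonneg_left h1 (Real.exp_nonneg (-(2 * κ * (t - s))))
    simp only
    linarith
  have h1 := hanti (left_mem_Icc.2 hsτ) (right_mem_Icc.2 hsτ) hsτ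
  simp only [hf, h0, norm_zero, intervalIntegral.integral_same] at h1
  have h2 : Real.exp (-(2 * κ * (τ - s))) * ‖w τ‖ ^ 2 ≤ ∫ r in s..τ, k r := by linarith
  rw [Real.exp_neg, inv_mul_le_iff₀ (Real.exp_pos _)] at h2
  exact h2

variable {A H R : E →L[ℂ] E} {T κ : ℝ} {u : ℝ → L2Ioi E} {g : ℝ → E}

/-- The energy estimate for the solution averaged over a short time: the average is differentiable in
time and vanishes at time `-δ`, since the solution is extended by `0` to negative times. -/
theorem sq_norm_convolution_le (hA : ∀ v w, ⟪A v, w⟫ = ⟪v, A w⟫) (hR : ∀ v, R (A v) = v)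
    (hR' : ∀ v, A (R v) = v) (hκ0 : 0 ≤ κ) (hκ : ∀ v, (⟪v, H v⟫).re ≤ κ * ‖v‖ ^ 2)
    (hu : ContinuousOn u (Icc 0 T)) (hg : MemLp g 2 (volume.restrict (Ioo 0 T)))
    (hav : ∀ θ : ℝ → ℂ, ContDiff ℝ ∞ θ → HasCompactSupport θ → tsupport θ ⊆ Iio T →
      HasWeakDerivIoi (fun x => A ((∫ t in Ioo 0 T, θ t • u t : L2Ioi E) x))
      (fun x => (∫ t in Ioo 0 T, deriv θ t • u t : L2Ioi E) x +
        H ((∫ t in Ioo 0 T, θ t • u t : L2Ioi E) x))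
      (A (∫ t in Ioo 0 T, θ t • g t)))
    {ρ : ℝ → ℝ} {δ : ℝ} (hρ : ContDiff ℝ ∞ ρ) (hρc : HasCompactSupport ρ)
    (hρ0 : ∀ t, 0 ≤ ρ t) (hρ1 : ∫ t, ρ t = 1) (hρs : tsupport ρ ⊆ Icc (-δ) δ) {τ : ℝ}
    (hτ : -δ ≤ τ) (hτT : τ + δ < T) :
    ‖(ρ ⋆[ContinuousLinearMap.lsmul ℝ ℝ] (Ioo 0 T).indicator u) τ‖ ^ 2 ≤
      ‖A‖ * Real.exp (2 * κ * T) * ∫ t in Ioo 0 T, ‖g t‖ ^ 2 := by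
  have : CompleteSpace E := FiniteDimensional.complete ℂ E
  set û : ℝ → L2Ioi E := (Ioo 0 T).indicator u with hû
  set ĝ : ℝ → E := (Ioo 0 T).indicator g with hĝ
  have hûi : Integrable û := by
    rw [hû, integrable_indicator_iff measurableSet_Ioo]
    exact hu.integrableOn_Icc.mono_set Ioo_subset_Icc_self
  have hĝm : MemLp ĝ 2 := (memLp_indicator_iff_restrict measurableSet_Ioo).2 hg
  have hρd : Continuous (deriv ρ) := hρ.continuous_deriv (by simp)
  have hw : ∀ t, HasDerivAt (ρ ⋆[ContinuousLinearMap.lsmul ℝ ℝ] û)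
      ((deriv ρ ⋆[ContinuousLinearMap.lsmul ℝ ℝ] û) t) t := fun t =>
    hρc.hasDerivAt_convolution_left _ (hρ.of_le (by simp)) hûi.locallyIntegrable t
  have hconv : ∀ {F : Type _} [NormedAddCommGroup F] [NormedSpace ℂ F] (σ : ℝ → ℝ) (f : ℝ → F)
      (t : ℝ), (σ ⋆[ContinuousLinearMap.lsmul ℝ ℝ] (Ioo 0 T).indicator f) t =
      ∫ s in Ioo 0 T, ((σ (t - s) : ℝ) : ℂ) • f s := by
    intro F _ _ σ f t
    rw [convolution_lsmul_swap, ← integral_indicator measurableSet_Ioo]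
    refine integral_congr_ae (ae_of_all _ fun s => ?_)
    by_cases hs : s ∈ Ioo 0 T
    · simp only [indicator_of_mem hs]
      rw [Complex.coe_smul]
    · simp only [indicator_of_notMem hs, smul_zero]
  have hgc : Continuous (ρ ⋆[ContinuousLinearMap.lsmul ℝ ℝ] ĝ) :=
    hρc.continuous_convolution_left _ hρ.continuous (hĝm.locallyIntegrable one_le_two)
  have hineq : ∀ t ∈ Icc (-δ) τ, 2 * (⟪(ρ ⋆[ContinuousLinearMap.lsmul ℝ ℝ] û) t,
      (deriv ρ ⋆[ContinuousLinearMap.lsmul ℝ ℝ] û) t⟫).re ≤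
      2 * κ * ‖(ρ ⋆[ContinuousLinearMap.lsmul ℝ ℝ] û) t‖ ^ 2 +
        ‖A‖ * ‖(ρ ⋆[ContinuousLinearMap.lsmul ℝ ℝ] ĝ) t‖ ^ 2 := by
    intro t ht
    set θ : ℝ → ℂ := fun s => ((ρ (t - s) : ℝ) : ℂ) with hθ
    have hθs : ContDiff ℝ ∞ θ :=
      Complex.ofRealCLM.contDiff.comp (hρ.comp (contDiff_const.sub contDiff_id))
    have hθt : tsupport θ ⊆ (fun s => t - s) ⁻¹' tsupport ρ := by
      refine closure_minimal (fun s hs => ?_) ((isClosed_tsupport ρ).preimage (by fun_prop))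
      by_contra h1
      exact hs (by simp [hθ, image_eq_zero_of_notMem_tsupport h1])
    have hθT : tsupport θ ⊆ Iio T := fun s hs => by
      have h1 := (hρs (hθt hs)).1
      have h2 := ht.2
      rw [mem_Iio]
      linarith
    have hθc : HasCompactSupport θ :=
      HasCompactSupport.of_support_subset_isCompact
        (((Homeomorph.subLeft t).isCompact_preimage).2 hρc.isCompact)
        ((subset_tsupport θ).trans hθt)
    have hθd : ∀ s, deriv θ s = -((deriv ρ (t - s) : ℝ) : ℂ) := fun s => by
      have h1 : HasDerivAt (fun s => ρ (t - s)) (-(deriv ρ (t - s))) s := by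
        have h2 : HasDerivAt ρ (deriv ρ (t - s)) (t - s) :=
          (hρ.differentiable (by simp)).differentiableAt.hasDerivAt
        simpa using h2.comp_const_sub t s
      simpa using h1.ofReal_comp.deriv
    have h1 := hav θ hθs hθc hθT
    have e1 : ∫ s in Ioo 0 T, θ s • u s = (ρ ⋆[ContinuousLinearMap.lsmul ℝ ℝ] û) t :=
      (hconv ρ u t).symm
    have e2 : ∫ s in Ioo 0 T, θ s • g s = (ρ ⋆[ContinuousLinearMap.lsmul ℝ ℝ] ĝ) t :=
      (hconv ρ g t).symm
    have e3 : ∫ s in Ioo 0 T, deriv θ s • u s =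
        -(deriv ρ ⋆[ContinuousLinearMap.lsmul ℝ ℝ] û) t := by
      have h2 : (deriv ρ ⋆[ContinuousLinearMap.lsmul ℝ ℝ] û) t =
          ∫ s in Ioo 0 T, ((deriv ρ (t - s) : ℝ) : ℂ) • u s := hconv (deriv ρ) u t
      rw [h2, ← integral_neg]
      simp only [hθd, neg_smul]
    rw [e1, e2, e3] at h1
    have h2 := neg_re_inner_le_of_hasWeakDerivIoi hA hR hR' hκ h1
    rw [inner_neg_right, Complex.neg_re] at h2
    linarith
  have h0 : (ρ ⋆[ContinuousLinearMap.lsmul ℝ ℝ] û) (-δ) = 0 := by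
    refine (hconv ρ u (-δ)).trans (setIntegral_eq_zero_of_forall_eq_zero ?_)
    intro s hs
    have hz : ρ (-δ - s) = 0 := image_eq_zero_of_notMem_tsupport fun h => by
      have h1 := (hρs h).1
      have h2 := hs.1
      linarith
    rw [hz, Complex.ofReal_zero, zero_smul]
  have key := sq_norm_le_of_re_inner_le (k := fun t =>
    ‖A‖ * ‖(ρ ⋆[ContinuousLinearMap.lsmul ℝ ℝ] ĝ) t‖ ^ 2) hκ0 hτ hw (by fun_prop)
    (fun t => by positivity) h0 hineq
  obtain ⟨hi, hle⟩ := integral_sq_norm_convolution_le hρ.continuous hρc hρ0 hρ1 hĝm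
  have e4 : ∫ t, ‖ĝ t‖ ^ 2 = ∫ t in Ioo 0 T, ‖g t‖ ^ 2 := by
    rw [← integral_indicator measurableSet_Ioo]
    refine integral_congr_ae (ae_of_all _ fun t => ?_)
    by_cases ht : t ∈ Ioo 0 T
    · simp only [hĝ, indicator_of_mem ht]
    · simp [hĝ, indicator_of_notMem ht]
  have e5 : ∫ t in (-δ)..τ, ‖(ρ ⋆[ContinuousLinearMap.lsmul ℝ ℝ] ĝ) t‖ ^ 2 ≤
      ∫ t in Ioo 0 T, ‖g t‖ ^ 2 := by
    rw [← e4, intervalIntegral.integral_of_le hτ]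
    exact (setIntegral_le_integral hi (ae_of_all _ fun t => by positivity)).trans hle
  calc _ ≤ _ := key
    _ ≤ Real.exp (2 * κ * T) * (‖A‖ * ∫ t in Ioo 0 T, ‖g t‖ ^ 2) := by
        rw [intervalIntegral.integral_const_mul]
        have h1 : Real.exp (2 * κ * (τ - -δ)) ≤ Real.exp (2 * κ * T) := by
          gcongr
          linarith
        have h2 : 0 ≤ ∫ t in Ioo 0 T, ‖g t‖ ^ 2 := integral_nonneg fun t => by positivity
        exact mul_le_mul h1 (mul_le_mul_of_nonneg_left e5 (norm_nonneg _))
          (mul_nonneg (norm_nonneg _)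
            (intervalIntegral.integral_nonneg hτ fun t _ => by positivity))
          (Real.exp_nonneg _)
    _ = _ := by ring

/-- The energy estimate: the solution is controlled by its trace. -/
theorem sq_norm_le_integral_trace (hA : ∀ v w, ⟪A v, w⟫ = ⟪v, A w⟫) (hR : ∀ v, R (A v) = v)
    (hR' : ∀ v, A (R v) = v) (hκ0 : 0 ≤ κ) (hκ : ∀ v, (⟪v, H v⟫).re ≤ κ * ‖v‖ ^ 2) (hT : 0 < T)
    (hu : ContinuousOn u (Icc 0 T)) (hg : MemLp g 2 (volume.restrict (Ioo 0 T)))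
    (hav : ∀ θ : ℝ → ℂ, ContDiff ℝ ∞ θ → HasCompactSupport θ → tsupport θ ⊆ Iio T →
      HasWeakDerivIoi (fun x => A ((∫ t in Ioo 0 T, θ t • u t : L2Ioi E) x))
      (fun x => (∫ t in Ioo 0 T, deriv θ t • u t : L2Ioi E) x +
        H ((∫ t in Ioo 0 T, θ t • u t : L2Ioi E) x))
      (A (∫ t in Ioo 0 T, θ t • g t))) {t : ℝ} (ht : t ∈ Icc 0 T) :
    ‖u t‖ ^ 2 ≤ ‖A‖ * Real.exp (2 * κ * T) * ∫ t in Ioo 0 T, ‖g t‖ ^ 2 := by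
  have : CompleteSpace E := FiniteDimensional.complete ℂ E
  have hopen : ∀ τ ∈ Ioo 0 T,
      ‖u τ‖ ^ 2 ≤ ‖A‖ * Real.exp (2 * κ * T) * ∫ t in Ioo 0 T, ‖g t‖ ^ 2 := by
    intro τ hτ
    -- averages with bump functions of shrinking support converge to `u τ`
    let ρ : ℕ → ContDiffBump (0 : ℝ) := fun n =>
      ⟨((n : ℝ) + 1)⁻¹ / 2, ((n : ℝ) + 1)⁻¹, by positivity, half_lt_self (by positivity)⟩
    have hr : Tendsto (fun n => (ρ n).rOut) atTop (𝓝 0) := by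
      simpa [ρ] using tendsto_one_div_add_atTop_nhds_zero_nat (𝕜 := ℝ)
    have hûi : Integrable ((Ioo 0 T).indicator u) := by
      rw [integrable_indicator_iff measurableSet_Ioo]
      exact hu.integrableOn_Icc.mono_set Ioo_subset_Icc_self
    have hcont : Tendsto ((Ioo 0 T).indicator u) (𝓝 τ) (𝓝 (u τ)) := by
      have h1 : Tendsto u (𝓝 τ) (𝓝 (u τ)) := hu.continuousAt (Icc_mem_nhds hτ.1 hτ.2)
      refine h1.congr' ?_
      filter_upwards [Ioo_mem_nhds hτ.1 hτ.2] with s hs using (indicator_of_mem hs u).symm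
    have hlim : Tendsto (fun n => ((ρ n).normed volume ⋆[ContinuousLinearMap.lsmul ℝ ℝ]
        (Ioo 0 T).indicator u) τ) atTop (𝓝 (u τ)) :=
      ContDiffBump.convolution_tendsto_right hr
        (Eventually.of_forall fun _ => hûi.aestronglyMeasurable) (hcont.comp tendsto_snd)
        tendsto_const_nhds
    refine le_of_tendsto (hlim.norm.pow 2) ?_
    filter_upwards [hr.eventually_lt_const (sub_pos.2 hτ.2)] with n hn
    refine sq_norm_convolution_le (δ := (ρ n).rOut) hA hR hR' hκ0 hκ hu hg hav
      (ρ n).contDiff_normed (ρ n).hasCompactSupport_normed (ρ n).nonneg_normed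
      ((ρ n).integral_normed) ?_ ?_ (by linarith)
    · rw [(ρ n).tsupport_normed_eq, Real.closedBall_eq_Icc]
      simp
    · linarith [hτ.1, (ρ n).rOut_pos]
  have hcl : t ∈ closure (Ioo 0 T) := by rwa [closure_Ioo hT.ne]
  have hcw : ContinuousWithinAt u (Ioo 0 T) t := (hu t ht).mono Ioo_subset_Icc_self
  have hne : (𝓝[Ioo 0 T] t).NeBot := mem_closure_iff_nhdsWithin_neBot.1 hcl
  exact le_of_tendsto (hcw.norm.pow 2) (eventually_mem_nhdsWithin.mono hopen)

end Gronwall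

/-! ### The stability estimate -/

section Estimate

variable {E : Type*} [NormedAddCommGroup E] [InnerProductSpace ℂ E] [FiniteDimensional ℂ E]

local notation "⟪" x ", " y "⟫" => inner ℂ x y

/-- The stability estimate, with constants which do not depend on the size of `H`: a boundary lift controls
the trace, and the trace controls the solution. -/
theorem memLp_trace_and_sq_norm_add_le {p : ℕ} {A H R : E →L[ℂ] E}
    {Bm : E →L[ℂ] EuclideanSpace ℂ (Fin p)} {T γ₀ c C C' κ : ℝ} {u : ℝ → L2Ioi E} {g : ℝ → E}
    {b : ℝ → EuclideanSpace ℂ (Fin p)} {r : Fin p → ℂ → E} (hT : 0 < T)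
    (hA : ∀ v w, ⟪A v, w⟫ = ⟪v, A w⟫)
    (hR : ∀ v, R (A v) = v) (hR' : ∀ v, A (R v) = v) (hH : ∀ v w, ⟪H v, w⟫ = ⟪v, H w⟫)
    (hκ0 : 0 ≤ κ) (hκ : ∀ v, (⟪v, H v⟫).re ≤ κ * ‖v‖ ^ 2) (hγ₀ : 0 < γ₀)
    (hc : 0 < c) (hC : 0 ≤ C) (hu : ContinuousOn u (Icc 0 T))
    (hg : IntegrableOn g (Ioo 0 T)) {S : Set E} (hS : ∀ v, (∀ e ∈ S, ⟪e, v⟫ = 0) → v = 0)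
    (hw : ∀ θ ψ : ℝ → ℝ, ContDiff ℝ ∞ θ → HasCompactSupport θ → tsupport θ ⊆ Iio T →
      ContDiff ℝ ∞ ψ → HasCompactSupport ψ → ∀ e ∈ S,
      (∫ t in Ioo 0 T, ∫ x in Ioi (0 : ℝ), (((deriv θ t : ℝ) : ℂ) * ((ψ x : ℂ) * ⟪e, u t x⟫) +
        (θ t : ℂ) * (((deriv ψ x : ℝ) : ℂ) * ⟪e, A (u t x)⟫ + (ψ x : ℂ) * ⟪e, H (u t x)⟫))) +
        ∫ t in Ioo 0 T, (θ t : ℂ) * ((ψ 0 : ℂ) * ⟪e, A (g t)⟫) = 0)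
    (hb : MemLp b 2 (volume.restrict (Ioo 0 T)))
    (hbg : ∀ᵐ t ∂(volume.restrict (Ioo 0 T)), Bm (g t) = b t)
    (hdis : ∀ ξ : ℂ, γ₀ < ξ.re → ∀ v, (⟪v, H v - ξ • v⟫).re ≤ -c * ‖v‖ ^ 2)
    (hr : ∀ j w, DifferentiableOn ℂ (fun ξ => ⟪w, r j ξ⟫) {ξ | γ₀ < ξ.re})
    (hrC : ∀ ξ : ℂ, γ₀ < ξ.re → ∀ β : EuclideanSpace ℂ (Fin p), ‖∑ j, β j • r j ξ‖ ≤ C * ‖β‖)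
    (hrδ : ∀ ξ : ℂ, γ₀ < ξ.re → ∀ v δ, 0 ≤ δ →
      (∀ Z Z' : ℝ → E, (∀ x, HasDerivAt Z (Z' x) x) → ExpDecay Z →
        (∀ x, A (Z' x) = -(H (Z x) - (starRingEnd ℂ ξ) • Z x)) →
        ‖⟪A (Z 0), v⟫‖ ≤ δ * ‖Z 0‖) → ‖v - ∑ j, (Bm v) j • r j ξ‖ ≤ C' * δ) :
    MemLp g 2 (volume.restrict (Ioo 0 T)) ∧ ∀ t ∈ Icc 0 T,
      ‖u t‖ ^ 2 + ∫ s in Ioo 0 T, ‖g s‖ ^ 2 ≤ (‖A‖ * Real.exp (2 * κ * T) + 1) *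
        (Module.finrank ℂ E * (C * Real.exp ((γ₀ + 1) * T)) ^ 2) *
          ∫ s in Ioo 0 T, ‖b s‖ ^ 2 := by
  have : CompleteSpace E := FiniteDimensional.complete ℂ E
  have hav := fun (θ : ℝ → ℂ) (h1 : ContDiff ℝ ∞ θ) (h2 : HasCompactSupport θ)
    (h3 : tsupport θ ⊆ Iio T) => hasWeakDerivIoi_average hA hH hu hg hS hw h1 h2 h3
  have hb0 : 0 ≤ ∫ s in Ioo 0 T, ‖b s‖ ^ 2 := integral_nonneg fun s => by positivity
  obtain ⟨hg2, hgb⟩ := memLp_two_of_norm_integral_mul_inner_le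
    (M := C * Real.exp ((γ₀ + 1) * T) * Real.sqrt (∫ s in Ioo 0 T, ‖b s‖ ^ 2)) (by positivity) hg
    fun w φ h1 h2 h3 => by
      refine (norm_integral_mul_inner_trace_le hA hR hH hγ₀ hc hC hu hg hav hb hbg hdis hr hrC hrδ
        w h1 h2 h3).trans_eq ?_
      ring
  refine ⟨hg2, fun t ht => ?_⟩
  have h1 := sq_norm_le_integral_trace hA hR hR' hκ0 hκ hT hu hg2 hav ht
  rw [mul_pow _ (Real.sqrt _), Real.sq_sqrt hb0, ← mul_assoc] at hgb
  calc _ ≤ (‖A‖ * Real.exp (2 * κ * T) + 1) * ∫ s in Ioo 0 T, ‖g s‖ ^ 2 := by linarith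
    _ ≤ _ := by
      rw [mul_assoc (_ + 1)]
      exact mul_le_mul_of_nonneg_left hgb (by positivity)

end Estimate

/-! ### The relaxation problem -/

section Relaxation

variable {ι : Type*} [Fintype ι] [DecidableEq ι] {p : ℕ}

/-- Real vectors suffice to test a complex vector. -/
theorem eq_zero_of_inner_complexify {v : EuclideanSpace ℂ ι}
    (h : ∀ e ∈ range (complexify (ι := ι)), inner ℂ e v = 0) : v = 0 := by
  ext i
  have h1 := h _ ⟨EuclideanSpace.single i 1, rfl⟩
  have h2 : complexify (EuclideanSpace.single i (1 : ℝ)) = EuclideanSpace.single i (1 : ℂ) := by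
    ext j
    rw [complexify_apply]
    by_cases hj : j = i <;> simp [hj]
  rw [h2, EuclideanSpace.inner_single_left] at h1
  simpa using h1

variable {A Q Qbar : Matrix ι ι ℝ} {B : Matrix (Fin p) ι ℝ} {ε T : ℝ}
  {b : ℝ → EuclideanSpace ℝ (Fin p)} {U : ℝ → HalfLineL2 ι} {g : ℝ → EuclideanSpace ℝ ι}

/-- The separated weak formulation for the complexified solution. -/
theorem IsRelaxationSolution.weak_prod_complexify
    (h : IsRelaxationSolution A Q Qbar B ε T b 0 U g) {u : ℝ → ℝ → EuclideanSpace ℂ ι}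
    (hu : ∀ t, u t =ᵐ[volume.restrict (Ioi (0 : ℝ))] fun x => complexify (U t x)) {θ ψ : ℝ → ℝ}
    (hθ : ContDiff ℝ ∞ θ) (hθc : HasCompactSupport θ) (hθs : tsupport θ ⊆ Iio T)
    (hψ : ContDiff ℝ ∞ ψ) (hψc : HasCompactSupport ψ) (e : EuclideanSpace ℝ ι) :
    (∫ t in Ioo 0 T, ∫ x in Ioi (0 : ℝ),
      (((deriv θ t : ℝ) : ℂ) * ((ψ x : ℂ) * inner ℂ (complexify e) (u t x)) +
        (θ t : ℂ) * (((deriv ψ x : ℝ) : ℂ) * inner ℂ (complexify e) (A.complexCLM (u t x)) +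
          (ψ x : ℂ) * inner ℂ (complexify e) ((ε⁻¹ • Q + Qbar).complexCLM (u t x))))) +
      ∫ t in Ioo 0 T, (θ t : ℂ) *
        ((ψ 0 : ℂ) * inner ℂ (complexify e) (A.complexCLM (complexify (g t)))) = 0 := by
  have h1 := congrArg (fun z : ℝ => (z : ℂ)) (h.weak_prod hθ hθc hθs hψ hψc e)
  simp only [Complex.ofReal_add, ← integral_complex_ofReal, Complex.ofReal_zero] at h1
  refine Eq.trans (congrArg₂ (· + ·) ?_ ?_) h1
  · refine integral_congr_ae (ae_of_all _ fun t => integral_congr_ae ?_)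
    filter_upwards [hu t] with x hx
    rw [hx, complexCLM_complexify, complexCLM_complexify, inner_complexify, inner_complexify,
      inner_complexify]
    push_cast
    ring
  · refine integral_congr_ae (ae_of_all _ fun t => ?_)
    simp only
    rw [complexCLM_complexify, inner_complexify]
    push_cast
    ring

end Relaxation

section Stability

variable {ι : Type*} [Fintype ι] [DecidableEq ι] {p : ℕ}

theorem Matrix.dotProduct_fromBlocks_mulVec_nonpos {r m : ℕ} {S : Matrix (Fin m) (Fin m) ℝ}
    (hS : (-S).PosDef) (x : Fin r ⊕ Fin m → ℝ) :
    x ⬝ᵥ Matrix.fromBlocks 0 0 0 S *ᵥ x ≤ 0 := by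
  have h := hS.posSemidef.dotProduct_mulVec_nonneg (x ∘ Sum.inr)
  rw [Matrix.fromBlocks_mulVec]
  simp only [dotProduct, Fintype.sum_sum_type]
  simp [Matrix.neg_mulVec, dotProduct] at h ⊢
  exact h

variable {A Q Qbar : Matrix ι ι ℝ} {B : Matrix (Fin p) ι ℝ}

omit [DecidableEq ι] in
theorem memLp_complexify_iff {f : ℝ → EuclideanSpace ℝ ι} {μ : Measure ℝ}
    (hf : AEStronglyMeasurable f μ) :
    MemLp (fun t => complexify (f t)) 2 μ ↔ MemLp f 2 μ :=
  memLp_congr_norm (isometry_complexify.continuous.comp_aestronglyMeasurable hf) hf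
    (ae_of_all _ fun t => norm_complexify (f t))

/-- The estimate for a negative semidefinite relaxation matrix, uniformly in the relaxation time. -/
theorem exists_uniform_stability_estimate (hA : A.IsSymm) (hdet : A.det ≠ 0) (hQs : Q.IsSymm)
    (hQ : ∀ x : ι → ℝ, x ⬝ᵥ Q *ᵥ x ≤ 0) (hK : Qbar.IsSymm) (hp : p = numPosEigenvalues A)
    (hB : GeneralizedKreissCondition A Q B) {T : ℝ} (hT : 0 < T) :
    ∃ C : ℝ, 0 < C ∧ ∀ ε : ℝ, 0 < ε →
      ∀ (b : ℝ → EuclideanSpace ℝ (Fin p)) (U : ℝ → HalfLineL2 ι) (g : ℝ → EuclideanSpace ℝ ι),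
        MemLp b 2 (volume.restrict (Ioo 0 T)) → IsRelaxationSolution A Q Qbar B ε T b 0 U g →
        MemLp g 2 (volume.restrict (Ioo 0 T)) ∧ ∀ t ∈ Icc 0 T,
          ‖U t‖ ^ 2 + ∫ s in Ioo 0 T, ‖g s‖ ^ 2 ≤ C * ∫ s in Ioo 0 T, ‖b s‖ ^ 2 := by
  have hAi := Matrix.complexCLM_inv_apply hdet
  have hAi' := Matrix.inv_complexCLM_apply hdet
  obtain ⟨γ₀, c, D, D', hγ₀, hc, hD, -, hlift⟩ :=
    exists_uniform_boundary_lift hA hdet hQs hQ hK hp hB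
  -- the contribution `η Q` to the energy is nonpositive, so only `Qbar` enters the constant
  set C := (‖A.complexCLM‖ * Real.exp (2 * ‖Qbar.complexCLM‖ * T) + 1) *
    (Module.finrank ℂ (EuclideanSpace ℂ ι) * (D * Real.exp ((γ₀ + 1) * T)) ^ 2)
  have hC : 0 ≤ C := by positivity
  -- `C` may vanish, for instance for `A` of size `0`
  refine ⟨C + 1, by positivity, fun ε hε b U g hb h => ?_⟩
  obtain ⟨hdis, r, hr, hrD, hrδ⟩ := hlift ε⁻¹ (inv_nonneg.2 hε.le)
  have hκ : ∀ v, (inner ℂ v ((ε⁻¹ • Q + Qbar).complexCLM v)).re ≤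
      ‖Qbar.complexCLM‖ * ‖v‖ ^ 2 := fun v => by
    rw [Matrix.complexCLM_smul_add, _root_.add_apply, _root_.smul_apply, inner_add_right,
      inner_smul_right, Complex.add_re, Complex.re_ofReal_mul]
    have h1 := mul_nonpos_of_nonneg_of_nonpos (inv_nonneg.2 hε.le)
      (Matrix.re_inner_complexCLM_nonpos hQ v)
    have h2 := (abs_le.1 (abs_re_inner_apply_le Qbar.complexCLM v)).2
    linarith
  have hcont : ContinuousOn (fun t => complexifyL2 (U t)) (Icc 0 T) :=
    (continuous_complexifyL2).comp_continuousOn h.continuousOn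
  have hgi : IntegrableOn (fun t => complexify (g t)) (Ioo 0 T) :=
    h.integrableOn_trace.congr'
      (isometry_complexify.continuous.comp_aestronglyMeasurable h.integrableOn_trace.1)
      (ae_of_all _ fun t => (norm_complexify (g t)).symm)
  have hbC := (memLp_complexify_iff hb.1).2 hb
  have hbg : ∀ᵐ t ∂(volume.restrict (Ioo 0 T)),
      B.complexCLM (complexify (g t)) = complexify (b t) := by
    filter_upwards [h.boundary] with t ht
    rw [complexCLM_complexify, ht]
  have hHs := ((hQs.smul ε⁻¹).add hK).inner_complexCLM
  have hw := fun θ ψ h1 h2 h3 h4 h5 e => h.weak_prod_complexify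
    (fun t => complexifyL2_ae_eq (U t)) (θ := θ) (ψ := ψ) h1 h2 h3 h4 h5 e
  obtain ⟨h1, h2⟩ := memLp_trace_and_sq_norm_add_le hT hA.inner_complexCLM hAi' hAi hHs
    (norm_nonneg _) hκ hγ₀ hc hD hcont hgi (S := range complexify)
    (fun v => eq_zero_of_inner_complexify)
    (fun θ ψ h1 h2 h3 h4 h5 e he => by
      obtain ⟨e, rfl⟩ := he
      exact hw θ ψ h1 h2 h3 h4 h5 e) hbC hbg hdis hr hrD hrδ
  refine ⟨(memLp_complexify_iff h.integrableOn_trace.1).1 h1, fun t ht => ?_⟩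
  have h3 := h2 t ht
  simp only [norm_complexify, norm_complexifyL2] at h3
  have h4 : 0 ≤ ∫ s in Ioo 0 T, ‖b s‖ ^ 2 := integral_nonneg fun s => by positivity
  linarith

end Stability

theorem propositionA2 {r m p : ℕ}
    (A Qbar : Matrix (Fin r ⊕ Fin m) (Fin r ⊕ Fin m) ℝ) (S : Matrix (Fin m) (Fin m) ℝ)
    (B : Matrix (Fin p) (Fin r ⊕ Fin m) ℝ)
    (hA : A.IsSymm) (hAdet : A.det ≠ 0) (hS : (-S).PosDef) (hQbar : Qbar.IsSymm)
    (hp : p = numPosEigenvalues A)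
    (hGKC : GeneralizedKreissCondition A (Matrix.fromBlocks 0 0 0 S) B) :
    ∃ ε₀ : ℝ, 0 < ε₀ ∧ ∀ T : ℝ, 0 < T → ∃ C : ℝ, 0 < C ∧
      ∀ ε : ℝ, 0 < ε → ε < ε₀ →
      ∀ (b : ℝ → EuclideanSpace ℝ (Fin p)) (U : ℝ → HalfLineL2 (Fin r ⊕ Fin m))
        (g : ℝ → EuclideanSpace ℝ (Fin r ⊕ Fin m)),
        MemLp b 2 (volume.restrict (Ioo 0 T)) →
        IsRelaxationSolution A (Matrix.fromBlocks 0 0 0 S) Qbar B ε T b 0 U g →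
        MemLp g 2 (volume.restrict (Ioo 0 T)) ∧
        ∀ t ∈ Icc 0 T,
          ‖U t‖ ^ 2 + ∫ s in Ioo 0 T, ‖g s‖ ^ 2 ≤ C * ∫ s in Ioo 0 T, ‖b s‖ ^ 2 := by
  have hSs : S.IsSymm := by
    have h := hS.isHermitian
    rw [Matrix.isHermitian_iff_isSymm] at h
    simpa using h.neg
  have hQs : (Matrix.fromBlocks 0 0 0 S : Matrix (Fin r ⊕ Fin m) (Fin r ⊕ Fin m) ℝ).IsSymm :=
    Matrix.IsSymm.fromBlocks Matrix.isSymm_zero (by simp) hSs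
  -- the estimate holds for every relaxation time, so any `ε₀` will do
  refine ⟨1, one_pos, fun T hT => ?_⟩
  obtain ⟨C, hC, h⟩ := exists_uniform_stability_estimate hA hAdet hQs
    (Matrix.dotProduct_fromBlocks_mulVec_nonpos hS) hQbar hp hGKC hT
  exact ⟨C, hC, fun ε hε _ => h ε hε⟩
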